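/- **Conventions.** Let $[n]=\frac{q^n-q^{-n}}{q-q^{-1}}$, $[n]!=[1]\cdots[n]$, $[0]!=1$. A triple of natural numbers $(a,b,c)$ is *admissible* if it satisfies the triangle inequalities and $a+b+c$ is even; it is *red* if at least two of $\frac{a+b-c}2,\frac{b+c-a}2,\frac{c+a-b}2$ are odd. The Kauffman brackets of the colored planar unknot, theta graph and tetrahedron graph are $$\bigcirc_a=(-1)^a[a+1],\qquad \Theta_{a,b,c}=(-1)^{\frac{a+b+c}2}\,\frac{[\frac{a+b+c}2+1]!\,[\frac{a+b-c}2]!\,[\frac{b+c-a}2]!\,[\frac{c+a-b}2]!}{[a]!\,[b]!\,[c]!},$$ $$\mathrm{Tet}(a,b,c,d,e,f)=\frac{\prod_{i,j}[\square_i-\triangle_j]!}{[a]!\,[b]!\,[c]!\,[d]!\,[e]!\,[f]!}\ \sum_{z=\max\triangle_j}^{\min\square_i}(-1)^z\frac{[z+1]!}{\prod_j[z-\triangle_j]!\,\prod_i[\square_i-z]!},$$ where $\triangle_1=\frac{a+b+c}2$, $\triangle_2=\frac{a+e+f}2$, $\triangle_3=\frac{d+b+f}2$, $\triangle_4=\frac{d+e+c}2$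 (the triples being the colors at the four vertices) and $\square_1=\frac{a+b+d+e}2$, $\square_2=\frac{a+c+d+f}2$, $\square_3=\frac{b+c+e+f}2$. A *simple polyhedron* $X$ is a compact 2-dimensional polyhedron in which every point is the apex of a neighborhood that is (PL) a cone over a circle, a theta graph, the 1-skeleton of a tetrahedron, a closed interval, or a tripod (the cone over three points). The points of these five types form respectively the *regions* $f$, the *interior edges* $e$ (open segments or circles), the *interior vertices* $v$, the *boundary edges* $e_\partial$ and the *boundary vertices* $v_\partial$ of $X$ (connected components). The last two types form the trivalent graph $\partial X$. A *shadow* carries on every region $f$ a half-integer $g_f\in\frac12\mathbb Z$, its *gleam*. An *admissible coloring* $\sigma$ of $X$ assigns a natural number $\sigma_f$ to every region $f$ so that the colors of the three regions incident to each interior edge form an admissible triple; it induces a coloring of the edges of $\partial X$. Its *evaluation* is $$\langle X_\sigma\rangle=\frac{\prod_f\bigcirc_f^{\chi(f)}q_f\ \prod_v\mathrm{Tet}_v\ \prod_{v_\partial}\Theta_{v_\partial}}{\prod_e\Theta_e^{\chi(e)}\ \prod_{e_\partial}\bigcirc_{e_\partial}^{\chi(e_\partial)}},\qquad q_f=(\sqrt{-1})^{2g_f\sigma_f}\,q^{-\frac{g_f\sigma_f}2(\sigma_f+2)},$$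 each graph being colored by the regions incident to the stratum (open segments have $\chi=1$, circles $\chi=0$). It is a meromorphic function of $q$ near $q=i$ (with the principal branch of $q^{1/4}$), and $\mathrm{ord}_i\in\mathbb Z\cup\{+\infty\}$ denotes its order at $q=i$. **Theorem 4.4.** Let $X$ be a simple polyhedron with arbitrary half-integer gleams on its regions; for instance, a shadow of a framed knotted trivalent graph in $S^3$. (1) For every admissible coloring $\sigma$ of $X$, $$\mathrm{ord}_i\langle X_\sigma\rangle\ \ge\ \chi(S_\sigma)-\frac r2 ,$$ where $S_\sigma\subset X$ is the odd surface (the closure of the union of the regions with odd color) and $r$ is the number of red vertices of $\partial X$, that is of boundary vertices at which the colors of the three incident edges of $\partial X$ form a red triple. (2) Suppose moreover that $X$ collapses onto a graph or a point (as shadows do). Let $\psi$ be a coloring of the edges of $\partial X$ by natural numbers. Then only finitely many admissible colorings $\sigma$ of $X$ extend $\psi$, and if $S\subset X$ is a properly embedded surface whose boundary is the odd sublink of $\partial X$ (the union of the edges with odd color), then $$\mathrm{ord}_i\Big(\sum_\sigma\langle X_\sigma\rangle\Big)\ \ge\ \chi(S)-\frac r2,$$ where $\sigma$ runs over the admissible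 colorings that extend $\psi$ and $r$ is the number of red vertices of $(\partial X,\psi)$. In particular, if $\partial X$ is a link $L$ colored by $1$, this state sum has order at least $\chi(S)$ at $q=i$ for the surface $S\subset X$ with $\partial S=L$. -/

import Mathlib

/-! ## Quantum integers and the Kauffman brackets of the circle, theta and tetrahedron graphs

All these are functions of a complex variable `q`. -/

namespace Quantum

/-- The quantum integer `[n] = (q ^ n - q ^ (-n)) / (q - q ^ (-1))`. -/
noncomputable def qInt (n : ℕ) (q : ℂ) : ℂ := (q ^ n - q⁻¹ ^ n) / (q - q⁻¹)

/-- The quantum factorial `[n]! = [1] ⋯ [n]`, with `[0]! = 1`. -/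
noncomputable def qFact (n : ℕ) (q : ℂ) : ℂ := ∏ k ∈ Finset.range n, qInt (k + 1) q

/-- A triple of colors `{a, b, c}` is admissible if it satisfies the triangle inequalities
(`2 * c ≤ a + b + c`, that is `c ≤ a + b`, and so on) and `a + b + c` is even. -/
def Admissible (m : Multiset ℕ) : Prop :=
  m.card = 3 ∧ Even m.sum ∧ ∀ x ∈ m, 2 * x ≤ m.sum

/-- For an admissible triple `m = {a, b, c}` the three numbers `m.sum / 2 - x` are
`(a + b - c) / 2`, `(b + c - a) / 2` and `(c + a - b) / 2`.  The triple is red if at least two of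
them are odd. -/
def Red (m : Multiset ℕ) : Prop := 2 ≤ (m.filter fun x => Odd (m.sum / 2 - x)).card

/-- The Kauffman bracket of the unknot colored by `a`. -/
noncomputable def circ (a : ℕ) (q : ℂ) : ℂ := (-1) ^ a * qInt (a + 1) q

/-- The Kauffman bracket of the planar theta graph whose edges are colored by an admissible triple
`m = {a, b, c}`; see `theta_eq` for the explicit formula. -/
noncomputable def theta (m : Multiset ℕ) (q : ℂ) : ℂ :=
  (-1) ^ (m.sum / 2) * (qFact (m.sum / 2 + 1) q * (m.map fun x => qFact (m.sum / 2 - x) q).prod) /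
    (m.map fun x => qFact x q).prod

theorem theta_eq (a b c : ℕ) (q : ℂ) :
    theta {a, b, c} q = (-1) ^ ((a + b + c) / 2) *
      (qFact ((a + b + c) / 2 + 1) q * (qFact ((a + b + c) / 2 - a) q *
        qFact ((a + b + c) / 2 - b) q * qFact ((a + b + c) / 2 - c) q)) /
      (qFact a q * qFact b q * qFact c q) := by
  simp [theta, mul_assoc, add_assoc]

/-- The Kauffman bracket of the planar tetrahedron graph with edges colored by `a, b, c, d, e, f`:
the three edges at the four vertices have colors `(a, b, c)`, `(a, e, f)`, `(d, b, f)`,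
`(d, e, c)`. -/
noncomputable def tet (a b c d e f : ℕ) (q : ℂ) : ℂ :=
  let T : Fin 4 → ℕ := ![(a + b + c) / 2, (a + e + f) / 2, (d + b + f) / 2, (d + e + c) / 2]
  let Q : Fin 3 → ℕ := ![(a + b + d + e) / 2, (a + c + d + f) / 2, (b + c + e + f) / 2]
  (∏ i, ∏ j, qFact (Q i - T j) q) /
      (qFact a q * qFact b q * qFact c q * qFact d q * qFact e q * qFact f q) *
    ∑ z ∈ Finset.Icc (Finset.univ.sup T) (Finset.univ.inf' Finset.univ_nonempty Q),
      (-1) ^ z * (qFact (z + 1) q / ((∏ j, qFact (z - T j) q) * ∏ i, qFact (Q i - z) q))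

/-- The phase `(√-1) ^ (2 g c) * q ^ (- g c (c + 2) / 2)` of a region with gleam `g` and color `c`.
The power of `q` is the branch, near `q = i`, given by the principal logarithm. -/
noncomputable def phase (g : ℚ) (c : ℕ) (q : ℂ) : ℂ :=
  Complex.I ^ ((2 * g * c : ℚ) : ℂ) * q ^ ((-(g * c / 2 * (c + 2)) : ℚ) : ℂ)

/-- The order at `q = i` of a function that is meromorphic at `i` (`⊤` if it vanishes near `i`),
regarded as an element of `ℚ ∪ {⊤}`. -/
noncomputable def ordI (f : ℂ → ℂ) : WithTop ℚ :=
  (meromorphicOrderAt f Complex.I).map fun n : ℤ => (n : ℚ)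

end Quantum

/-! ## Homeomorphism types of finite graphs -/

namespace SimpleGraph

variable {W : Type*}

/-- The valence of a vertex (meaningful if `G` is locally finite). -/
noncomputable def valence (G : SimpleGraph W) (x : W) : ℕ := (G.neighborSet x).ncard

/-- There is an embedded arc in `G` which starts at `x` along the edge `xz`, ends at `y`, and whose
interior vertices all have valence two. -/
def ArcVia (G : SimpleGraph W) (x z y : W) : Prop :=
  x ≠ y ∧ ∃ p : G.Walk x y, p.IsPath ∧ p.snd = z ∧
    ∀ w ∈ p.support, w ≠ x → w ≠ y → G.valence w = 2

/-- `G` is homeomorphic to a circle. -/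
def IsCircle (G : SimpleGraph W) : Prop := G.Connected ∧ ∀ x, G.valence x = 2

/-- `G` is homeomorphic to the theta graph: two trivalent vertices joined by three arcs. -/
def IsTheta (G : SimpleGraph W) : Prop :=
  G.Connected ∧ ∃ x y, x ≠ y ∧ G.valence x = 3 ∧ G.valence y = 3 ∧
    (∀ w, w ≠ x → w ≠ y → G.valence w = 2) ∧ ∀ z, G.Adj x z → G.ArcVia x z y

/-- The vertices `x 0, …, x 3` are trivalent, are pairwise joined by arcs, and all other vertices
have valence two. -/
def IsTetraFrame (G : SimpleGraph W) (x : Fin 4 → W) : Prop :=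
  Function.Injective x ∧ (∀ i, G.valence (x i) = 3) ∧
    (∀ w, w ∉ Set.range x → G.valence w = 2) ∧ ∀ i j, i ≠ j → ∃ z, G.ArcVia (x i) z (x j)

/-- `G` is homeomorphic to the 1-skeleton of a tetrahedron. -/
def IsTetra (G : SimpleGraph W) : Prop := G.Connected ∧ ∃ x, G.IsTetraFrame x

/-- `G` is homeomorphic to a closed interval. -/
def IsInterval (G : SimpleGraph W) : Prop :=
  G.Connected ∧ ∃ x y, x ≠ y ∧ G.valence x = 1 ∧ G.valence y = 1 ∧
    ∀ w, w ≠ x → w ≠ y → G.valence w = 2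

/-- `G` is homeomorphic to the cone over three points. -/
def IsTripod (G : SimpleGraph W) : Prop :=
  G.Connected ∧ ∃ (x : W) (y : Fin 3 → W), Function.Injective y ∧ G.valence x = 3 ∧
    (∀ i, G.valence (y i) = 1) ∧ (∀ w, w ≠ x → w ∉ Set.range y → G.valence w = 2) ∧
    ∀ i, ∃ z, G.ArcVia x z (y i)

end SimpleGraph

/-! ## Sets of open simplices

A set `P` of simplices of a simplicial complex stands for the union of the corresponding open
simplices. -/

namespace Simplices

variable {V : Type*}

/-- Two open simplices are adjacent if one of them is a proper face of the other. -/
def incidence (P : Set (Finset V)) : SimpleGraph P where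
  Adj s t := s.1 ⊂ t.1 ∨ t.1 ⊂ s.1
  symm := ⟨fun _ _ h => h.symm⟩
  loopless := ⟨fun s h => h.elim (fun h => (ssubset_irrefl s.1) h) (fun h => (ssubset_irrefl s.1) h)⟩

/-- The connected components of the union of the open simplices in `P`. -/
abbrev Component (P : Set (Finset V)) : Type _ := (incidence P).ConnectedComponent

/-- The open simplices that constitute a connected component. -/
def Component.simplices {P : Set (Finset V)} (C : Component P) : Set (Finset V) :=
  {s | ∃ h : s ∈ P, (incidence P).connectedComponentMk ⟨s, h⟩ = C}

/-- The value at the open simplex `s` of a function on the components (`0` if `s ∉ P`). -/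
noncomputable def valueAt {P : Set (Finset V)} (σ : Component P → ℕ) (s : Finset V) : ℕ :=
  open Classical in
  if h : s ∈ P then σ ((incidence P).connectedComponentMk ⟨s, h⟩) else 0

/-- The Euler characteristic of the union `U` of the open simplices in a finite set `A` (not
necessarily a subcomplex).  The space `U` deformation retracts onto its intersection with the
subcomplex of the barycentric subdivision spanned by the barycenters of the simplices in `A`, whose
simplices are the nonempty chains of elements of `A`; so this is the homotopy-invariant Euler
characteristic: `1` for an open segment or an open disc, `0` for a circle. -/
noncomputable def eulerChar (A : Set (Finset V)) : ℤ :=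
  ∑ᶠ c ∈ {c : Finset (Finset V) | c.Nonempty ∧ (c : Set (Finset V)) ⊆ A ∧
    IsChain (· ⊆ ·) (c : Set (Finset V))}, (-1) ^ (c.card + 1)

/-- Elementary collapse: remove a simplex `s` that is a proper face of only one simplex `t`,
together with `t`. -/
def ElementaryCollapse (A B : Set (Finset V)) : Prop :=
  ∃ s ∈ A, ∃ t ∈ A, s ⊂ t ∧ (∀ u ∈ A, s ⊂ u → u = t) ∧ B = A \ {s, t}

end Simplices

/-! ## Simple polyhedra -/

namespace PreAbstractSimplicialComplex

variable {V : Type*} [DecidableEq V]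

/-- The vertices of the link of `v`. -/
abbrev LinkVertex (K : PreAbstractSimplicialComplex V) (v : V) : Type _ :=
  {x : V // x ≠ v ∧ ({v, x} : Finset V) ∈ K.faces}

/-- The (1-skeleton of the) link of the vertex `v`. -/
def linkGraph (K : PreAbstractSimplicialComplex V) (v : V) : SimpleGraph (K.LinkVertex v) where
  Adj x y := x ≠ y ∧ ({v, x.1, y.1} : Finset V) ∈ K.faces
  symm := ⟨fun x y h => ⟨h.1.symm, by rw [Finset.pair_comm]; exact h.2⟩⟩
  loopless := ⟨fun _ h => h.1 rfl⟩

end PreAbstractSimplicialComplex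

/-- A (triangulated) simple polyhedron: a finite simplicial complex of dimension at most two in
which the star of every vertex is the cone over one of the following graphs:
* a circle (the vertex is an interior point of a region),
* a theta graph (the vertex lies on an interior edge),
* the 1-skeleton of a tetrahedron (the vertex is an interior vertex of the polyhedron),
* an interval (the vertex lies on a boundary edge),
* a cone over three points (the vertex is a boundary vertex of the polyhedron). -/
structure SimplePolyhedron (V : Type*) [DecidableEq V] extends PreAbstractSimplicialComplex V where
  finite_faces : faces.Finite
  card_le : ∀ s ∈ faces, s.card ≤ 3
  link_type : ∀ v : V, {v} ∈ faces →
    (toPreAbstractSimplicialComplex.linkGraph v).IsCircle ∨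
    (toPreAbstractSimplicialComplex.linkGraph v).IsTheta ∨
    (toPreAbstractSimplicialComplex.linkGraph v).IsTetra ∨
    (toPreAbstractSimplicialComplex.linkGraph v).IsInterval ∨
    (toPreAbstractSimplicialComplex.linkGraph v).IsTripod

namespace SimplePolyhedron

open Simplices Quantum

variable {V : Type*} [DecidableEq V] (X : SimplePolyhedron V)

/-- The link of a vertex. -/
abbrev link (v : V) : SimpleGraph (X.LinkVertex v) := X.toPreAbstractSimplicialComplex.linkGraph v

/-- The triangles containing the simplex `s`. -/
noncomputable def cofaces (s : Finset V) : Finset (Finset V) :=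
  X.finite_faces.toFinset.filter fun t => t.card = 3 ∧ s ⊆ t

/-- The 1-simplices of the triangulation that are contained in exactly `k` triangles: for
`k = 1, 2, 3` they lie respectively on boundary edges, in regions, on interior edges. -/
def segments (k : ℕ) : Set (Finset V) :=
  {s | s ∈ X.faces ∧ s.card = 2 ∧ (X.cofaces s).card = k}

/-! ### Strata -/

/-- The open simplices whose points have a neighborhood homeomorphic to a disc. -/
def regionSimplices : Set (Finset V) :=
  {s | s ∈ X.faces ∧ s.card = 3} ∪ X.segments 2 ∪ {s | s ∈ X.faces ∧ ∃ v, s = {v} ∧ (X.link v).IsCircle}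

/-- The open simplices whose points have a neighborhood homeomorphic to the product of an open
segment and a cone over three points. -/
def intEdgeSimplices : Set (Finset V) :=
  X.segments 3 ∪ {s | s ∈ X.faces ∧ ∃ v, s = {v} ∧ (X.link v).IsTheta}

/-- The open simplices whose points have a neighborhood homeomorphic to a half-disc, and lie on its
diameter. -/
def bdryEdgeSimplices : Set (Finset V) :=
  X.segments 1 ∪ {s | s ∈ X.faces ∧ ∃ v, s = {v} ∧ (X.link v).IsInterval}

/-- The regions of the simple polyhedron. -/
abbrev Region : Type _ := Component X.regionSimplices

/-- The interior edges of the simple polyhedron (open segments or circles). -/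
abbrev IntEdge : Type _ := Component X.intEdgeSimplices

/-- The boundary edges of the simple polyhedron (open segments or circles). -/
abbrev BdryEdge : Type _ := Component X.bdryEdgeSimplices

/-- The interior vertices of the simple polyhedron. -/
abbrev IntVertex : Type _ := {v : V // {v} ∈ X.faces ∧ (X.link v).IsTetra}

/-- The boundary vertices of the simple polyhedron. -/
abbrev BdryVertex : Type _ := {v : V // {v} ∈ X.faces ∧ (X.link v).IsTripod}

instance finite_component (P : Set (Finset V)) [Finite P] : Finite (Component P) :=
  Quot.finite _

instance finite_regionSimplices : Finite X.regionSimplices :=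
  (X.finite_faces.subset (by rintro s ((h | h) | h) <;> exact h.1)).to_subtype

instance finite_intEdgeSimplices : Finite X.intEdgeSimplices :=
  (X.finite_faces.subset (by rintro s (h | h) <;> exact h.1)).to_subtype

instance finite_bdryEdgeSimplices : Finite X.bdryEdgeSimplices :=
  (X.finite_faces.subset (by rintro s (h | h) <;> exact h.1)).to_subtype

theorem finite_vertices (p : V → Prop) : Finite {v : V // {v} ∈ X.faces ∧ p v} :=
  haveI : Finite X.faces := X.finite_faces.to_subtype
  Finite.of_injective (fun v : {v : V // {v} ∈ X.faces ∧ p v} => (⟨{v.1}, v.2.1⟩ : X.faces))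
    fun _ _ h => Subtype.ext (Finset.singleton_injective (congrArg Subtype.val h))

instance finite_intVertex : Finite X.IntVertex := X.finite_vertices _

instance finite_bdryVertex : Finite X.BdryVertex := X.finite_vertices _

noncomputable instance fintypeRegion : Fintype X.Region := Fintype.ofFinite _
noncomputable instance fintypeIntEdge : Fintype X.IntEdge := Fintype.ofFinite _
noncomputable instance fintypeBdryEdge : Fintype X.BdryEdge := Fintype.ofFinite _
noncomputable instance fintypeIntVertex : Fintype X.IntVertex := Fintype.ofFinite _
noncomputable instance fintypeBdryVertex : Fintype X.BdryVertex := Fintype.ofFinite _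

/-! ### Colorings -/

variable {X}

/-- The colors of the triangles (that is, of the germs of regions) containing the 1-simplex `s`. -/
noncomputable def segmentColors (σ : X.Region → ℕ) (s : Finset V) : Multiset ℕ :=
  (X.cofaces s).val.map (valueAt σ)

/-- A coloring of the regions is admissible if the colors of the three (germs of) regions incident
to every interior edge form an admissible triple. -/
def IsAdmissible (σ : X.Region → ℕ) : Prop :=
  ∀ s ∈ X.segments 3, Admissible (segmentColors σ s)

/-- The colors of the (germs of) regions incident to an edge, read off at any 1-simplex of the
edge: the three colors of the regions incident to an interior edge, the color of the region incident
to a boundary edge. -/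
noncomputable def edgeColors (σ : X.Region → ℕ) {P : Set (Finset V)} (e : Component P) :
    Multiset ℕ :=
  open Classical in
  if h : ∃ s ∈ e.simplices, s.card = 2 then segmentColors σ h.choose else 0

/-- Let `x`, `y` be vertices of the link of `v` joined by an arc as in `SimpleGraph.ArcVia`.  This
is the color of the germ at `v` of the region that is the cone over the interior of this arc. -/
noncomputable def sectorColor (σ : X.Region → ℕ) (v : V) (x y : X.LinkVertex v) : ℕ :=
  open Classical in
  if h : ∃ z, (X.link v).ArcVia x z y then valueAt σ {v, x.1, h.choose.1} else 0

/-- The bracket of the tetrahedron graph given by the link of an interior vertex `v`, whose edges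
are colored as the six germs of regions at `v`.  The choice of the numbering of its four vertices
does not matter, because of the symmetries of `tet`. -/
noncomputable def vertexTet (σ : X.Region → ℕ) (v : X.IntVertex) : ℂ → ℂ :=
  let x := v.2.2.2.choose
  tet (sectorColor σ v.1 (x 0) (x 1)) (sectorColor σ v.1 (x 0) (x 2))
    (sectorColor σ v.1 (x 0) (x 3)) (sectorColor σ v.1 (x 2) (x 3))
    (sectorColor σ v.1 (x 1) (x 3)) (sectorColor σ v.1 (x 1) (x 2))

/-- Given colors `c` of the boundary 1-simplices: the colors of the three edges of the trivalent
graph `∂X` incident to one of its vertices. -/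
noncomputable def bdryVertexColors (c : Finset V → ℕ) (v : X.BdryVertex) : Multiset ℕ :=
  open Classical in
  (X.finite_faces.toFinset.filter fun s => s ∈ X.segments 1 ∧ v.1 ∈ s).val.map c

/-- The color induced by `σ` on a boundary 1-simplex `s`, that is the color of the unique triangle
containing `s`. -/
noncomputable def bdryColor (σ : X.Region → ℕ) (s : Finset V) : ℕ := (segmentColors σ s).sum

variable (X) in
/-- The number of red vertices of the trivalent graph `∂X`, whose 1-simplices are colored by `c`. -/
noncomputable def numRed (c : Finset V → ℕ) : ℕ :=
  {v : X.BdryVertex | Red (bdryVertexColors c v)}.ncard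

/-- The evaluation `⟨X_σ⟩` of the coloring `σ` of the simple polyhedron `X` with gleams `gl`. -/
noncomputable def state (gl : X.Region → ℚ) (σ : X.Region → ℕ) (q : ℂ) : ℂ :=
  ((∏ f : X.Region, circ (σ f) q ^ eulerChar f.simplices * phase (gl f) (σ f) q) *
      (∏ v : X.IntVertex, vertexTet σ v q) *
      ∏ v : X.BdryVertex, theta (bdryVertexColors (bdryColor σ) v) q) /
    ((∏ e : X.IntEdge, theta (edgeColors σ e) q ^ eulerChar e.simplices) *
      ∏ e : X.BdryEdge, circ (edgeColors σ e).sum q ^ eulerChar e.simplices)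

/-! ### Surfaces in a simple polyhedron -/

/-- The simplices of the closure of the union of the regions in `S`. -/
def closure (S : Set X.Region) : Set (Finset V) :=
  {s | s ∈ X.faces ∧ ∃ f ∈ S, ∃ t ∈ f.simplices, s ⊆ t}

/-- The set of regions that form the odd surface of `σ`. -/
def oddRegions (σ : X.Region → ℕ) : Set X.Region := {f | Odd (σ f)}

/-- The closure of the union of the regions in `S` is a properly embedded surface: at every interior
edge it contains none or exactly two of the three germs of regions. -/
def IsProperSurface (S : Set X.Region) : Prop :=
  open Classical in
  ∀ s ∈ X.segments 3,
    ((X.cofaces s).filter (· ∈ closure S)).card = 0 ∨ ((X.cofaces s).filter (· ∈ closure S)).card = 2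

/-- The boundary of the surface `S` is the odd sublink of the graph `∂X` colored by `ψ`. -/
def BoundaryIsOddSublink (S : Set X.Region) (ψ : X.BdryEdge → ℕ) : Prop :=
  ∀ s ∈ X.segments 1, s ∈ closure S ↔ Odd (valueAt ψ s)

/-- The admissible colorings of `X` that extend the coloring `ψ` of `∂X`. -/
def extensions (ψ : X.BdryEdge → ℕ) : Set (X.Region → ℕ) :=
  {σ | IsAdmissible σ ∧ ∀ s ∈ X.segments 1, bdryColor σ s = valueAt ψ s}

variable (X) in
/-- `X` collapses onto a graph (or a point). -/
def CollapsesToGraph : Prop :=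
  ∃ B, Relation.ReflTransGen ElementaryCollapse X.faces B ∧ ∀ s ∈ B, s.card ≤ 2

end SimplePolyhedron

/-! The function `[2] = q + q⁻¹` has a simple zero at `q = i`, and the recurrence `[n+2] = [2][n+1]
- [n]` shows that, for `n > 0`, `[n]` has order 1 at `i` if `n` is even and 0 if `n` is odd. Hence
`[n]!` has order `⌊n/2⌋`, the phases have order 0, and the order of each factor of the evaluation is
a matter of parities. A circle has order 1 or 0 according to whether its color is odd or even
(`hasOrd_circ`). A theta graph has order 1 if it has an odd edge, minus 1 if it is red
(`hasOrd_theta`). A tetrahedron has order at least 1 if it has an odd edge, minus half the number of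
its red vertices (`exists_ordGE_tet`).

Only the tetrahedron is delicate. For a single term of its sum the estimate is a finite check on the
parities of the triangles, the squares and `z` (`tet_parity`). It fails in one case: all triangles
odd and all squares even. There the terms `z = 2k+1` and `z = 2k+2` cancel to second order
(`ordGE_pair`), which is exactly what is missing.

To add up the orders, recall that the Euler characteristic of a compact surface is the sum, over the
open strata it contains, of the Euler characteristics with compact support: `χ(f)` for a region,
`-χ(e)` for an edge, 1 for a vertex. These are the exponents in the evaluation, so the odd parts of
the orders add up to at least `χ(S_σ)`. As for the red parts, a red interior edge contributes
`+χ(e)`, that is 1/2 for each of its ends. This cancels the loss of 1/2 at an interior vertex, while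
at a red boundary vertex the theta graph loses 1 and the edge ending there returns 1/2. The total
loss is `r/2` (`two_mul_sum_redEdgeInd`, `exists_ordGE_state`). On a triangulation all of this
becomes a sum over open simplices, each of which lies in one stratum (`sum_faces_eq`).

For the state sum, a collapse onto a graph removes every triangle through a segment whose other
triangles have already been removed (`triangle_induction`). Along such a collapse the triangle
inequalities bound all colors in terms of those of the boundary, so there are finitely many
extensions. The parity condition likewise determines a proper surface from its boundary, so all
extensions have the same odd surface `S`. Every summand then satisfies the same bound, and so does
the sum. -/

namespace Quantum

open Filter Topology

/-! ## Orders at `q = i` -/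

/-- `f` is meromorphic at `i`, of order exactly `n`. -/
def HasOrd (f : ℂ → ℂ) (n : ℤ) : Prop :=
  MeromorphicAt f Complex.I ∧ meromorphicOrderAt f Complex.I = n

/-- `f` is meromorphic at `i`, of order at least `n`. -/
def OrdGE (f : ℂ → ℂ) (n : ℤ) : Prop :=
  MeromorphicAt f Complex.I ∧ (n : WithTop ℤ) ≤ meromorphicOrderAt f Complex.I

theorem HasOrd.ordGE {f : ℂ → ℂ} {n : ℤ} (h : HasOrd f n) : OrdGE f n := ⟨h.1, h.2.ge⟩

theorem OrdGE.mono {f : ℂ → ℂ} {m n : ℤ} (h : OrdGE f n) (hmn : m ≤ n) : OrdGE f m :=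
  ⟨h.1, le_trans (WithTop.coe_le_coe.2 hmn) h.2⟩

theorem HasOrd.of_eq {f : ℂ → ℂ} {m n : ℤ} (h : HasOrd f n) (hmn : n = m) : HasOrd f m := hmn ▸ h

theorem hasOrd_of_analyticAt {f : ℂ → ℂ} (hf : AnalyticAt ℂ f Complex.I) (h : f Complex.I ≠ 0) :
    HasOrd f 0 := by
  refine ⟨hf.meromorphicAt, ?_⟩
  rw [meromorphicOrderAt_eq_int_iff hf.meromorphicAt]
  exact ⟨f, hf, h, by simp⟩

theorem ordGE_of_analyticAt {f : ℂ → ℂ} (hf : AnalyticAt ℂ f Complex.I) : OrdGE f 0 :=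
  ⟨hf.meromorphicAt, hf.meromorphicOrderAt_nonneg⟩

theorem hasOrd_const {c : ℂ} (hc : c ≠ 0) : HasOrd (fun _ => c) 0 :=
  hasOrd_of_analyticAt analyticAt_const hc

theorem HasOrd.congr {f g : ℂ → ℂ} {n : ℤ} (h : HasOrd f n) (hfg : f =ᶠ[𝓝[≠] Complex.I] g) :
    HasOrd g n :=
  ⟨h.1.congr hfg, by rw [← meromorphicOrderAt_congr hfg, h.2]⟩

theorem OrdGE.congr {f g : ℂ → ℂ} {n : ℤ} (h : OrdGE f n) (hfg : f =ᶠ[𝓝[≠] Complex.I] g) :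
    OrdGE g n :=
  ⟨h.1.congr hfg, by rw [← meromorphicOrderAt_congr hfg]; exact h.2⟩

theorem HasOrd.mul {f g : ℂ → ℂ} {m n : ℤ} (hf : HasOrd f m) (hg : HasOrd g n) :
    HasOrd (fun q => f q * g q) (m + n) :=
  ⟨hf.1.mul hg.1, by
    change meromorphicOrderAt (f * g) _ = _
    rw [meromorphicOrderAt_mul hf.1 hg.1, hf.2, hg.2, WithTop.coe_add]⟩

theorem OrdGE.mul {f g : ℂ → ℂ} {m n : ℤ} (hf : OrdGE f m) (hg : OrdGE g n) :
    OrdGE (fun q => f q * g q) (m + n) :=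
  ⟨hf.1.mul hg.1, by
    change _ ≤ meromorphicOrderAt (f * g) _
    rw [meromorphicOrderAt_mul hf.1 hg.1, WithTop.coe_add]
    exact add_le_add hf.2 hg.2⟩

theorem OrdGE.add {f g : ℂ → ℂ} {n : ℤ} (hf : OrdGE f n) (hg : OrdGE g n) :
    OrdGE (fun q => f q + g q) n :=
  ⟨hf.1.add hg.1, le_trans (le_min hf.2 hg.2) (meromorphicOrderAt_add hf.1 hg.1)⟩

theorem ordGE_zero (n : ℤ) : OrdGE (fun _ => 0) n := by
  refine ⟨MeromorphicAt.const 0 _, ?_⟩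
  rw [(meromorphicOrderAt_eq_top_iff (x := Complex.I) (f := fun _ : ℂ => (0 : ℂ))).2 (by simp)]
  exact le_top

theorem OrdGE.sum {ι : Type*} (s : Finset ι) {f : ι → ℂ → ℂ} {n : ℤ}
    (hf : ∀ i ∈ s, OrdGE (f i) n) : OrdGE (fun q => ∑ i ∈ s, f i q) n := by
  classical
  induction s using Finset.induction_on with
  | empty => simpa using ordGE_zero n
  | insert a s ha ih =>
    simp only [Finset.sum_insert ha]
    exact (hf a (Finset.mem_insert_self _ _)).add
      (ih fun i hi => hf i (Finset.mem_insert_of_mem hi))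

theorem HasOrd.prod {ι : Type*} (s : Finset ι) {f : ι → ℂ → ℂ} {n : ι → ℤ}
    (hf : ∀ i ∈ s, HasOrd (f i) (n i)) : HasOrd (fun q => ∏ i ∈ s, f i q) (∑ i ∈ s, n i) := by
  classical
  induction s using Finset.induction_on with
  | empty => simpa using hasOrd_const one_ne_zero
  | insert a s ha ih =>
    simp only [Finset.prod_insert ha, Finset.sum_insert ha]
    exact (hf a (Finset.mem_insert_self _ _)).mul
      (ih fun i hi => hf i (Finset.mem_insert_of_mem hi))

theorem OrdGE.prod {ι : Type*} (s : Finset ι) {f : ι → ℂ → ℂ} {n : ι → ℤ}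
    (hf : ∀ i ∈ s, OrdGE (f i) (n i)) : OrdGE (fun q => ∏ i ∈ s, f i q) (∑ i ∈ s, n i) := by
  classical
  induction s using Finset.induction_on with
  | empty => simpa using (hasOrd_const one_ne_zero).ordGE
  | insert a s ha ih =>
    simp only [Finset.prod_insert ha, Finset.sum_insert ha]
    exact (hf a (Finset.mem_insert_self _ _)).mul
      (ih fun i hi => hf i (Finset.mem_insert_of_mem hi))

theorem HasOrd.inv {f : ℂ → ℂ} {n : ℤ} (hf : HasOrd f n) : HasOrd (fun q => (f q)⁻¹) (-n) :=
  ⟨hf.1.inv, by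
    change meromorphicOrderAt (f⁻¹) _ = _
    rw [meromorphicOrderAt_inv, hf.2]
    rfl⟩

theorem HasOrd.div {f g : ℂ → ℂ} {m n : ℤ} (hf : HasOrd f m) (hg : HasOrd g n) :
    HasOrd (fun q => f q / g q) (m - n) := by
  simpa only [div_eq_mul_inv, sub_eq_add_neg] using hf.mul hg.inv

theorem OrdGE.div {f g : ℂ → ℂ} {m n : ℤ} (hf : OrdGE f m) (hg : HasOrd g n) :
    OrdGE (fun q => f q / g q) (m - n) := by
  simpa only [div_eq_mul_inv, sub_eq_add_neg] using hf.mul hg.inv.ordGE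

theorem HasOrd.zpow {f : ℂ → ℂ} {n : ℤ} (hf : HasOrd f n) (k : ℤ) :
    HasOrd (fun q => f q ^ k) (k * n) :=
  ⟨hf.1.zpow k, by
    change meromorphicOrderAt (f ^ k) _ = _
    rw [meromorphicOrderAt_zpow hf.1, hf.2, WithTop.coe_mul]⟩

theorem HasOrd.eventually_ne_zero {f : ℂ → ℂ} {n : ℤ} (hf : HasOrd f n) :
    ∀ᶠ q in 𝓝[≠] Complex.I, f q ≠ 0 :=
  (meromorphicOrderAt_ne_top_iff_eventually_ne_zero hf.1).1 (by rw [hf.2]; exact WithTop.coe_ne_top)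

theorem OrdGE.le_ordI {f : ℂ → ℂ} {n : ℤ} (hf : OrdGE f n) {x : ℚ} (hx : x ≤ n) :
    (x : WithTop ℚ) ≤ ordI f := by
  have h := hf.2
  unfold ordI
  cases hm : meromorphicOrderAt f Complex.I with
  | top => simp
  | coe m =>
    rw [hm, WithTop.coe_le_coe] at h
    rw [WithTop.map_coe, WithTop.coe_le_coe]
    exact hx.trans (by exact_mod_cast h)

/-! ## Quantum integers near `q = i` -/

theorem eventually_ne_zero_I : ∀ᶠ q : ℂ in 𝓝[≠] Complex.I, q ≠ 0 ∧ q - q⁻¹ ≠ 0 := by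
  have hc : ContinuousAt (fun q : ℂ => q - q⁻¹) Complex.I :=
    continuousAt_id.sub (continuousAt_inv₀ Complex.I_ne_zero)
  have h2 : Complex.I - Complex.I⁻¹ ≠ 0 := by
    rw [Complex.inv_I, sub_neg_eq_add, ← two_mul]
    exact mul_ne_zero two_ne_zero Complex.I_ne_zero
  exact ((continuousAt_id.eventually_ne Complex.I_ne_zero).and
    (hc.eventually_ne h2)).filter_mono nhdsWithin_le_nhds

/-- Because `q + q⁻¹ = (q - i)(q + i) / q`. This function, which is `[2]`, measures all zeros and
poles below. -/
theorem hasOrd_add_inv : HasOrd (fun q => q + q⁻¹) 1 := by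
  have ha : AnalyticAt ℂ (fun q : ℂ => q + q⁻¹) Complex.I :=
    analyticAt_id.add (analyticAt_inv Complex.I_ne_zero)
  refine ⟨ha.meromorphicAt, ?_⟩
  rw [meromorphicOrderAt_eq_int_iff ha.meromorphicAt]
  refine ⟨fun q => (q + Complex.I) * q⁻¹, (analyticAt_id.add analyticAt_const).mul
    (analyticAt_inv Complex.I_ne_zero), ?_, ?_⟩
  · exact mul_ne_zero (by rw [← two_mul]; exact mul_ne_zero two_ne_zero Complex.I_ne_zero)
      (inv_ne_zero Complex.I_ne_zero)
  · filter_upwards [eventually_ne_zero_I] with q hq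
    have h0 := hq.1
    have hI : Complex.I ^ 2 = -1 := Complex.I_sq
    simp only [zpow_one, smul_eq_mul]
    field_simp
    linear_combination hI

/-- Near `q = i`, `f` differs from the constant `c` by a multiple of `(q + q⁻¹) ^ 2`. -/
def NearConst (f : ℂ → ℂ) (c : ℂ) : Prop :=
  ∃ G : ℂ → ℂ, AnalyticAt ℂ G Complex.I ∧
    ∀ᶠ q in 𝓝[≠] Complex.I, f q = c + (q + q⁻¹) ^ 2 * G q

theorem NearConst.mul {f g : ℂ → ℂ} {c d : ℂ} (hf : NearConst f c) (hg : NearConst g d) :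
    NearConst (fun q => f q * g q) (c * d) := by
  obtain ⟨F, hF, hf⟩ := hf
  obtain ⟨G, hG, hg⟩ := hg
  have hh : AnalyticAt ℂ (fun q : ℂ => (q + q⁻¹) ^ 2) Complex.I :=
    (analyticAt_id.add (analyticAt_inv Complex.I_ne_zero)).pow 2
  refine ⟨fun q => c * G q + d * F q + (q + q⁻¹) ^ 2 * (F q * G q),
    ((analyticAt_const.mul hG).add (analyticAt_const.mul hF)).add (hh.mul (hF.mul hG)), ?_⟩
  filter_upwards [hf, hg] with q h1 h2
  rw [h1, h2]
  ring

theorem NearConst.prod {ι : Type*} (s : Finset ι) {f : ι → ℂ → ℂ} {c : ι → ℂ}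
    (hf : ∀ i ∈ s, NearConst (f i) (c i)) :
    NearConst (fun q => ∏ i ∈ s, f i q) (∏ i ∈ s, c i) := by
  classical
  induction s using Finset.induction_on with
  | empty => exact ⟨0, analyticAt_const, by simp⟩
  | insert a s ha ih =>
    simp only [Finset.prod_insert ha]
    exact (hf a (Finset.mem_insert_self _ _)).mul
      (ih fun i hi => hf i (Finset.mem_insert_of_mem hi))

theorem NearConst.sub_ordGE {f g : ℂ → ℂ} {c : ℂ} (hf : NearConst f c) (hg : NearConst g c) :
    OrdGE (fun q => f q - g q) 2 := by
  obtain ⟨F, hF, hf⟩ := hf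
  obtain ⟨G, hG, hg⟩ := hg
  have := ((hasOrd_add_inv.mul hasOrd_add_inv).ordGE.mul (ordGE_of_analyticAt (hF.sub hG)))
  refine (this.mono (by norm_num)).congr ?_
  filter_upwards [hf, hg] with q h1 h2
  simp only [Pi.sub_apply]
  rw [h1, h2]
  ring

/-- `[2m] / [2]` is `(-1) ^ (m + 1) * m` at `q = i`, and `[2m+1]` is `(-1) ^ m` up to a multiple of
`[2] ^ 2`. -/
theorem exists_qInt_expansion (m : ℕ) : ∃ B G : ℂ → ℂ,
    AnalyticAt ℂ B Complex.I ∧ AnalyticAt ℂ G Complex.I ∧ B Complex.I = (-1) ^ (m + 1) * m ∧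
    ∀ q : ℂ, q ≠ 0 → q - q⁻¹ ≠ 0 → qInt (2 * m) q = (q + q⁻¹) * B q ∧
      qInt (2 * m + 1) q = (-1) ^ m + (q + q⁻¹) ^ 2 * G q := by
  -- The recurrence `[n+2] = [2][n+1] - [n]`, which yields the even and the odd expansions by a
  -- simultaneous induction.
  have key : ∀ (n : ℕ) (q : ℂ), q ≠ 0 → q - q⁻¹ ≠ 0 →
      qInt (n + 2) q = (q + q⁻¹) * qInt (n + 1) q - qInt n q := by
    intro n q h0 h1
    unfold qInt
    rw [eq_sub_iff_add_eq, ← mul_div_assoc, ← add_div]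
    congr 1
    have : q * q⁻¹ = 1 := mul_inv_cancel₀ h0
    simp only [pow_succ]
    linear_combination (q⁻¹ ^ n - q ^ n) * this
  have hh : AnalyticAt ℂ (fun q : ℂ => q + q⁻¹) Complex.I :=
    analyticAt_id.add (analyticAt_inv Complex.I_ne_zero)
  induction m with
  | zero =>
    refine ⟨fun _ => 0, fun _ => 0, analyticAt_const, analyticAt_const, by simp, fun q h0 h1 => ?_⟩
    simp [qInt, div_self h1]
  | succ m ih =>
    obtain ⟨B, G, hB, hG, hBI, h⟩ := ih
    have hB' : AnalyticAt ℂ (fun q => (-1) ^ m + (q + q⁻¹) ^ 2 * G q - B q) Complex.I :=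
      (analyticAt_const.add ((hh.pow 2).mul hG)).sub hB
    -- The new `B` is `[2m+1] - B`, from the recurrence for `[2m+2]`; the new `G` is the new `B`
    -- minus `G`, from the recurrence for `[2m+3]`.
    refine ⟨fun q => (-1) ^ m + (q + q⁻¹) ^ 2 * G q - B q,
      fun q => ((-1) ^ m + (q + q⁻¹) ^ 2 * G q - B q) - G q, hB', hB'.sub hG, ?_,
      fun q h0 h1 => ?_⟩
    · simp only [hBI, Complex.inv_I]
      push_cast
      ring
    · obtain ⟨h2, h3⟩ := h q h0 h1
      have e1 : qInt (2 * (m + 1)) q = (q + q⁻¹) * ((-1) ^ m + (q + q⁻¹) ^ 2 * G q - B q) := by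
        rw [show 2 * (m + 1) = 2 * m + 2 by ring, key _ q h0 h1, h2, h3]
        ring
      refine ⟨e1, ?_⟩
      rw [show 2 * (m + 1) + 1 = (2 * m + 1) + 2 by ring, key _ q h0 h1,
        show 2 * m + 1 + 1 = 2 * (m + 1) by ring, e1, h3]
      ring

theorem nearConst_qInt (m : ℕ) : NearConst (qInt (2 * m + 1)) ((-1) ^ m) := by
  obtain ⟨B, G, -, hG, -, h⟩ := exists_qInt_expansion m
  exact ⟨G, hG, by filter_upwards [eventually_ne_zero_I] with q hq using (h q hq.1 hq.2).2⟩

/-- For `n = 2m` the cofactor of `[2]` is `±m` at `i`, not zero, so the zero stays simple. For `n`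
odd the value at `i` is `±1`. -/
theorem hasOrd_qInt (n : ℕ) (hn : n ≠ 0) : HasOrd (qInt n) (1 - (n % 2 : ℕ)) := by
  rcases Nat.even_or_odd' n with ⟨m, rfl | rfl⟩
  · obtain ⟨B, G, hB, -, hBI, h⟩ := exists_qInt_expansion m
    have h1 := hasOrd_add_inv.mul (hasOrd_of_analyticAt hB (by
      rw [hBI]
      exact mul_ne_zero (pow_ne_zero _ (by norm_num)) (by simpa using hn)))
    refine (h1.of_eq (by simp)).congr ?_
    filter_upwards [eventually_ne_zero_I] with q hq using (h q hq.1 hq.2).1.symm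
  · obtain ⟨B, G, -, hG, -, h⟩ := exists_qInt_expansion m
    have hh : AnalyticAt ℂ (fun q : ℂ => (q + q⁻¹) ^ 2) Complex.I :=
      (analyticAt_id.add (analyticAt_inv Complex.I_ne_zero)).pow 2
    have h1 : HasOrd (fun q => (-1) ^ m + (q + q⁻¹) ^ 2 * G q) 0 :=
      hasOrd_of_analyticAt (analyticAt_const.add (hh.mul hG)) (by simp [Complex.inv_I])
    refine (h1.of_eq (by omega)).congr ?_
    filter_upwards [eventually_ne_zero_I] with q hq using (h q hq.1 hq.2).2.symm

/-- One simple zero for each even number among `1, …, n`. -/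
theorem hasOrd_qFact (n : ℕ) : HasOrd (qFact n) (n / 2 : ℕ) := by
  induction n with
  | zero =>
    have : qFact 0 = fun _ => 1 := by ext; simp [qFact]
    rw [this]
    exact hasOrd_const one_ne_zero
  | succ n ih =>
    have : qFact (n + 1) = fun q => qFact n q * qInt (n + 1) q := by
      ext; simp [qFact, Finset.prod_range_succ]
    rw [this]
    exact (ih.mul (hasOrd_qInt (n + 1) (by omega))).of_eq (by omega)

theorem hasOrd_neg_one_pow (n : ℕ) : HasOrd (fun _ => (-1) ^ n) 0 :=
  hasOrd_const (pow_ne_zero _ (by norm_num))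

theorem hasOrd_circ (a : ℕ) : HasOrd (circ a) (a % 2 : ℕ) :=
  ((hasOrd_neg_one_pow a).mul (hasOrd_qInt (a + 1) (by omega))).of_eq (by omega)

/-- Powers with a nonzero base are exponentials, hence never zero, and `i` lies in the slit plane,
where the principal branch is analytic. -/
theorem hasOrd_phase (g : ℚ) (c : ℕ) : HasOrd (phase g c) 0 := by
  refine hasOrd_of_analyticAt ?_ ?_
  · exact analyticAt_const.mul (analyticAt_id.cpow analyticAt_const (by simp [Complex.slitPlane]))
  · unfold phase
    refine mul_ne_zero ?_ ?_ <;>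
    · rw [Complex.cpow_def_of_ne_zero Complex.I_ne_zero]
      exact Complex.exp_ne_zero _

end Quantum

/-! ### Admissible triples and the order of the theta graph. -/

namespace Quantum

open Filter Topology

/-- The numbers `u, v, w` are half the sum minus each color. They are the numbers whose parities
define redness. -/
theorem Admissible.exists_eq {m : Multiset ℕ} (h : Admissible m) :
    ∃ u v w : ℕ, m = {v + w, u + w, u + v} := by
  obtain ⟨h3, he, ht⟩ := h
  obtain ⟨a, b, c, rfl⟩ := Multiset.card_eq_three.1 h3
  simp only [Multiset.insert_eq_cons, Multiset.sum_cons, Multiset.sum_singleton,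
    Multiset.mem_cons, Multiset.mem_singleton, forall_eq_or_imp, forall_eq] at he ht
  obtain ⟨s, hs⟩ := he
  refine ⟨s - a, s - b, s - c, ?_⟩
  rw [show s - b + (s - c) = a by omega, show s - a + (s - c) = b by omega,
    show s - a + (s - b) = c by omega]

theorem red_iff (u v w : ℕ) : Red {v + w, u + w, u + v} ↔ 2 ≤ u % 2 + v % 2 + w % 2 := by
  have hs : ({v + w, u + w, u + v} : Multiset ℕ).sum / 2 = u + v + w := by
    simp only [Multiset.insert_eq_cons, Multiset.sum_cons, Multiset.sum_singleton]; omega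
  unfold Red
  rw [hs]
  simp only [Multiset.insert_eq_cons, Multiset.filter_cons, Multiset.filter_singleton,
    show u + v + w - (v + w) = u by omega, show u + v + w - (u + w) = v by omega,
    show u + v + w - (u + v) = w by omega, Nat.odd_iff]
  rcases Nat.mod_two_eq_zero_or_one u with hu | hu <;>
  rcases Nat.mod_two_eq_zero_or_one v with hv | hv <;>
  rcases Nat.mod_two_eq_zero_or_one w with hw | hw <;> simp [hu, hv, hw]

open Classical in
/-- The theta graph has order `1` or `0` according to whether it has an odd edge, minus `1` if its
triple is red. -/
theorem hasOrd_theta {m : Multiset ℕ} (h : Admissible m) :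
    HasOrd (theta m) ((if ∃ x ∈ m, Odd x then 1 else 0) - if Red m then 1 else 0) := by
  obtain ⟨u, v, w, rfl⟩ := h.exists_eq
  rw [show theta {v + w, u + w, u + v} = _ from funext (theta_eq (v + w) (u + w) (u + v))]
  refine (((hasOrd_neg_one_pow _).mul ((hasOrd_qFact _).mul (((hasOrd_qFact _).mul
    (hasOrd_qFact _)).mul (hasOrd_qFact _)))).div (((hasOrd_qFact _).mul (hasOrd_qFact _)).mul
      (hasOrd_qFact _))).of_eq ?_
  rw [red_iff, show (v + w + (u + w) + (u + v)) / 2 = u + v + w by omega,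
    show u + v + w - (v + w) = u by omega, show u + v + w - (u + w) = v by omega,
    show u + v + w - (u + v) = w by omega]
  have ho : (∃ x ∈ ({v + w, u + w, u + v} : Multiset ℕ), Odd x) ↔
      (v + w) % 2 = 1 ∨ (u + w) % 2 = 1 ∨ (u + v) % 2 = 1 := by
    simp [Nat.odd_iff]
  rw [if_congr ho rfl rfl]
  -- The order is a combination of rounded halves. Once the residues of `u, v, w` are fixed it is
  -- linear in `a, b, c`, so the eight cases are checked separately.
  obtain ⟨a, ha⟩ : ∃ a, u = 2 * a + u % 2 := ⟨u / 2, by omega⟩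
  obtain ⟨b, hb⟩ : ∃ b, v = 2 * b + v % 2 := ⟨v / 2, by omega⟩
  obtain ⟨c, hc⟩ : ∃ c, w = 2 * c + w % 2 := ⟨w / 2, by omega⟩
  rcases Nat.mod_two_eq_zero_or_one u with hu | hu <;>
  rcases Nat.mod_two_eq_zero_or_one v with hv | hv <;>
  rcases Nat.mod_two_eq_zero_or_one w with hw | hw <;>
  · simp only [Nat.add_mod v w, Nat.add_mod u w, Nat.add_mod u v, hu, hv, hw]
    norm_num
    rw [hu] at ha; rw [hv] at hb; rw [hw] at hc
    clear hu hv hw ho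
    subst ha hb hc
    omega

/-! ## The tetrahedron -/

/-- The sum over `z` in the formula for the tetrahedron. -/
noncomputable def tetSum (T : Fin 4 → ℕ) (Q : Fin 3 → ℕ) (q : ℂ) : ℂ :=
  ∑ z ∈ Finset.Icc (Finset.univ.sup T) (Finset.univ.inf' Finset.univ_nonempty Q),
    (-1) ^ z * (qFact (z + 1) q / ((∏ j, qFact (z - T j) q) * ∏ i, qFact (Q i - z) q))

theorem hasOrd_tetSum_term (T : Fin 4 → ℕ) (Q : Fin 3 → ℕ) (z : ℕ) :
    HasOrd (fun q => (-1) ^ z * (qFact (z + 1) q /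
      ((∏ j, qFact (z - T j) q) * ∏ i, qFact (Q i - z) q)))
      ((((z + 1) / 2 : ℕ) : ℤ) - (∑ j, (((z - T j) / 2 : ℕ) : ℤ) + ∑ i, (((Q i - z) / 2 : ℕ) : ℤ))) := by
  refine ((hasOrd_neg_one_pow z).mul ((hasOrd_qFact _).div
    ((HasOrd.prod _ fun j _ => hasOrd_qFact _).mul
      (HasOrd.prod _ fun i _ => hasOrd_qFact _)))).of_eq ?_
  push_cast
  ring

theorem ordGE_tetSum (T : Fin 4 → ℕ) (Q : Fin 3 → ℕ) (M : ℤ)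
    (h : ∀ z, (∀ j, T j ≤ z) → (∀ i, z ≤ Q i) →
      M ≤ (((z + 1) / 2 : ℕ) : ℤ) - (∑ j, (((z - T j) / 2 : ℕ) : ℤ) + ∑ i, (((Q i - z) / 2 : ℕ) : ℤ))) :
    OrdGE (tetSum T Q) M := by
  refine OrdGE.sum _ fun z hz => (hasOrd_tetSum_term T Q z).ordGE.mono (h z ?_ ?_)
  · intro j
    exact (Finset.le_sup (f := T) (Finset.mem_univ j)).trans (Finset.mem_Icc.1 hz).1
  · intro i
    exact (Finset.mem_Icc.1 hz).2.trans (Finset.inf'_le Q (Finset.mem_univ i))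

/-- With an odd lower end and an even upper end, the range splits into the pairs of consecutive
numbers whose terms cancel. -/
theorem sum_Icc_odd_even {M : Type*} [AddCommMonoid M] (F : ℕ → M) (m n : ℕ) :
    ∑ z ∈ Finset.Icc (2 * m + 1) (2 * n), F z =
      ∑ k ∈ Finset.Ico m n, (F (2 * k + 1) + F (2 * k + 2)) := by
  induction n with
  | zero => simp
  | succ n ih =>
    rcases Nat.lt_or_ge n m with h | h
    · rw [Finset.Icc_eq_empty (by omega), Finset.Ico_eq_empty (by omega)]
      simp
    · rw [Finset.sum_Ico_succ_top h, ← ih, show 2 * (n + 1) = 2 * n + 1 + 1 by ring,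
        ← Finset.insert_Icc_right_eq_Icc_add_one (by omega),
        Finset.sum_insert (by simp), ← Finset.insert_Icc_right_eq_Icc_add_one (by omega),
        Finset.sum_insert (by simp)]
      rw [add_comm (F (2 * n + 1)), add_comm, add_assoc]
      rfl

theorem qFact_succ (n : ℕ) (q : ℂ) : qFact (n + 1) q = qFact n q * qInt (n + 1) q :=
  Finset.prod_range_succ _ _

/-- Two consecutive terms of the tetrahedron sum cancel to second order. -/
theorem ordGE_pair (k : ℕ) (u : Fin 4 → ℕ) (v : Fin 3 → ℕ) (h : ∑ j, u j + ∑ i, v i + 1 = k) :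
    OrdGE (fun q => (-1) ^ (2 * k + 1) * (qFact (2 * k + 1 + 1) q /
        ((∏ j, qFact (2 * u j) q) * ∏ i, qFact (2 * v i + 1) q)) +
      (-1) ^ (2 * k + 2) * (qFact (2 * k + 2 + 1) q /
        ((∏ j, qFact (2 * u j + 1) q) * ∏ i, qFact (2 * v i) q))) 4 := by
  have hU := HasOrd.prod Finset.univ fun j _ => hasOrd_qFact (2 * u j)
  have hU1 := HasOrd.prod Finset.univ fun j _ => hasOrd_qInt (2 * u j + 1) (by omega)
  have hV := HasOrd.prod Finset.univ fun i _ => hasOrd_qFact (2 * v i)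
  have hV1 := HasOrd.prod Finset.univ fun i _ => hasOrd_qInt (2 * v i + 1) (by omega)
  have h1 := (nearConst_qInt (k + 1)).mul
    (NearConst.prod Finset.univ fun i _ => nearConst_qInt (v i))
  have h2 := NearConst.prod Finset.univ fun j _ => nearConst_qInt (u j)
  -- By `h` the exponents `k + 1 + ∑ v` and `∑ u` have the same parity. This is the reason for the
  -- cancellation.
  have hc : (-1 : ℂ) ^ (k + 1) * ∏ i, (-1 : ℂ) ^ v i = ∏ j, (-1 : ℂ) ^ u j := by
    rw [Finset.prod_pow_eq_pow_sum, Finset.prod_pow_eq_pow_sum, ← pow_add, ← h,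
      show ∑ j, u j + ∑ i, v i + 1 + 1 + ∑ i, v i = ∑ j, u j + 2 * (∑ i, v i + 1) by ring,
      pow_add, pow_mul]
    simp
  rw [hc] at h1
  -- Both terms are multiples of `[2k+2]! / (∏ [2u_j+1]! ∏ [2v_i+1]!)`, which has order 2: the
  -- second by `[2k+3] ∏ [2v_i+1]`, the first by `-∏ [2u_j+1]`. These two products have the same
  -- constant, so their difference gives the other 2.
  have := ((hasOrd_qFact (2 * k + 1 + 1)).div ((hU.mul hU1).mul (hV.mul hV1))).ordGE.mul
    (h1.sub_ordGE h2)
  refine (this.mono ?_).congr ?_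
  · have e1 : ∀ x : ℕ, (2 * x) / 2 = x := fun x => by omega
    have e2 : ∀ x : ℕ, (1 - ((2 * x + 1) % 2 : ℕ) : ℤ) = 0 := fun x => by omega
    simp only [e1, e2, Finset.sum_const_zero, add_zero]
    rw [show (2 * k + 1 + 1) / 2 = k + 1 by omega, ← h]
    push_cast
    linarith
  · filter_upwards [hU.eventually_ne_zero, hU1.eventually_ne_zero, hV.eventually_ne_zero,
      hV1.eventually_ne_zero] with q a1 a2 a3 a4
    simp only [qFact_succ (2 * u _) q, qFact_succ (2 * v _) q, Finset.prod_mul_distrib]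
    rw [show 2 * k + 2 + 1 = (2 * k + 1 + 1) + 1 by ring, qFact_succ (2 * k + 1 + 1),
      show 2 * (k + 1) + 1 = 2 * k + 1 + 1 + 1 by ring, pow_succ, pow_mul, pow_add, pow_mul]
    field_simp
    ring

/-- Each term has order 2 only, but the range of `z` starts at an odd number and ends at an even
one, so the terms cancel in pairs to second order. -/
theorem ordGE_tetSum_of_odd_even (T : Fin 4 → ℕ) (Q : Fin 3 → ℕ) (hT : ∀ j, T j % 2 = 1)
    (hQ : ∀ i, Q i % 2 = 0) (h : ∑ j, T j = ∑ i, Q i) : OrdGE (tetSum T Q) 4 := by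
  obtain ⟨j₀, -, hj₀⟩ := Finset.exists_mem_eq_sup Finset.univ Finset.univ_nonempty T
  obtain ⟨i₀, -, hi₀⟩ := Finset.exists_mem_eq_inf' Finset.univ_nonempty Q
  have hm : ∀ j, T j ≤ T j₀ := fun j => hj₀ ▸ Finset.le_sup (f := T) (Finset.mem_univ j)
  have hn : ∀ i, Q i₀ ≤ Q i := fun i => hi₀ ▸ Finset.inf'_le Q (Finset.mem_univ i)
  have e : tetSum T Q = fun q => ∑ k ∈ Finset.Ico (T j₀ / 2) (Q i₀ / 2),
      ((-1) ^ (2 * k + 1) * (qFact (2 * k + 1 + 1) q /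
        ((∏ j, qFact (2 * k + 1 - T j) q) * ∏ i, qFact (Q i - (2 * k + 1)) q)) +
      (-1) ^ (2 * k + 2) * (qFact (2 * k + 2 + 1) q /
        ((∏ j, qFact (2 * k + 2 - T j) q) * ∏ i, qFact (Q i - (2 * k + 2)) q))) := by
    ext q
    unfold tetSum
    have := sum_Icc_odd_even (fun z => (-1) ^ z * (qFact (z + 1) q /
      ((∏ j, qFact (z - T j) q) * ∏ i, qFact (Q i - z) q))) (T j₀ / 2) (Q i₀ / 2)
    rw [show 2 * (T j₀ / 2) + 1 = T j₀ by have := hT j₀; omega,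
      show 2 * (Q i₀ / 2) = Q i₀ by have := hQ i₀; omega] at this
    rw [hj₀, hi₀, this]
  rw [e]
  refine OrdGE.sum _ fun k hk => ?_
  have hk := Finset.mem_Ico.1 hk
  have hu : ∀ j, ∃ u, 2 * k + 1 = 2 * u + T j := fun j =>
    ⟨(2 * k + 1 - T j) / 2, by have := hT j; have := hm j; have := hT j₀; omega⟩
  have hv : ∀ i, ∃ v, Q i = 2 * v + (2 * k + 2) := fun i =>
    ⟨(Q i - (2 * k + 2)) / 2, by have := hQ i; have := hn i; have := hQ i₀; omega⟩
  choose u hu using hu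
  choose v hv using hv
  -- The equality of the sums of triangles and of squares, `4(2k+1) - 2∑u = 3(2k+2) + 2∑v`.
  have hs : ∑ j, u j + ∑ i, v i + 1 = k := by
    simp only [Fin.sum_univ_four, Fin.sum_univ_three] at h ⊢
    have := hu 0; have := hu 1; have := hu 2; have := hu 3
    have := hv 0; have := hv 1; have := hv 2
    omega
  refine (ordGE_pair k u v hs).congr (Eventually.of_forall fun q => ?_)
  have f1 : ∀ j, 2 * k + 1 - T j = 2 * u j := fun j => by have := hu j; omega
  have f2 : ∀ j, 2 * k + 2 - T j = 2 * u j + 1 := fun j => by have := hu j; omega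
  have f3 : ∀ i, Q i - (2 * k + 1) = 2 * v i + 1 := fun i => by have := hv i; omega
  have f4 : ∀ i, Q i - (2 * k + 2) = 2 * v i := fun i => by have := hv i; omega
  simp only [f1, f2, f3, f4]

end Quantum

namespace Quantum

open Filter Topology

/-- The parity of `x - y` for natural numbers `y ≤ x`. -/
theorem sub_mod_two {x y : ℕ} (h : y ≤ x) : (x - y) % 2 = (x % 2 + y % 2) % 2 := by omega

theorem two_mul_half (x : ℕ) : 2 * ((x / 2 : ℕ) : ℤ) = x - (x % 2 : ℕ) := by omega

set_option synthInstance.maxSize 4000 in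
set_option synthInstance.maxHeartbeats 400000 in
/-- The numbers of odd edges and of red vertices of a tetrahedron, in terms of the parities of the
triangles and squares: the estimate of the order of one term of the tetrahedron sum. -/
theorem tet_parity : ∀ t₁ < 2, ∀ t₂ < 2, ∀ t₃ < 2, ∀ t₄ < 2, ∀ q₁ < 2, ∀ q₂ < 2, ∀ q₃ < 2,
    ∀ z < 2, (t₁ + t₂ + t₃ + t₄ + q₁ + q₂ + q₃) % 2 = 0 →
    2 * min 1 ((t₁ + t₂ + q₃) % 2 + (t₁ + t₃ + q₂) % 2 + (t₁ + t₄ + q₁) % 2 +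
      (t₃ + t₄ + q₃) % 2 + (t₂ + t₄ + q₂) % 2 + (t₂ + t₃ + q₁) % 2) +
    ((q₁ + t₁) % 2 + (q₁ + t₂) % 2 + (q₁ + t₃) % 2 + (q₁ + t₄) % 2 +
      ((q₂ + t₁) % 2 + (q₂ + t₂) % 2 + (q₂ + t₃) % 2 + (q₂ + t₄) % 2) +
      ((q₃ + t₁) % 2 + (q₃ + t₂) % 2 + (q₃ + t₃) % 2 + (q₃ + t₄) % 2)) + (z + 1) % 2 ≤
    ((q₃ + t₂) % 2 + (q₂ + t₃) % 2 + (q₁ + t₄) % 2) / 2 +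
    ((q₃ + t₁) % 2 + (q₂ + t₄) % 2 + (q₁ + t₃) % 2) / 2 +
    ((q₃ + t₄) % 2 + (q₂ + t₁) % 2 + (q₁ + t₂) % 2) / 2 +
    ((q₃ + t₃) % 2 + (q₂ + t₂) % 2 + (q₁ + t₁) % 2) / 2 +
    ((t₁ + t₂ + q₃) % 2 + (t₁ + t₃ + q₂) % 2 + (t₁ + t₄ + q₁) % 2 +
      (t₃ + t₄ + q₃) % 2 + (t₂ + t₄ + q₂) % 2 + (t₂ + t₃ + q₁) % 2) + 1 +
    ((z + t₁) % 2 + (z + t₂) % 2 + (z + t₃) % 2 + (z + t₄) % 2) +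
    ((q₁ + z) % 2 + (q₂ + z) % 2 + (q₃ + z) % 2) +
    4 * ((t₁ * t₂ * t₃ * t₄) * ((1 - q₁) * (1 - q₂) * (1 - q₃))) := by
  -- Only 256 residues have to be checked. The last summand is the shortfall, 4 in the doubled
  -- order, of a single term when all triangles are odd and all squares even. The constant 1 is what
  -- remains of the linear parts of the order.
  decide +kernel

-- A sum of three residues modulo 2 is at most 3, so its half, rounded down, tells whether at least
-- two of them are 1.
open Classical in
theorem ite_red {a b c s : ℕ} (h : Admissible {a, b, c}) (hs : a + b + c = 2 * s) :
    (if Red {a, b, c} then 1 else 0 : ℤ) =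
      (((s - a) % 2 + (s - b) % 2 + (s - c) % 2) / 2 : ℕ) := by
  have ht := h.2.2
  simp only [Multiset.insert_eq_cons, Multiset.sum_cons, Multiset.sum_singleton,
    Multiset.mem_cons, Multiset.mem_singleton, forall_eq_or_imp, forall_eq] at ht
  have e : ({a, b, c} : Multiset ℕ) = {(s - b) + (s - c), (s - a) + (s - c), (s - a) + (s - b)} := by
    rw [show s - b + (s - c) = a by omega, show s - a + (s - c) = b by omega,
      show s - a + (s - b) = c by omega]
  rw [e, red_iff]
  split_ifs <;> omega

theorem tet_eq (a b c d e f : ℕ) (q : ℂ) : tet a b c d e f q =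
    (∏ i, ∏ j, qFact (![(a + b + d + e) / 2, (a + c + d + f) / 2, (b + c + e + f) / 2] i -
        ![(a + b + c) / 2, (a + e + f) / 2, (d + b + f) / 2, (d + e + c) / 2] j) q) /
      (qFact a q * qFact b q * qFact c q * qFact d q * qFact e q * qFact f q) *
    tetSum ![(a + b + c) / 2, (a + e + f) / 2, (d + b + f) / 2, (d + e + c) / 2]
      ![(a + b + d + e) / 2, (a + c + d + f) / 2, (b + c + e + f) / 2] q := rfl

theorem two_mul_half_sub {x y : ℕ} (h : y ≤ x) :
    2 * (((x - y) / 2 : ℕ) : ℤ) = x - y - ((x % 2 + y % 2) % 2 : ℕ) := by omega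

theorem ite_odd_six (a b c d e f : ℕ) [Decidable (Odd a ∨ Odd b ∨ Odd c ∨ Odd d ∨ Odd e ∨ Odd f)] :
    (if Odd a ∨ Odd b ∨ Odd c ∨ Odd d ∨ Odd e ∨ Odd f then 1 else 0 : ℤ) =
      (min 1 (a % 2 + b % 2 + c % 2 + d % 2 + e % 2 + f % 2) : ℕ) := by
  split_ifs with h
  · simp only [Nat.odd_iff] at h
    rw [Nat.min_eq_left]
    · rfl
    · rcases h with h | h | h | h | h | h <;> rw [h] <;> omega
  · simp only [not_or, Nat.not_odd_iff] at h
    obtain ⟨h1, h2, h3, h4, h5, h6⟩ := h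
    simp [h1, h2, h3, h4, h5, h6]

end Quantum

namespace Quantum

theorem Admissible.exists_half {a b c : ℕ} (h : Admissible {a, b, c}) :
    ∃ s, a + b + c = 2 * s ∧ a ≤ s ∧ b ≤ s ∧ c ≤ s := by
  obtain ⟨-, ⟨s, hs⟩, ht⟩ := h
  simp only [Multiset.insert_eq_cons, Multiset.sum_cons, Multiset.sum_singleton,
    Multiset.mem_cons, Multiset.mem_singleton, forall_eq_or_imp, forall_eq] at ht hs
  exact ⟨s, by omega, by omega, by omega, by omega⟩

/-- How an edge `a` of a tetrahedron determines the difference between a square `Q` and the two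
triangles `T`, `U` that contain the edge. -/
theorem square_relations {a Q T U : ℕ} (h : Q + a = T + U) (hT : a ≤ T) (hU : a ≤ U) :
    (T ≤ Q ∧ U ≤ Q) ∧ (T - a = Q - U ∧ U - a = Q - T) ∧
      a % 2 = (T % 2 + U % 2 + Q % 2) % 2 := by
  omega

/-- The order of one term of the tetrahedron sum, with its prefactor. -/
theorem tet_term_bound {T₁ T₂ T₃ T₄ Q₁ Q₂ Q₃ a b c d e f z : ℕ}
    (hS : T₁ + T₂ + T₃ + T₄ = Q₁ + Q₂ + Q₃) (hs : a + b + c + d + e + f = T₁ + T₂ + T₃ + T₄)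
    (ha : a % 2 = (T₁ % 2 + T₂ % 2 + Q₃ % 2) % 2) (hb : b % 2 = (T₁ % 2 + T₃ % 2 + Q₂ % 2) % 2)
    (hc : c % 2 = (T₁ % 2 + T₄ % 2 + Q₁ % 2) % 2) (hd : d % 2 = (T₃ % 2 + T₄ % 2 + Q₃ % 2) % 2)
    (he : e % 2 = (T₂ % 2 + T₄ % 2 + Q₂ % 2) % 2) (hf : f % 2 = (T₂ % 2 + T₃ % 2 + Q₁ % 2) % 2)
    (hT : ∀ j, ![T₁, T₂, T₃, T₄] j ≤ z) (hQ : ∀ i, z ≤ ![Q₁, Q₂, Q₃] i) :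
    2 * ((min 1 (a % 2 + b % 2 + c % 2 + d % 2 + e % 2 + f % 2) : ℕ) : ℤ) -
      (((((Q₃ - T₂) % 2 + (Q₂ - T₃) % 2 + (Q₁ - T₄) % 2) / 2 : ℕ) : ℤ) +
      (((Q₃ - T₁) % 2 + (Q₂ - T₄) % 2 + (Q₁ - T₃) % 2) / 2 : ℕ) +
      (((Q₃ - T₄) % 2 + (Q₂ - T₁) % 2 + (Q₁ - T₂) % 2) / 2 : ℕ) +
      (((Q₃ - T₃) % 2 + (Q₂ - T₂) % 2 + (Q₁ - T₁) % 2) / 2 : ℕ)) ≤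
    2 * (∑ i, ∑ j, (((![Q₁, Q₂, Q₃] i - ![T₁, T₂, T₃, T₄] j) / 2 : ℕ) : ℤ) -
        ((a / 2 : ℕ) + (b / 2 : ℕ) + (c / 2 : ℕ) + (d / 2 : ℕ) + (e / 2 : ℕ) + (f / 2 : ℕ))) +
      2 * ((((z + 1) / 2 : ℕ) : ℤ) - (∑ j, (((z - ![T₁, T₂, T₃, T₄] j) / 2 : ℕ) : ℤ) +
        ∑ i, (((![Q₁, Q₂, Q₃] i - z) / 2 : ℕ) : ℤ))) +
      4 * ((T₁ % 2 * (T₂ % 2) * (T₃ % 2) * (T₄ % 2)) *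
        ((1 - Q₁ % 2) * (1 - Q₂ % 2) * (1 - Q₃ % 2)) : ℕ) := by
  have par := tet_parity (T₁ % 2) (Nat.mod_lt _ two_pos) (T₂ % 2) (Nat.mod_lt _ two_pos)
    (T₃ % 2) (Nat.mod_lt _ two_pos) (T₄ % 2) (Nat.mod_lt _ two_pos) (Q₁ % 2)
    (Nat.mod_lt _ two_pos) (Q₂ % 2) (Nat.mod_lt _ two_pos) (Q₃ % 2) (Nat.mod_lt _ two_pos)
    (z % 2) (Nat.mod_lt _ two_pos) (by clear ha hb hc hd he hf hs hT hQ; omega)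
  simp only [Fin.forall_fin_succ] at hT hQ
  obtain ⟨ht1, ht2, ht3, ht4⟩ : T₁ ≤ z ∧ T₂ ≤ z ∧ T₃ ≤ z ∧ T₄ ≤ z := by simpa using hT
  obtain ⟨hq1, hq2, hq3⟩ : z ≤ Q₁ ∧ z ≤ Q₂ ∧ z ≤ Q₃ := by simpa using hQ
  clear hT hQ
  rw [← ha, ← hb, ← hc, ← hd, ← he, ← hf] at par
  clear ha hb hc hd he hf
  rw [sub_mod_two (ht1.trans hq1), sub_mod_two (ht2.trans hq1), sub_mod_two (ht3.trans hq1),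
    sub_mod_two (ht4.trans hq1), sub_mod_two (ht1.trans hq2), sub_mod_two (ht2.trans hq2),
    sub_mod_two (ht3.trans hq2), sub_mod_two (ht4.trans hq2), sub_mod_two (ht1.trans hq3),
    sub_mod_two (ht2.trans hq3), sub_mod_two (ht3.trans hq3), sub_mod_two (ht4.trans hq3)]
  simp only [Fin.sum_univ_three, Fin.sum_univ_four, Matrix.cons_val_zero, Matrix.cons_val_one,
    Matrix.cons_val]
  -- Twice a rounded half is a linear form minus a residue. By `hS` and `hs` the linear forms cancel
  -- up to the 1 of `z + 1`, and the residues are compared by `par`.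
  have l1 := two_mul_half a
  have l2 := two_mul_half b
  have l3 := two_mul_half c
  have l4 := two_mul_half d
  have l5 := two_mul_half e
  have l6 := two_mul_half f
  have l7 := two_mul_half (z + 1)
  rw [← Nat.mod_add_mod] at l7
  have m1 := two_mul_half_sub (ht1.trans hq1)
  have m2 := two_mul_half_sub (ht2.trans hq1)
  have m3 := two_mul_half_sub (ht3.trans hq1)
  have m4 := two_mul_half_sub (ht4.trans hq1)
  have m5 := two_mul_half_sub (ht1.trans hq2)
  have m6 := two_mul_half_sub (ht2.trans hq2)
  have m7 := two_mul_half_sub (ht3.trans hq2)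
  have m8 := two_mul_half_sub (ht4.trans hq2)
  have m9 := two_mul_half_sub (ht1.trans hq3)
  have m10 := two_mul_half_sub (ht2.trans hq3)
  have m11 := two_mul_half_sub (ht3.trans hq3)
  have m12 := two_mul_half_sub (ht4.trans hq3)
  have n1 := two_mul_half_sub ht1
  have n2 := two_mul_half_sub ht2
  have n3 := two_mul_half_sub ht3
  have n4 := two_mul_half_sub ht4
  have n5 := two_mul_half_sub hq1
  have n6 := two_mul_half_sub hq2
  have n7 := two_mul_half_sub hq3
  have par' := (Nat.cast_le (α := ℤ)).2 par
  have hS' := congrArg (Nat.cast (R := ℤ)) hS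
  have hs' := congrArg (Nat.cast (R := ℤ)) hs
  clear par ht1 ht2 ht3 ht4 hq1 hq2 hq3 hS hs
  simp only [Nat.cast_add, Nat.cast_mul (α := ℤ) 2, Nat.cast_mul (α := ℤ) 4, Nat.cast_one, Nat.cast_ofNat] at par' hS' hs' l7
  linarith

/-- The prefactor of the tetrahedron sum when all triangles are odd and all squares are even. -/
theorem tet_odd_even_bound {T₁ T₂ T₃ T₄ Q₁ Q₂ Q₃ a b c d e f : ℕ}
    (hS : T₁ + T₂ + T₃ + T₄ = Q₁ + Q₂ + Q₃) (hs : a + b + c + d + e + f = T₁ + T₂ + T₃ + T₄)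
    (ha : a % 2 = (T₁ % 2 + T₂ % 2 + Q₃ % 2) % 2) (hb : b % 2 = (T₁ % 2 + T₃ % 2 + Q₂ % 2) % 2)
    (hc : c % 2 = (T₁ % 2 + T₄ % 2 + Q₁ % 2) % 2) (hd : d % 2 = (T₃ % 2 + T₄ % 2 + Q₃ % 2) % 2)
    (he : e % 2 = (T₂ % 2 + T₄ % 2 + Q₂ % 2) % 2) (hf : f % 2 = (T₂ % 2 + T₃ % 2 + Q₁ % 2) % 2)
    (h₁ : T₁ ≤ Q₁ ∧ T₂ ≤ Q₁ ∧ T₃ ≤ Q₁ ∧ T₄ ≤ Q₁) (h₂ : T₁ ≤ Q₂ ∧ T₂ ≤ Q₂ ∧ T₃ ≤ Q₂ ∧ T₄ ≤ Q₂)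
    (h₃ : T₁ ≤ Q₃ ∧ T₂ ≤ Q₃ ∧ T₃ ≤ Q₃ ∧ T₄ ≤ Q₃)
    (hT : T₁ % 2 = 1 ∧ T₂ % 2 = 1 ∧ T₃ % 2 = 1 ∧ T₄ % 2 = 1)
    (hQ : Q₁ % 2 = 0 ∧ Q₂ % 2 = 0 ∧ Q₃ % 2 = 0) :
    2 * ((min 1 (a % 2 + b % 2 + c % 2 + d % 2 + e % 2 + f % 2) : ℕ) : ℤ) -
      (((((Q₃ - T₂) % 2 + (Q₂ - T₃) % 2 + (Q₁ - T₄) % 2) / 2 : ℕ) : ℤ) +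
      (((Q₃ - T₁) % 2 + (Q₂ - T₄) % 2 + (Q₁ - T₃) % 2) / 2 : ℕ) +
      (((Q₃ - T₄) % 2 + (Q₂ - T₁) % 2 + (Q₁ - T₂) % 2) / 2 : ℕ) +
      (((Q₃ - T₃) % 2 + (Q₂ - T₂) % 2 + (Q₁ - T₁) % 2) / 2 : ℕ)) ≤
    2 * (∑ i, ∑ j, (((![Q₁, Q₂, Q₃] i - ![T₁, T₂, T₃, T₄] j) / 2 : ℕ) : ℤ) -
        ((a / 2 : ℕ) + (b / 2 : ℕ) + (c / 2 : ℕ) + (d / 2 : ℕ) + (e / 2 : ℕ) + (f / 2 : ℕ))) + 8 := by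
  obtain ⟨t1, t2, t3, t4⟩ := hT
  obtain ⟨q1, q2, q3⟩ := hQ
  have l1 := two_mul_half a
  have l2 := two_mul_half b
  have l3 := two_mul_half c
  have l4 := two_mul_half d
  have l5 := two_mul_half e
  have l6 := two_mul_half f
  have m1 := two_mul_half_sub h₁.1
  have m2 := two_mul_half_sub h₁.2.1
  have m3 := two_mul_half_sub h₁.2.2.1
  have m4 := two_mul_half_sub h₁.2.2.2
  have m5 := two_mul_half_sub h₂.1
  have m6 := two_mul_half_sub h₂.2.1
  have m7 := two_mul_half_sub h₂.2.2.1
  have m8 := two_mul_half_sub h₂.2.2.2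
  have m9 := two_mul_half_sub h₃.1
  have m10 := two_mul_half_sub h₃.2.1
  have m11 := two_mul_half_sub h₃.2.2.1
  have m12 := two_mul_half_sub h₃.2.2.2
  rw [sub_mod_two h₁.1, sub_mod_two h₁.2.1, sub_mod_two h₁.2.2.1, sub_mod_two h₁.2.2.2,
    sub_mod_two h₂.1, sub_mod_two h₂.2.1, sub_mod_two h₂.2.2.1, sub_mod_two h₂.2.2.2,
    sub_mod_two h₃.1, sub_mod_two h₃.2.1, sub_mod_two h₃.2.2.1, sub_mod_two h₃.2.2.2]
  -- Here all edges are even and all differences of a square and a triangle are odd, so the four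
  -- vertices are red. The prefactor has order `-6`, and the inequality is the equality `-4 = -12 +
  -- 8`.
  simp only [t1, t2, t3, t4, q1, q2, q3] at *
  rw [ha] at l1 ⊢
  rw [hb] at l2 ⊢
  rw [hc] at l3 ⊢
  rw [hd] at l4 ⊢
  rw [he] at l5 ⊢
  rw [hf] at l6 ⊢
  simp only [Fin.sum_univ_three, Fin.sum_univ_four, Matrix.cons_val_zero, Matrix.cons_val_one,
    Matrix.cons_val]
  have hS' := congrArg (Nat.cast (R := ℤ)) hS
  have hs' := congrArg (Nat.cast (R := ℤ)) hs
  clear hS hs ha hb hc hd he hf h₁ h₂ h₃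
  simp only [Nat.cast_add] at hS' hs'
  norm_num at l1 l2 l3 l4 l5 l6 m1 m2 m3 m4 m5 m6 m7 m8 m9 m10 m11 m12 hS' hs' ⊢
  linarith only [l1, l2, l3, l4, l5, l6, m1, m2, m3, m4, m5, m6, m7, m8, m9, m10, m11, m12, hS', hs']

open Classical in
/-- The tetrahedron graph has order at least `1` or `0` according to whether it has an odd edge,
minus half the number of its red vertices. -/
theorem exists_ordGE_tet {a b c d e f : ℕ} (h₁ : Admissible {a, b, c}) (h₂ : Admissible {a, e, f})
    (h₃ : Admissible {d, b, f}) (h₄ : Admissible {d, e, c}) :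
    ∃ n : ℤ, OrdGE (tet a b c d e f) n ∧
      2 * (if Odd a ∨ Odd b ∨ Odd c ∨ Odd d ∨ Odd e ∨ Odd f then 1 else 0) -
        ((if Red {a, b, c} then 1 else 0) + (if Red {a, e, f} then 1 else 0) +
          (if Red {d, b, f} then 1 else 0) + (if Red {d, e, c} then 1 else 0)) ≤ 2 * n := by
  obtain ⟨T₁, hT₁, a₁, b₁, c₁⟩ := h₁.exists_half
  obtain ⟨T₂, hT₂, a₂, e₂, f₂⟩ := h₂.exists_half
  obtain ⟨T₃, hT₃, d₃, b₃, f₃⟩ := h₃.exists_half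
  obtain ⟨T₄, hT₄, d₄, e₄, c₄⟩ := h₄.exists_half
  rw [ite_red h₁ hT₁, ite_red h₂ hT₂, ite_red h₃ hT₃, ite_red h₄ hT₄, ite_odd_six]
  clear h₁ h₂ h₃ h₄
  -- A square is the sum of the two triangles at an edge it avoids, minus that edge. The two
  -- opposite edges avoided by a square define the same number.
  obtain ⟨Q₁, hc⟩ : ∃ Q, Q + c = T₁ + T₄ :=
    ⟨T₁ + T₄ - c, Nat.sub_add_cancel (c₁.trans (Nat.le_add_right _ _))⟩
  obtain ⟨Q₂, hb⟩ : ∃ Q, Q + b = T₁ + T₃ :=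
    ⟨T₁ + T₃ - b, Nat.sub_add_cancel (b₁.trans (Nat.le_add_right _ _))⟩
  obtain ⟨Q₃, ha⟩ : ∃ Q, Q + a = T₁ + T₂ :=
    ⟨T₁ + T₂ - a, Nat.sub_add_cancel (a₁.trans (Nat.le_add_right _ _))⟩
  have hf : Q₁ + f = T₂ + T₃ := by linarith
  have he : Q₂ + e = T₂ + T₄ := by linarith
  have hd : Q₃ + d = T₃ + T₄ := by linarith
  have hS : T₁ + T₂ + T₃ + T₄ = Q₁ + Q₂ + Q₃ := by linarith
  have hs : a + b + c + d + e + f = T₁ + T₂ + T₃ + T₄ := by linarith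
  rw [show tet a b c d e f = _ from funext (tet_eq a b c d e f)]
  rw [show (a + b + c) / 2 = T₁ from Nat.div_eq_of_eq_mul_right two_pos hT₁,
    show (a + e + f) / 2 = T₂ from Nat.div_eq_of_eq_mul_right two_pos hT₂,
    show (d + b + f) / 2 = T₃ from Nat.div_eq_of_eq_mul_right two_pos hT₃,
    show (d + e + c) / 2 = T₄ from Nat.div_eq_of_eq_mul_right two_pos hT₄,
    show (a + b + d + e) / 2 = Q₁ from Nat.div_eq_of_eq_mul_right two_pos (by linarith),
    show (a + c + d + f) / 2 = Q₂ from Nat.div_eq_of_eq_mul_right two_pos (by linarith),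
    show (b + c + e + f) / 2 = Q₃ from Nat.div_eq_of_eq_mul_right two_pos (by linarith)]
  clear hT₁ hT₂ hT₃ hT₄
  obtain ⟨⟨la1, la2⟩, ⟨ra1, ra2⟩, pa⟩ := square_relations ha a₁ a₂
  obtain ⟨⟨lb1, lb3⟩, ⟨rb1, rb3⟩, pb⟩ := square_relations hb b₁ b₃
  obtain ⟨⟨lc1, lc4⟩, ⟨rc1, rc4⟩, pc⟩ := square_relations hc c₁ c₄
  obtain ⟨⟨ld3, ld4⟩, ⟨rd3, rd4⟩, pd⟩ := square_relations hd d₃ d₄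
  obtain ⟨⟨le2, le4⟩, ⟨re2, re4⟩, pe⟩ := square_relations he e₂ e₄
  obtain ⟨⟨lf2, lf3⟩, ⟨rf2, rf3⟩, pf⟩ := square_relations hf f₂ f₃
  rw [ra1, ra2, rb1, rb3, rc1, rc4, rd3, rd4, re2, re4, rf2, rf3]
  clear ha hb hc hd he hf ra1 ra2 rb1 rb3 rc1 rc4 rd3 rd4 re2 re4 rf2 rf3
    a₁ a₂ b₁ b₃ c₁ c₄ d₃ d₄ e₂ e₄ f₂ f₃
  have hpre := (HasOrd.prod Finset.univ fun i _ => HasOrd.prod Finset.univ fun j _ =>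
    hasOrd_qFact (![Q₁, Q₂, Q₃] i - ![T₁, T₂, T₃, T₄] j)).div
    ((((((hasOrd_qFact a).mul (hasOrd_qFact b)).mul (hasOrd_qFact c)).mul (hasOrd_qFact d)).mul
      (hasOrd_qFact e)).mul (hasOrd_qFact f))
  have bound := fun z => tet_term_bound (z := z) hS hs pa pb pc pd pe pf
  generalize hR : 2 * ((min 1 (a % 2 + b % 2 + c % 2 + d % 2 + e % 2 + f % 2) : ℕ) : ℤ) - _ = R
    at bound ⊢
  generalize hp : (∑ i, ∑ j, (((![Q₁, Q₂, Q₃] i - ![T₁, T₂, T₃, T₄] j) / 2 : ℕ) : ℤ) - _ : ℤ) = p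
    at bound hpre
  -- The case in which the estimate fails term by term and the cancellation in pairs is needed.
  by_cases hsp : (∀ j, ![T₁, T₂, T₃, T₄] j % 2 = 1) ∧ ∀ i, ![Q₁, Q₂, Q₃] i % 2 = 0
  · refine ⟨p + 4, hpre.ordGE.mul (ordGE_tetSum_of_odd_even _ _ hsp.1 hsp.2 ?_), ?_⟩
    · simpa [Fin.sum_univ_three, Fin.sum_univ_four] using hS
    · have h1 := hsp.1
      have h2 := hsp.2
      simp only [Fin.forall_fin_succ] at h1 h2
      clear bound hpre hsp
      subst hR hp
      rw [mul_add]
      exact tet_odd_even_bound hS hs pa pb pc pd pe pf ⟨lc1, lf2, lf3, lc4⟩ ⟨lb1, le2, lb3, le4⟩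
        ⟨la1, la2, ld3, ld4⟩ (by simpa using h1) (by simpa using h2)
  -- The quotient `(R - 2 * p + 1) / 2` is `R / 2 - p` rounded up, as orders are integers.
  · have key : ∀ z, (∀ j, ![T₁, T₂, T₃, T₄] j ≤ z) → (∀ i, z ≤ ![Q₁, Q₂, Q₃] i) → 
        (R - 2 * p + 1) / 2 ≤ (((z + 1) / 2 : ℕ) : ℤ) - (∑ j, (((z - ![T₁, T₂, T₃, T₄] j) / 2 : ℕ) : ℤ) +
        ∑ i, (((![Q₁, Q₂, Q₃] i - z) / 2 : ℕ) : ℤ)) := by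
      intro z h1 h2
      have h0 : ((T₁ % 2 * (T₂ % 2) * (T₃ % 2) * (T₄ % 2)) *
        ((1 - Q₁ % 2) * (1 - Q₂ % 2) * (1 - Q₃ % 2)) : ℕ) = 0 := by
        by_contra h
        apply hsp
        simp only [mul_ne_zero_iff] at h
        obtain ⟨⟨⟨⟨u1, u2⟩, u3⟩, u4⟩, ⟨v1, v2⟩, v3⟩ := h
        simp only [Nat.mod_two_ne_zero] at u1 u2 u3 u4
        have hv : ∀ Q : ℕ, 1 - Q % 2 ≠ 0 → Q % 2 = 0 := fun Q h => by clear * - h; omega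
        simp [Fin.forall_fin_succ, u1, u2, u3, u4, hv _ v1, hv _ v2, hv _ v3]
      have := bound z h1 h2
      rw [h0] at this
      generalize (((z + 1) / 2 : ℕ) : ℤ) - _ = N at this ⊢
      clear * - this
      omega
    refine ⟨_, hpre.ordGE.mul (ordGE_tetSum _ _ _ key), ?_⟩
    clear * -
    omega

end Quantum

/-! ### Arcs whose interior vertices have valence two. -/

namespace SimpleGraph

variable {W : Type*} {G : SimpleGraph W}

/-- There is an arc which starts at `x` along the edge `xz`, ends at `y` along the edge `uy`, and
whose interior vertices have valence two. -/
inductive Arc (G : SimpleGraph W) : W → W → W → W → Prop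
  | edge {x z : W} : G.Adj x z → Arc G x z x z
  | step {x z w u y : W} : G.Adj x z → G.valence z = 2 → w ≠ x → Arc G z w u y → Arc G x z u y

theorem Arc.adj_left {x z u y : W} (h : G.Arc x z u y) : G.Adj x z := by
  cases h <;> assumption

theorem Arc.adj_right {x z u y : W} (h : G.Arc x z u y) : G.Adj u y := by
  induction h <;> assumption

theorem Arc.snoc {x z u y w : W} (h : G.Arc x z u y) (hy : G.valence y = 2) (hw : G.Adj y w)
    (hne : w ≠ u) : G.Arc x z y w := by
  induction h with
  | edge h => exact .step h hy hne (.edge hw)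
  | step h1 h2 h3 _ ih => exact .step h1 h2 h3 (ih hy hw hne)

theorem Arc.reverse {x z u y : W} (h : G.Arc x z u y) : G.Arc y u z x := by
  induction h with
  | edge h => exact .edge h.symm
  | step h1 h2 h3 _ ih => exact ih.snoc h2 h1.symm h3.symm

/-- A vertex of valence two has only two neighbors. -/
theorem eq_of_valence_two {z a b c : W} (h : G.valence z = 2) (ha : G.Adj z a) (hb : G.Adj z b)
    (hc : G.Adj z c) (hba : b ≠ a) (hca : c ≠ a) : b = c := by
  obtain ⟨p, q, -, hpq⟩ := Set.ncard_eq_two.1 h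
  have h1 : a ∈ G.neighborSet z := ha
  have h2 : b ∈ G.neighborSet z := hb
  have h3 : c ∈ G.neighborSet z := hc
  rw [hpq] at h1 h2 h3
  simp only [Set.mem_insert_iff, Set.mem_singleton_iff] at h1 h2 h3
  grind

/-- At a vertex of valence two there is only one way to go on, so the first edge determines the arc
until a vertex of another valence. With `Arc.reverse`, arcs that leave by different edges and end at
the same branch point must arrive by different edges. -/
theorem Arc.unique {x z u y u' y' : W} (h : G.Arc x z u y) (h' : G.Arc x z u' y')
    (hy : G.valence y ≠ 2) (hy' : G.valence y' ≠ 2) : u = u' ∧ y = y' := by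
  induction h with
  | edge h =>
    cases h' with
    | edge => exact ⟨rfl, rfl⟩
    | step h1 h2 h3 h4 => exact absurd h2 hy
  | step h1 h2 h3 h4 ih =>
    cases h' with
    | edge => exact absurd h2 hy'
    | step k1 k2 k3 k4 =>
      obtain rfl := eq_of_valence_two h2 h1.symm h4.adj_left k4.adj_left h3 k3
      exact ih k4 hy

/-- A path never turns back, which is the condition `w ≠ x` in each step. The arc also records the
edge of arrival, needed to compare colors at its two ends. -/
theorem exists_arc_of_isPath {x y : W} (p : G.Walk x y) (hp : p.IsPath) (hxy : x ≠ y)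
    (h : ∀ w ∈ p.support, w ≠ x → w ≠ y → G.valence w = 2) : ∃ u, G.Arc x p.snd u y := by
  induction p with
  | nil => exact absurd rfl hxy
  | @cons a b c hab p ih =>
    rw [Walk.cons_isPath_iff] at hp
    rw [Walk.snd_cons]
    by_cases hbc : b = c
    · subst hbc
      exact ⟨a, .edge hab⟩
    · have hb : b ≠ a := hab.ne'
      obtain ⟨u, hu⟩ := ih hp.1 hbc fun w hw h1 h2 => h w (by simp [hw])
        (fun e => hp.2 (e ▸ hw)) h2
      refine ⟨u, .step hab (h b (by simp) hb hbc) ?_ hu⟩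
      intro e
      apply hp.2
      rw [← e]
      exact Walk.getVert_mem_support _ _

theorem ArcVia.exists_arc {x z y : W} (h : G.ArcVia x z y) : ∃ u, G.Arc x z u y := by
  obtain ⟨hxy, p, hp, rfl, h⟩ := h
  exact exists_arc_of_isPath p hp hxy h

theorem exists_adj_of_valence_ne_zero {x : W} (h : G.valence x ≠ 0) : ∃ z, G.Adj x z :=
  Set.nonempty_of_ncard_ne_zero h

/-- A vertex whose valence is the number of the distinct neighbors `z i` has no other neighbor. -/
theorem exists_eq_of_valence {ι : Type*} [Fintype ι] {x : W} (z : ι → W)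
    (hx : G.valence x = Fintype.card ι) (hz : Function.Injective z) (hadj : ∀ i, G.Adj x (z i))
    (hfin : (G.neighborSet x).Finite) {w : W} (hw : G.Adj x w) : ∃ i, z i = w := by
  have hs : Set.range z ⊆ G.neighborSet x := by
    rintro _ ⟨i, rfl⟩
    exact hadj i
  have hc : (G.neighborSet x).ncard ≤ (Set.range z).ncard := by
    rw [← Set.image_univ, Set.ncard_image_of_injective _ hz, Set.ncard_univ,
      Nat.card_eq_fintype_card]
    exact hx.le
  have := Set.eq_of_subset_of_ncard_le hs hc hfin
  have h : w ∈ Set.range z := by rw [this]; exact hw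
  exact h

end SimpleGraph

/-! ### Euler characteristics of sets of open simplices. -/

namespace Simplices

variable {V : Type*}

/-- The nonempty chains of elements of `A`. -/
def chains (A : Set (Finset V)) : Set (Finset (Finset V)) :=
  {c | c.Nonempty ∧ (c : Set (Finset V)) ⊆ A ∧ IsChain (· ⊆ ·) (c : Set (Finset V))}

theorem eulerChar_eq (A : Set (Finset V)) :
    eulerChar A = ∑ᶠ c ∈ chains A, (-1 : ℤ) ^ (c.card + 1) := rfl

theorem finite_chains {A : Set (Finset V)} (hA : A.Finite) : (chains A).Finite :=
  hA.toFinset.powerset.finite_toSet.subset fun c hc => by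
    simpa [Set.subset_def, Finset.subset_iff] using hc.2.1

theorem eulerChar_empty : eulerChar (∅ : Set (Finset V)) = 0 := by
  rw [eulerChar_eq, show chains (∅ : Set (Finset V)) = ∅ from ?_, finsum_mem_empty]
  ext c
  simp only [chains, Set.mem_ofPred_eq, Set.subset_empty_iff, Finset.coe_eq_empty,
    Set.mem_empty_iff_false, iff_false]
  rintro ⟨h1, h2, -⟩
  exact h1.ne_empty h2

variable [DecidableEq V]

/-- A chain containing `s` is `s` added to the empty chain or to a chain of other simplices
comparable with `s`; adding `s` changes the sign. -/
theorem eulerChar_remove {A : Set (Finset V)} (hA : A.Finite) {s : Finset V} (hs : s ∈ A) :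
    eulerChar A = eulerChar (A \ {s}) + 1 - eulerChar {t | t ∈ A ∧ (s ⊂ t ∨ t ⊂ s)} := by
  set B : Set (Finset V) := {t | t ∈ A ∧ (s ⊂ t ∨ t ⊂ s)} with hB
  have hBA : B ⊆ A := fun t ht => ht.1
  have hsB : s ∉ B := fun h => h.2.elim (fun h => ssubset_irrefl s h) fun h => ssubset_irrefl s h
  have hsc : ∀ c ∈ insert ∅ (chains B), s ∉ c := by
    rintro c (rfl | hc) h
    · simp at h
    · exact hsB (hc.2.1 h)
  have h1 : chains A = chains (A \ {s}) ∪ (insert s) '' (insert ∅ (chains B)) := by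
    ext c
    constructor
    · rintro ⟨h1, h2, h3⟩
      by_cases hc : s ∈ c
      · right
        refine ⟨c.erase s, ?_, Finset.insert_erase hc⟩
        rcases (c.erase s).eq_empty_or_nonempty with h | h
        · exact Or.inl h
        · refine Or.inr ⟨h, ?_, ?_⟩
          · intro t ht
            have ht := Finset.mem_erase.1 (Finset.mem_coe.1 ht)
            refine ⟨h2 ht.2, ?_⟩
            rcases h3 hc ht.2 ht.1.symm with h | h
            · exact Or.inl (Finset.ssubset_iff_subset_ne.2 ⟨h, ht.1.symm⟩)
            · exact Or.inr (Finset.ssubset_iff_subset_ne.2 ⟨h, ht.1⟩)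
          · exact h3.mono (by simp)
      · left
        refine ⟨h1, fun t ht => ⟨h2 ht, fun e => hc (e ▸ ht)⟩, h3⟩
    · rintro (⟨h1, h2, h3⟩ | ⟨c, hc, rfl⟩)
      · exact ⟨h1, h2.trans Set.sdiff_subset, h3⟩
      · rcases hc with rfl | ⟨h1, h2, h3⟩
        · exact ⟨by simp, by simpa using hs, by simp⟩
        · refine ⟨by simp, ?_, ?_⟩
          · rw [Finset.coe_insert]
            exact Set.insert_subset hs (h2.trans hBA)
          · rw [Finset.coe_insert]
            refine h3.insert fun t ht _ => ?_
            exact (h2 ht).2.imp (fun h => h.subset) fun h => h.subset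
  have hd : Disjoint (chains (A \ {s})) ((insert s) '' (insert ∅ (chains B))) := by
    rw [Set.disjoint_left]
    rintro c hc ⟨d, -, rfl⟩
    exact (hc.2.1 (Finset.mem_insert_self s d)).2 rfl
  have hf := finite_chains (hA.subset hBA)
  rw [eulerChar_eq, h1, finsum_mem_union hd (finite_chains (hA.subset Set.sdiff_subset))
    ((hf.insert _).image _), finsum_mem_image, finsum_mem_insert _ _ hf]
  · rw [eulerChar_eq (A \ {s}), eulerChar_eq B, add_sub_assoc, sub_eq_add_neg,
      ← finsum_mem_neg_distrib _ hf]
    congr 2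
    · simp
    · refine finsum_mem_congr rfl fun c hc => ?_
      rw [Finset.card_insert_of_notMem (hsc c (Or.inr hc))]
      ring
  · exact fun h => h.1.ne_empty rfl
  · intro c hc d hd h
    rw [← Finset.erase_insert (hsc c hc), ← Finset.erase_insert (hsc d hd)]
    exact congrArg (fun x => Finset.erase x s) h

/-- The Euler characteristic, computed by grouping the chains according to their minima. -/
theorem eulerChar_eq_sum_above (A : Finset (Finset V)) :
    eulerChar (A : Set (Finset V)) =
      ∑ s ∈ A, (1 - eulerChar {t | t ∈ A ∧ s ⊂ t}) := by
  induction A using Finset.strongInduction with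
  | H A ih =>
    rcases A.eq_empty_or_nonempty with rfl | hne
    · simpa using eulerChar_empty
    -- What is comparable with a minimal simplex lies above it, and its removal does not affect what
    -- lies above the others.
    · obtain ⟨s, hs⟩ := A.exists_minimal hne
      have hmin : ∀ t ∈ A, ¬ t ⊂ s := fun t ht h => hs.not_lt ht h
      rw [eulerChar_remove A.finite_toSet (Finset.mem_coe.2 hs.1), ← Finset.coe_singleton,
        ← Finset.coe_sdiff, Finset.sdiff_singleton_eq_erase, ih _ (Finset.erase_ssubset hs.1),
        ← Finset.add_sum_erase A _ hs.1]
      have e1 : {t | t ∈ (A : Set (Finset V)) ∧ (s ⊂ t ∨ t ⊂ s)} = {t | t ∈ A ∧ s ⊂ t} := by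
        ext t
        simp only [Set.mem_ofPred_eq, Finset.mem_coe]
        exact ⟨fun h => ⟨h.1, h.2.resolve_right (hmin t h.1)⟩, fun h => ⟨h.1, Or.inl h.2⟩⟩
      have e2 : ∀ t ∈ A.erase s, (1 - eulerChar {u | u ∈ A.erase s ∧ t ⊂ u}) =
          1 - eulerChar {u | u ∈ A ∧ t ⊂ u} := by
        intro t ht
        congr 2
        ext u
        simp only [Set.mem_ofPred_eq, Finset.mem_erase]
        refine ⟨fun h => ⟨h.1.2, h.2⟩, fun h => ⟨⟨?_, h.1⟩, h.2⟩⟩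
        rintro rfl
        exact hmin t (Finset.mem_of_mem_erase ht) h.2
      rw [e1, Finset.sum_congr rfl e2]
      ring

theorem eulerChar_of_antichain (A : Finset (Finset V)) (h : ∀ s ∈ A, ∀ t ∈ A, ¬ s ⊂ t) :
    eulerChar (A : Set (Finset V)) = A.card := by
  rw [eulerChar_eq_sum_above, Finset.sum_congr rfl (g := fun _ => (1 : ℤ))]
  · simp
  · intro s hs
    rw [show {t | t ∈ A ∧ s ⊂ t} = ∅ from ?_, eulerChar_empty, sub_zero]
    ext t
    simpa using h s hs t

/-- The Euler characteristic of a simplicial complex. -/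
theorem eulerChar_of_isLower (A : Finset (Finset V)) (h0 : ∅ ∉ A)
    (h : ∀ t ∈ A, ∀ s ⊆ t, s.Nonempty → s ∈ A) :
    eulerChar (A : Set (Finset V)) = ∑ s ∈ A, (-1 : ℤ) ^ (s.card + 1) := by
  induction A using Finset.strongInduction with
  | H A ih =>
    rcases A.eq_empty_or_nonempty with rfl | hne
    · simpa using eulerChar_empty
    -- What is comparable with a maximal simplex is its set of proper faces, a smaller complex to
    -- which the induction applies as well. Its alternating sum is known because the one over all
    -- subsets of `t` vanishes.
    · obtain ⟨t, ht⟩ := A.exists_maximal hne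
      have hmax : ∀ s ∈ A, ¬ t ⊂ s := fun s hs h => ht.not_gt hs h
      have htn : t.Nonempty := Finset.nonempty_iff_ne_empty.2 fun e => h0 (e ▸ ht.1)
      have e1 : {s | s ∈ (A : Set (Finset V)) ∧ (t ⊂ s ∨ s ⊂ t)} =
          ((t.ssubsets.erase ∅ : Finset (Finset V)) : Set (Finset V)) := by
        ext s
        simp only [Set.mem_ofPred_eq, Finset.mem_coe, Finset.mem_erase, Finset.mem_ssubsets]
        constructor
        · rintro ⟨h1, h2⟩
          exact ⟨fun e => h0 (e ▸ h1), h2.resolve_left (hmax s h1)⟩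
        · rintro ⟨h1, h2⟩
          exact ⟨h t ht.1 s h2.subset (Finset.nonempty_iff_ne_empty.2 h1), Or.inr h2⟩
      have hsub : t.ssubsets.erase ∅ ⊂ A := by
        refine (Finset.ssubset_iff_of_subset ?_).2 ⟨t, ht.1, by simp⟩
        intro s hs
        simp only [Finset.mem_erase, Finset.mem_ssubsets] at hs
        exact h t ht.1 s hs.2.subset (Finset.nonempty_iff_ne_empty.2 hs.1)
      rw [eulerChar_remove A.finite_toSet (Finset.mem_coe.2 ht.1), e1, ← Finset.coe_singleton,
        ← Finset.coe_sdiff, Finset.sdiff_singleton_eq_erase,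
        ih _ (Finset.erase_ssubset ht.1) (fun h => h0 (Finset.mem_of_mem_erase h)) ?_,
        ih _ hsub (by simp) ?_, ← Finset.add_sum_erase A _ ht.1]
      · have hsum : ∑ s ∈ t.ssubsets.erase ∅, (-1 : ℤ) ^ (s.card + 1) = 1 - (-1) ^ (t.card + 1) := by
          have h2 := Finset.sum_powerset_neg_one_pow_card_of_nonempty htn
          rw [← Finset.insert_erase (Finset.mem_powerset_self t), Finset.sum_insert (by simp),
            show t.powerset.erase t = t.ssubsets from rfl,
            ← Finset.add_sum_erase t.ssubsets _ (Finset.empty_mem_ssubsets htn)] at h2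
          simp only [pow_succ, Finset.card_empty, pow_zero, mul_neg, mul_one,
            Finset.sum_neg_distrib] at h2 ⊢
          linarith
        rw [hsum]
        ring
      · intro s hs u hu hun
        simp only [Finset.mem_erase, Finset.mem_ssubsets] at hs ⊢
        exact ⟨hun.ne_empty, hu.trans_ssubset hs.2⟩
      · intro s hs u hu hun
        rw [Finset.mem_erase] at hs ⊢
        refine ⟨?_, h s hs.2 u hu hun⟩
        rintro rfl
        exact hmax s hs.2 (Finset.ssubset_iff_subset_ne.2 ⟨hu, hs.1.symm⟩)

end Simplices

namespace SimplePolyhedron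

open Simplices

variable {V : Type*} [DecidableEq V] {X : SimplePolyhedron V}

/-! ## Faces and links -/

theorem nonempty_of_mem_faces {s : Finset V} (hs : s ∈ X.faces) : s.Nonempty :=
  (X.isRelLowerSet_faces hs).1

theorem mem_faces_of_subset {s t : Finset V} (ht : t ∈ X.faces) (hst : s ⊆ t) (hs : s.Nonempty) :
    s ∈ X.faces :=
  (X.isRelLowerSet_faces ht).2 hst hs

theorem mem_cofaces {s t : Finset V} : t ∈ X.cofaces s ↔ t ∈ X.faces ∧ t.card = 3 ∧ s ⊆ t := by
  simp [cofaces]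

/-- The 1-simplex joining `v` to a vertex of its link. -/
def seg (v : V) (x : X.LinkVertex v) : Finset V := {v, x.1}

/-- The triangle spanned by `v` and an edge of its link. -/
def tri (v : V) (x y : X.LinkVertex v) : Finset V := {v, x.1, y.1}

theorem card_seg {v : V} (x : X.LinkVertex v) : (seg v x).card = 2 :=
  Finset.card_pair x.2.1.symm

theorem seg_mem_faces {v : V} (x : X.LinkVertex v) : seg v x ∈ X.faces := x.2.2

theorem seg_injective (v : V) : Function.Injective (seg (X := X) v) := by
  intro x y h
  have h1 : x.1 ∈ seg v y := h ▸ (by simp [seg])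
  simp only [seg, Finset.mem_insert, Finset.mem_singleton] at h1
  exact Subtype.ext (h1.resolve_left x.2.1)

theorem singleton_ssubset_seg {v : V} (x : X.LinkVertex v) : {v} ⊂ seg v x :=
  Finset.ssubset_iff_subset_ne.2 ⟨by simp [seg], fun e => by
    have h := card_seg x
    simp [← e] at h⟩

theorem exists_eq_seg {v : V} {s : Finset V} (hs : s ∈ X.faces) (hc : s.card = 2) (hv : v ∈ s) :
    ∃ x : X.LinkVertex v, s = seg v x := by
  obtain ⟨a, b, hab, rfl⟩ := Finset.card_eq_two.1 hc
  simp only [Finset.mem_insert, Finset.mem_singleton] at hv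
  rcases hv with rfl | rfl
  · exact ⟨⟨b, hab.symm, hs⟩, rfl⟩
  · exact ⟨⟨a, hab, Finset.pair_comm a v ▸ hs⟩, Finset.pair_comm a v⟩

theorem tri_comm {v : V} (x y : X.LinkVertex v) : tri v x y = tri v y x := by
  unfold tri
  rw [Finset.pair_comm]

theorem card_tri {v : V} {x y : X.LinkVertex v} (h : x ≠ y) : (tri v x y).card = 3 :=
  Finset.card_eq_three.2 ⟨v, x.1, y.1, x.2.1.symm, y.2.1.symm, fun e => h (Subtype.ext e), rfl⟩

theorem seg_subset_tri {v : V} (x y : X.LinkVertex v) : seg v x ⊆ tri v x y := by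
  intro a
  simp only [seg, tri, Finset.mem_insert, Finset.mem_singleton]
  tauto

theorem tri_mem_cofaces {v : V} {x y : X.LinkVertex v} (h : (X.link v).Adj x y) :
    tri v x y ∈ X.cofaces (seg v x) :=
  mem_cofaces.2 ⟨h.2, card_tri h.1, seg_subset_tri x y⟩

theorem exists_eq_tri {v : V} {t : Finset V} (ht : t ∈ X.faces) (hc : t.card = 3) (hv : v ∈ t) :
    ∃ x y : X.LinkVertex v, (X.link v).Adj x y ∧ t = tri v x y := by
  obtain ⟨a, b, hab, he⟩ := Finset.card_eq_two.1 (show (t.erase v).card = 2 by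
    rw [Finset.card_erase_of_mem hv, hc])
  have h1 : t = {v, a, b} := by rw [← he, Finset.insert_erase hv]
  have ha : a ∈ t.erase v := by simp [he]
  have hb : b ∈ t.erase v := by simp [he]
  rw [Finset.mem_erase] at ha hb
  refine ⟨⟨a, ha.1, mem_faces_of_subset ht ?_ (by simp)⟩,
    ⟨b, hb.1, mem_faces_of_subset ht ?_ (by simp)⟩,
    ⟨fun e => hab (congrArg Subtype.val e), h1 ▸ ht⟩, h1⟩
  · rintro c hc
    simp only [Finset.mem_insert, Finset.mem_singleton] at hc
    rcases hc with rfl | rfl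
    exacts [hv, ha.2]
  · rintro c hc
    simp only [Finset.mem_insert, Finset.mem_singleton] at hc
    rcases hc with rfl | rfl
    exacts [hv, hb.2]

theorem exists_eq_tri_of_mem_cofaces {v : V} {x : X.LinkVertex v} {t : Finset V}
    (ht : t ∈ X.cofaces (seg v x)) : ∃ y, (X.link v).Adj x y ∧ t = tri v x y := by
  obtain ⟨h1, h2, h3⟩ := mem_cofaces.1 ht
  obtain ⟨a, b, hab, rfl⟩ := exists_eq_tri h1 h2 (h3 (by simp [seg] : v ∈ seg v x))
  have hx : x.1 ∈ tri v a b := h3 (by simp [seg])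
  simp only [tri, Finset.mem_insert, Finset.mem_singleton] at hx
  rcases hx with h | h | h
  · exact absurd h x.2.1
  · obtain rfl := Subtype.ext h
    exact ⟨b, hab, rfl⟩
  · obtain rfl := Subtype.ext h
    exact ⟨a, hab.symm, tri_comm _ _⟩

theorem tri_right_injective {v : V} (x : X.LinkVertex v) :
    Set.InjOn (tri v x) ((X.link v).neighborSet x) := by
  intro y hy z _ h
  have h1 : y.1 ∈ tri v x z := by
    rw [← h]
    simp [tri]
  simp only [tri, Finset.mem_insert, Finset.mem_singleton] at h1
  rcases h1 with h1 | h1 | h1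
  · exact absurd h1 y.2.1
  · exact absurd (Subtype.ext h1).symm hy.1
  · exact Subtype.ext h1

theorem cofaces_seg {v : V} (x : X.LinkVertex v) :
    (X.cofaces (seg v x) : Set (Finset V)) = tri v x '' (X.link v).neighborSet x := by
  ext t
  constructor
  · intro ht
    obtain ⟨y, hy, rfl⟩ := exists_eq_tri_of_mem_cofaces ht
    exact ⟨y, hy, rfl⟩
  · rintro ⟨y, hy, rfl⟩
    exact tri_mem_cofaces hy

theorem card_cofaces_seg {v : V} (x : X.LinkVertex v) :
    (X.cofaces (seg v x)).card = (X.link v).valence x := by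
  rw [← Set.ncard_coe_finset, cofaces_seg, (tri_right_injective x).ncard_image]
  rfl

/-- This translates the shapes of links into strata: valence 1, 2, 3 means boundary edge, region,
interior edge. -/
theorem seg_mem_segments {v : V} (x : X.LinkVertex v) (k : ℕ) :
    seg v x ∈ X.segments k ↔ (X.link v).valence x = k := by
  simp [segments, seg_mem_faces, card_seg, card_cofaces_seg]

instance finite_linkVertex (v : V) : Finite (X.LinkVertex v) :=
  haveI : Finite X.faces := X.finite_faces.to_subtype
  Finite.of_injective (fun x : X.LinkVertex v => (⟨seg v x, seg_mem_faces x⟩ : X.faces))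
    fun _ _ h => seg_injective v (congrArg Subtype.val h)

/-! ## Regions -/

theorem valueAt_of_mem {P : Set (Finset V)} (σ : Component P → ℕ) {s : Finset V} (hs : s ∈ P) :
    valueAt σ s = σ ((incidence P).connectedComponentMk ⟨s, hs⟩) := by
  unfold valueAt
  rw [dif_pos hs]

theorem component_eq_of_subset {P : Set (Finset V)} {s t : Finset V} (hs : s ∈ P) (ht : t ∈ P)
    (h : s ⊆ t) : (incidence P).connectedComponentMk ⟨s, hs⟩ =
      (incidence P).connectedComponentMk ⟨t, ht⟩ := by
  rcases eq_or_ne s t with rfl | hne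
  · rfl
  · exact SimpleGraph.ConnectedComponent.sound (SimpleGraph.Adj.reachable
      (Or.inl (Finset.ssubset_iff_subset_ne.2 ⟨h, hne⟩)))

theorem valueAt_eq_of_subset {P : Set (Finset V)} (σ : Component P → ℕ) {s t : Finset V}
    (hs : s ∈ P) (ht : t ∈ P) (h : s ⊆ t) : valueAt σ s = valueAt σ t := by
  rw [valueAt_of_mem σ hs, valueAt_of_mem σ ht, component_eq_of_subset hs ht h]

theorem triangle_mem_regionSimplices {t : Finset V} (ht : t ∈ X.faces) (hc : t.card = 3) :
    t ∈ X.regionSimplices := Or.inl (Or.inl ⟨ht, hc⟩)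

theorem tri_mem_regionSimplices {v : V} {x y : X.LinkVertex v} (h : (X.link v).Adj x y) :
    tri v x y ∈ X.regionSimplices := triangle_mem_regionSimplices h.2 (card_tri h.1)

/-- The color of the triangle spanned by `v` and an edge of its link. -/
noncomputable def triColor (σ : X.Region → ℕ) (v : V) (x y : X.LinkVertex v) : ℕ :=
  valueAt σ (tri v x y)

theorem triColor_comm (σ : X.Region → ℕ) {v : V} (x y : X.LinkVertex v) :
    triColor σ v x y = triColor σ v y x := by
  unfold triColor
  rw [tri_comm]

/-- The segment from `v` to a vertex of valence two lies in the same region as its two triangles, so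
the color does not jump across it. Hence colors are constant along arcs of the link. -/
theorem triColor_eq_of_valence_two (σ : X.Region → ℕ) {v : V} {x y z : X.LinkVertex v}
    (hx : (X.link v).valence x = 2) (hy : (X.link v).Adj x y) (hz : (X.link v).Adj x z) :
    triColor σ v x y = triColor σ v x z := by
  have hs : seg v x ∈ X.regionSimplices := Or.inl (Or.inr ((seg_mem_segments x 2).2 hx))
  unfold triColor
  rw [← valueAt_eq_of_subset σ hs (tri_mem_regionSimplices hy) (seg_subset_tri x y),
    valueAt_eq_of_subset σ hs (tri_mem_regionSimplices hz) (seg_subset_tri x z)]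

theorem triColor_eq_of_arc (σ : X.Region → ℕ) {v : V} {x z u y : X.LinkVertex v}
    (h : (X.link v).Arc x z u y) : triColor σ v x z = triColor σ v u y := by
  induction h with
  | edge => rfl
  | step h1 h2 _ h4 ih =>
    rw [triColor_comm, triColor_eq_of_valence_two σ h2 h1.symm h4.adj_left, ih]

theorem segmentColors_seg (σ : X.Region → ℕ) {v : V} {x : X.LinkVertex v} {ι : Type*} [Fintype ι]
    (z : ι → X.LinkVertex v) (hz : Function.Injective z) (hadj : ∀ i, (X.link v).Adj x (z i))
    (hx : (X.link v).valence x = Fintype.card ι) :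
    segmentColors σ (seg v x) = Finset.univ.val.map fun i => triColor σ v x (z i) := by
  have h : X.cofaces (seg v x) = Finset.univ.map ⟨fun i => tri v x (z i), fun i j hij =>
      hz (tri_right_injective x (hadj i) (hadj j) hij)⟩ := by
    symm
    apply Finset.eq_of_subset_of_card_le
    · intro t ht
      simp only [Finset.mem_map, Finset.mem_univ, true_and] at ht
      obtain ⟨i, rfl⟩ := ht
      exact tri_mem_cofaces (hadj i)
    · rw [card_cofaces_seg, hx, Finset.card_map, Finset.card_univ]
  unfold segmentColors
  rw [h, Finset.map_val, Multiset.map_map]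
  rfl

theorem mem_segmentColors_seg (σ : X.Region → ℕ) {v : V} {x : X.LinkVertex v} {c : ℕ} :
    c ∈ segmentColors σ (seg v x) ↔ ∃ y, (X.link v).Adj x y ∧ triColor σ v x y = c := by
  unfold segmentColors
  rw [Multiset.mem_map]
  constructor
  · rintro ⟨t, ht, rfl⟩
    obtain ⟨y, hy, rfl⟩ := exists_eq_tri_of_mem_cofaces ht
    exact ⟨y, hy, rfl⟩
  · rintro ⟨y, hy, rfl⟩
    exact ⟨_, tri_mem_cofaces hy, rfl⟩

/-- Colors that occur at `v`, but not around the vertices of its link that have valence different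
from two, do not exist. -/
theorem not_triColor_of_branch {p : ℕ → Prop} (σ : X.Region → ℕ) {v : V}
    (hc : (X.link v).Connected) {x₀ : X.LinkVertex v} (hx₀ : (X.link v).valence x₀ ≠ 2)
    (h : ∀ x, (X.link v).valence x ≠ 2 → ∀ c ∈ segmentColors σ (seg v x), ¬ p c)
    {x y : X.LinkVertex v} (hxy : (X.link v).Adj x y) : ¬ p (triColor σ v x y) := by
  intro hp
  -- The property travels along a walk: the color is unchanged at a vertex of valence two, and `h`
  -- excludes meeting any other vertex.
  have spread : ∀ a b : X.LinkVertex v, (X.link v).Walk a b →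
      (∃ w, (X.link v).Adj a w ∧ p (triColor σ v a w)) →
      ∃ w, (X.link v).Adj b w ∧ p (triColor σ v b w) := by
    intro a b q
    induction q with
    | nil => exact id
    | @cons a b c hab _ ih =>
      rintro ⟨w, hw, hpw⟩
      apply ih
      by_cases ha : (X.link v).valence a = 2
      · refine ⟨a, hab.symm, ?_⟩
        rwa [triColor_comm, triColor_eq_of_valence_two σ ha hab hw]
      · exact absurd hpw (h a ha _ ((mem_segmentColors_seg σ).2 ⟨w, hw, rfl⟩))
  obtain ⟨q⟩ := hc.preconnected x x₀
  obtain ⟨w, hw, hpw⟩ := spread x x₀ q ⟨y, hxy, hp⟩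
  exact h x₀ hx₀ _ ((mem_segmentColors_seg σ).2 ⟨w, hw, rfl⟩) hpw

end SimplePolyhedron

namespace SimplePolyhedron

open Simplices Quantum

variable {V : Type*} [DecidableEq V] {X : SimplePolyhedron V}

/-! ## The segments at a vertex -/

open Classical in
variable (X) in
/-- The 1-simplices that contain the vertex `v` and are contained in exactly `k` triangles. -/
noncomputable def segmentsAt (k : ℕ) (v : V) : Finset (Finset V) :=
  X.finite_faces.toFinset.filter fun s => s ∈ X.segments k ∧ v ∈ s

theorem mem_segmentsAt {k : ℕ} {v : V} {s : Finset V} :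
    s ∈ X.segmentsAt k v ↔ s ∈ X.segments k ∧ v ∈ s := by
  simp only [segmentsAt, Finset.mem_filter, Set.Finite.mem_toFinset, and_iff_right_iff_imp]
  exact fun h => h.1.1

theorem mem_segmentsAt_iff_exists {k : ℕ} {v : V} {s : Finset V} :
    s ∈ X.segmentsAt k v ↔ ∃ x : X.LinkVertex v, (X.link v).valence x = k ∧ s = seg v x := by
  rw [mem_segmentsAt]
  constructor
  · rintro ⟨h, hv⟩
    obtain ⟨x, rfl⟩ := exists_eq_seg h.1 h.2.1 hv
    exact ⟨x, (seg_mem_segments x k).1 h, rfl⟩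
  · rintro ⟨x, hx, rfl⟩
    exact ⟨(seg_mem_segments x k).2 hx, by simp [seg]⟩

theorem segmentsAt_eq_map {k : ℕ} {v : V} {ι : Type*} [Fintype ι] (x : ι → X.LinkVertex v)
    (hx : Function.Injective x) (h : ∀ y, (X.link v).valence y = k ↔ y ∈ Set.range x) :
    X.segmentsAt k v = Finset.univ.map ⟨fun i => seg v (x i), (seg_injective v).comp hx⟩ := by
  ext s
  rw [mem_segmentsAt_iff_exists]
  simp only [h, Finset.mem_map, Finset.mem_univ, true_and, Function.Embedding.coeFn_mk]
  constructor
  · rintro ⟨_, ⟨i, rfl⟩, rfl⟩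
    exact ⟨i, rfl⟩
  · rintro ⟨i, rfl⟩
    exact ⟨_, ⟨i, rfl⟩, rfl⟩

theorem card_segmentsAt {k : ℕ} {v : V} {ι : Type*} [Fintype ι] (x : ι → X.LinkVertex v)
    (hx : Function.Injective x) (h : ∀ y, (X.link v).valence y = k ↔ y ∈ Set.range x) :
    (X.segmentsAt k v).card = Fintype.card ι := by
  rw [segmentsAt_eq_map x hx h, Finset.card_map, Finset.card_univ]

theorem segmentsAt_eq_empty {k : ℕ} {v : V} (h : ∀ y : X.LinkVertex v, (X.link v).valence y ≠ k) :
    X.segmentsAt k v = ∅ := by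
  ext s
  simp only [mem_segmentsAt_iff_exists, Finset.notMem_empty, iff_false]
  rintro ⟨x, hx, -⟩
  exact h x hx

theorem bdryVertexColors_eq (c : Finset V → ℕ) (v : X.BdryVertex) :
    bdryVertexColors c v = (X.segmentsAt 1 v.1).val.map c := rfl

theorem injective_pair {W : Type*} {x y : W} (h : x ≠ y) : Function.Injective ![x, y] := by
  intro i j hij
  fin_cases i <;> fin_cases j <;> simp_all [eq_comm]

/-! ### Circles -/

theorem circle_valence {v : V} (h : (X.link v).IsCircle) :
    X.segmentsAt 1 v = ∅ ∧ X.segmentsAt 3 v = ∅ :=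
  ⟨segmentsAt_eq_empty fun y => by rw [h.2 y]; decide,
    segmentsAt_eq_empty fun y => by rw [h.2 y]; decide⟩

/-! ### Theta graphs -/

theorem theta_frame {v : V} (h : (X.link v).IsTheta) : ∃ x y : X.LinkVertex v, x ≠ y ∧
    (∀ w, (X.link v).valence w = 3 ↔ w ∈ Set.range ![x, y]) ∧
    (∀ w, (X.link v).valence w = 2 ∨ (X.link v).valence w = 3) ∧
    ∀ z, (X.link v).Adj x z → (X.link v).ArcVia x z y := by
  obtain ⟨-, x, y, hxy, hx, hy, h2, ha⟩ := h
  refine ⟨x, y, hxy, fun w => ?_, fun w => ?_, ha⟩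
  · constructor
    · intro hw
      by_contra hn
      simp only [Matrix.range_cons, Matrix.range_empty, Set.union_empty, Set.mem_union,
        Set.mem_singleton_iff, not_or] at hn
      have := h2 w hn.1 hn.2
      omega
    · rintro ⟨i, rfl⟩
      fin_cases i
      exacts [hx, hy]
  · by_cases h1 : w = x
    · exact Or.inr (h1 ▸ hx)
    · by_cases h3 : w = y
      · exact Or.inr (h3 ▸ hy)
      · exact Or.inl (h2 w h1 h3)

theorem theta_valence {v : V} (h : (X.link v).IsTheta) :
    X.segmentsAt 1 v = ∅ ∧ (X.segmentsAt 3 v).card = 2 := by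
  obtain ⟨x, y, hxy, h3, h23, -⟩ := theta_frame h
  refine ⟨segmentsAt_eq_empty fun w => ?_, ?_⟩
  · rcases h23 w with h | h <;> rw [h] <;> decide
  · rw [card_segmentsAt _ (injective_pair hxy) h3, Fintype.card_fin]

theorem exists_neighbors_of_valence_three {W : Type*} {G : SimpleGraph W} {x : W}
    (h : G.valence x = 3) :
    ∃ z : Fin 3 → W, Function.Injective z ∧ ∀ i, G.Adj x (z i) := by
  obtain ⟨a, b, c, hab, hac, hbc, he⟩ := Set.ncard_eq_three.1 h
  have : ∀ w ∈ ({a, b, c} : Set W), G.Adj x w := fun w hw => by rw [← he] at hw; exact hw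
  refine ⟨![a, b, c], ?_, fun i => this _ (by fin_cases i <;> simp)⟩
  intro i j hij
  fin_cases i <;> fin_cases j <;> simp_all [eq_comm]

/-- The three arcs of the theta graph match the germs of regions at its two trivalent vertices. The
matching is injective because a reversed arc is determined by its first edge. -/
theorem theta_segmentColors (σ : X.Region → ℕ) {v : V} (h : (X.link v).IsTheta) {s t : Finset V}
    (hs : s ∈ X.segmentsAt 3 v) (ht : t ∈ X.segmentsAt 3 v) :
    segmentColors σ s = segmentColors σ t := by
  obtain ⟨x, y, hxy, h3, -, ha⟩ := theta_frame h
  have hx : (X.link v).valence x = 3 := (h3 x).2 ⟨0, rfl⟩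
  have hy : (X.link v).valence y = 3 := (h3 y).2 ⟨1, rfl⟩
  have key : segmentColors σ (seg v x) = segmentColors σ (seg v y) := by
    obtain ⟨z, hz, hadj⟩ := exists_neighbors_of_valence_three hx
    choose u hu using fun i => (ha (z i) (hadj i)).exists_arc
    have hui : Function.Injective u := by
      intro i j hij
      have h1 := (hu i).reverse
      rw [hij] at h1
      exact hz (h1.unique (hu j).reverse (by omega) (by omega)).1
    rw [segmentColors_seg σ z hz hadj hx,
      segmentColors_seg σ u hui (fun i => (hu i).adj_right.symm) hy]
    congr 1
    ext i
    rw [triColor_eq_of_arc σ (hu i), triColor_comm]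
  rw [segmentsAt_eq_map _ (injective_pair hxy) h3] at hs ht
  simp only [Finset.mem_map, Finset.mem_univ, true_and, Function.Embedding.coeFn_mk,
    Fin.exists_fin_two, Matrix.cons_val_zero, Matrix.cons_val_one] at hs ht
  rcases hs with rfl | rfl <;> rcases ht with rfl | rfl <;> simp [key]

/-! ### Intervals -/

theorem interval_frame {v : V} (h : (X.link v).IsInterval) : ∃ x y : X.LinkVertex v, x ≠ y ∧
    (∀ w, (X.link v).valence w = 1 ↔ w ∈ Set.range ![x, y]) ∧
    (∀ w, (X.link v).valence w = 2 ∨ (X.link v).valence w = 1) ∧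
    ∃ z u, (X.link v).Arc x z u y := by
  obtain ⟨hc, x, y, hxy, hx, hy, h2⟩ := h
  refine ⟨x, y, hxy, fun w => ?_, fun w => ?_, ?_⟩
  · constructor
    · intro hw
      by_contra hn
      simp only [Matrix.range_cons, Matrix.range_empty, Set.union_empty, Set.mem_union,
        Set.mem_singleton_iff, not_or] at hn
      have := h2 w hn.1 hn.2
      omega
    · rintro ⟨i, rfl⟩
      fin_cases i
      exacts [hx, hy]
  · by_cases h1 : w = x
    · exact Or.inr (h1 ▸ hx)
    · by_cases h3 : w = y
      · exact Or.inr (h3 ▸ hy)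
      · exact Or.inl (h2 w h1 h3)
  · obtain ⟨p, hp⟩ := hc.exists_isPath x y
    obtain ⟨u, hu⟩ := SimpleGraph.exists_arc_of_isPath p hp hxy fun w _ h1 h3 => h2 w h1 h3
    exact ⟨_, u, hu⟩

theorem interval_valence {v : V} (h : (X.link v).IsInterval) :
    (X.segmentsAt 1 v).card = 2 ∧ X.segmentsAt 3 v = ∅ := by
  obtain ⟨x, y, hxy, h3, h23, -⟩ := interval_frame h
  refine ⟨?_, segmentsAt_eq_empty fun w => ?_⟩
  · rw [card_segmentsAt _ (injective_pair hxy) h3, Fintype.card_fin]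
  · rcases h23 w with h | h <;> rw [h] <;> decide

theorem segmentColors_of_valence_one (σ : X.Region → ℕ) {v : V} {x z : X.LinkVertex v}
    (hx : (X.link v).valence x = 1) (hz : (X.link v).Adj x z) :
    segmentColors σ (seg v x) = {triColor σ v x z} := by
  rw [segmentColors_seg (ι := Unit) σ (fun _ => z) (fun _ _ _ => rfl) (fun _ => hz) (by simpa)]
  simp

theorem interval_segmentColors (σ : X.Region → ℕ) {v : V} (h : (X.link v).IsInterval)
    {s t : Finset V} (hs : s ∈ X.segmentsAt 1 v) (ht : t ∈ X.segmentsAt 1 v) :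
    segmentColors σ s = segmentColors σ t := by
  obtain ⟨x, y, hxy, h3, -, z, u, ha⟩ := interval_frame h
  have key : segmentColors σ (seg v x) = segmentColors σ (seg v y) := by
    rw [segmentColors_of_valence_one σ ((h3 x).2 ⟨0, rfl⟩) ha.adj_left,
      segmentColors_of_valence_one σ ((h3 y).2 ⟨1, rfl⟩) ha.adj_right.symm,
      triColor_eq_of_arc σ ha, triColor_comm]
  rw [segmentsAt_eq_map _ (injective_pair hxy) h3] at hs ht
  simp only [Finset.mem_map, Finset.mem_univ, true_and, Function.Embedding.coeFn_mk,
    Fin.exists_fin_two, Matrix.cons_val_zero, Matrix.cons_val_one] at hs ht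
  rcases hs with rfl | rfl <;> rcases ht with rfl | rfl <;> simp [key]

/-! ### Tripods -/

theorem tripod_frame {v : V} (h : (X.link v).IsTripod) :
    ∃ (x : X.LinkVertex v) (y : Fin 3 → X.LinkVertex v), Function.Injective y ∧
    (∀ w, (X.link v).valence w = 3 ↔ w = x) ∧
    (∀ w, (X.link v).valence w = 1 ↔ w ∈ Set.range y) ∧
    (∀ w, (X.link v).valence w = 1 ∨ (X.link v).valence w = 2 ∨ (X.link v).valence w = 3) ∧
    ∀ i, ∃ z, (X.link v).ArcVia x z (y i) := by
  obtain ⟨-, x, y, hy, hx, hy1, h2, ha⟩ := h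
  have h1 : ∀ w, w = x ∨ w ∈ Set.range y ∨ (X.link v).valence w = 2 := by
    intro w
    by_contra! hn
    exact hn.2.2 (h2 w hn.1 hn.2.1)
  refine ⟨x, y, hy, fun w => ⟨fun hw => ?_, fun e => e ▸ hx⟩, fun w => ⟨fun hw => ?_, ?_⟩,
    fun w => ?_, ha⟩
  · rcases h1 w with e | ⟨i, rfl⟩ | e
    · exact e
    · have := hy1 i
      omega
    · omega
  · rcases h1 w with rfl | e | e
    · omega
    · exact e
    · omega
  · rintro ⟨i, rfl⟩
    exact hy1 i
  · rcases h1 w with rfl | ⟨i, rfl⟩ | e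
    · exact Or.inr (Or.inr hx)
    · exact Or.inl (hy1 i)
    · exact Or.inr (Or.inl e)

theorem tripod_valence {v : V} (h : (X.link v).IsTripod) :
    (X.segmentsAt 1 v).card = 3 ∧ (X.segmentsAt 3 v).card = 1 := by
  obtain ⟨x, y, hy, h3, h1, -, -⟩ := tripod_frame h
  refine ⟨?_, ?_⟩
  · rw [card_segmentsAt _ hy h1, Fintype.card_fin]
  · rw [card_segmentsAt (ι := Unit) (fun _ => x) (fun _ _ _ => rfl) (by simpa using h3),
      Fintype.card_unit]

/-- Each of the three sectors at `v` joins the interior edge that ends at `v` to one edge of `∂X`,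
so both carry the same triple. -/
theorem tripod_segmentColors (σ : X.Region → ℕ) (v : X.BdryVertex) {s : Finset V}
    (hs : s ∈ X.segmentsAt 3 v.1) : bdryVertexColors (bdryColor σ) v = segmentColors σ s := by
  obtain ⟨x, y, hy, h3, h1, -, ha⟩ := tripod_frame v.2.2
  obtain ⟨x', hx', rfl⟩ := mem_segmentsAt_iff_exists.1 hs
  obtain rfl := (h3 x').1 hx'
  choose z hz using ha
  choose u hu using fun i => (hz i).exists_arc
  have hy1 : ∀ i, (X.link v.1).valence (y i) = 1 := fun i => (h1 _).2 ⟨i, rfl⟩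
  have hzi : Function.Injective z := by
    intro i j hij
    have h1 := hu i
    rw [hij] at h1
    exact hy (h1.unique (hu j) (by rw [hy1]; decide) (by rw [hy1]; decide)).2
  rw [bdryVertexColors_eq, segmentsAt_eq_map y hy h1,
    segmentColors_seg σ z hzi (fun i => (hu i).adj_left) hx', Finset.map_val, Multiset.map_map]
  congr 1
  ext i
  rw [triColor_eq_of_arc σ (hu i), triColor_comm]
  simp only [Function.comp_apply, Function.Embedding.coeFn_mk, bdryColor]
  rw [segmentColors_of_valence_one σ (hy1 i) (hu i).adj_right.symm, Multiset.sum_singleton]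

/-! ### Tetrahedra -/

theorem tetra_valence_iff {v : V} {x : Fin 4 → X.LinkVertex v} (h : (X.link v).IsTetraFrame x)
    (w : X.LinkVertex v) : (X.link v).valence w = 3 ↔ w ∈ Set.range x := by
  constructor
  · intro hw
    by_contra hn
    have := h.2.2.1 w hn
    omega
  · rintro ⟨i, rfl⟩
    exact h.2.1 i

theorem tetra_valence {v : V} (h : (X.link v).IsTetra) :
    X.segmentsAt 1 v = ∅ ∧ (X.segmentsAt 3 v).card = 4 := by
  obtain ⟨-, x, hx⟩ := h
  refine ⟨segmentsAt_eq_empty fun w => ?_, ?_⟩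
  · by_cases hw : w ∈ Set.range x
    · rw [(tetra_valence_iff hx w).2 hw]; decide
    · rw [hx.2.2.1 w hw]; decide
  · rw [card_segmentsAt _ hx.1 (tetra_valence_iff hx), Fintype.card_fin]

/-- The color is read from a chosen arc, and the choice is immaterial: the arcs to the other three
branch points use up the three edges at a branch point, so there is only one arc for each pair. -/
theorem tetra_sectorColor (σ : X.Region → ℕ) {v : V} {x : Fin 4 → X.LinkVertex v}
    (h : (X.link v).IsTetraFrame x) :
    (∀ i j, i ≠ j → sectorColor σ v (x i) (x j) = sectorColor σ v (x j) (x i)) ∧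
    ∀ i, segmentColors σ (seg v (x i)) =
      Finset.univ.val.map fun k : Fin 3 => sectorColor σ v (x i) (x (i.succAbove k)) := by
  obtain ⟨hxi, hx3, -, ha⟩ := h
  have hne : ∀ (i : Fin 4) (k : Fin 3), i ≠ i.succAbove k := fun i k => (Fin.succAbove_ne i k).symm
  have hz : ∀ i j, i ≠ j → ∃ z u, (X.link v).Arc (x i) z u (x j) ∧
      sectorColor σ v (x i) (x j) = triColor σ v (x i) z := by
    intro i j hij
    obtain ⟨u, hu⟩ := (ha i j hij).choose_spec.exists_arc
    exact ⟨_, u, hu, by unfold sectorColor; rw [dif_pos (ha i j hij)]; rfl⟩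
  have h2 : ∀ i, (X.link v).valence (x i) ≠ 2 := fun i => by rw [hx3]; decide
  choose z u hu hcol using fun i k => hz i (i.succAbove k) (hne i k)
  have hzi : ∀ i, Function.Injective (z i) := by
    intro i k l hkl
    have h1 := hu i k
    rw [hkl] at h1
    exact Fin.succAbove_right_injective (hxi (h1.unique (hu i l) (h2 _) (h2 _)).2)
  constructor
  · intro i j hij
    obtain ⟨k, rfl⟩ := Fin.exists_succAbove_eq hij.symm
    obtain ⟨l, hl⟩ := Fin.exists_succAbove_eq hij
    rw [hcol, triColor_eq_of_arc σ (hu i k), triColor_comm]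
    -- The reverse of the chosen arc starts at one of the three neighbors already used, hence it
    -- follows the arc chosen in the other direction.
    obtain ⟨m, hm⟩ := SimpleGraph.exists_eq_of_valence (z (i.succAbove k)) (by simp [hx3])
      (hzi _) (fun m => (hu _ m).adj_left) (Set.toFinite _) (hu i k).adj_right.symm
    have h1 := hu (i.succAbove k) m
    rw [hm] at h1
    have h3 := hxi (h1.unique (hu i k).reverse (h2 _) (h2 _)).2
    rw [← hm, ← hcol, h3]
  · intro i
    rw [segmentColors_seg σ (z i) (hzi i) (fun k => (hu i k).adj_left) (by simp [hx3])]
    simp only [hcol]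

end SimplePolyhedron

namespace SimplePolyhedron

open Simplices Quantum

variable {V : Type*} [DecidableEq V] {X : SimplePolyhedron V}

/-! ## The strata -/

theorem link_cases {v : V} (hv : {v} ∈ X.faces) :
    (X.link v).IsCircle ∨ (X.link v).IsTheta ∨ (X.link v).IsTetra ∨ (X.link v).IsInterval ∨
      (X.link v).IsTripod := X.link_type v hv

/-- The five links are told apart by the numbers of boundary segments and of interior edge segments
at `v`: `(0,0)`, `(0,2)`, `(0,4)`, `(2,0)` and `(3,1)`. -/
theorem not_two_types {p q : ℕ × ℕ} {v : V}
    (hp : ((X.segmentsAt 1 v).card, (X.segmentsAt 3 v).card) = p)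
    (hq : ((X.segmentsAt 1 v).card, (X.segmentsAt 3 v).card) = q) (h : p ≠ q) : False :=
  h (hp.symm.trans hq)

theorem circle_type {v : V} (h : (X.link v).IsCircle) :
    ((X.segmentsAt 1 v).card, (X.segmentsAt 3 v).card) = (0, 0) := by
  simp [circle_valence h]

theorem theta_type {v : V} (h : (X.link v).IsTheta) :
    ((X.segmentsAt 1 v).card, (X.segmentsAt 3 v).card) = (0, 2) := by
  simp [theta_valence h]

theorem tetra_type {v : V} (h : (X.link v).IsTetra) :
    ((X.segmentsAt 1 v).card, (X.segmentsAt 3 v).card) = (0, 4) := by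
  simp [tetra_valence h]

theorem interval_type {v : V} (h : (X.link v).IsInterval) :
    ((X.segmentsAt 1 v).card, (X.segmentsAt 3 v).card) = (2, 0) := by
  simp [interval_valence h]

theorem tripod_type {v : V} (h : (X.link v).IsTripod) :
    ((X.segmentsAt 1 v).card, (X.segmentsAt 3 v).card) = (3, 1) := by
  simp [tripod_valence h]

theorem valence_cases {v : V} (x : X.LinkVertex v) :
    (X.link v).valence x = 1 ∨ (X.link v).valence x = 2 ∨ (X.link v).valence x = 3 := by
  have hv : {v} ∈ X.faces :=
    mem_faces_of_subset (seg_mem_faces x) (singleton_ssubset_seg x).subset (by simp)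
  rcases link_cases hv with h | h | h | h | h
  · exact Or.inr (Or.inl (h.2 x))
  · obtain ⟨_, _, _, _, h, _⟩ := theta_frame h
    exact Or.inr (h x)
  · obtain ⟨-, y, hy⟩ := h
    by_cases hx : x ∈ Set.range y
    · exact Or.inr (Or.inr ((tetra_valence_iff hy x).2 hx))
    · exact Or.inr (Or.inl (hy.2.2.1 x hx))
  · obtain ⟨_, _, _, _, h, _⟩ := interval_frame h
    exact (h x).elim (fun h => Or.inr (Or.inl h)) Or.inl
  · obtain ⟨_, _, _, _, _, h, _⟩ := tripod_frame h
    exact h x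

theorem segments_cases {s : Finset V} (hs : s ∈ X.faces) (hc : s.card = 2) :
    s ∈ X.segments 1 ∨ s ∈ X.segments 2 ∨ s ∈ X.segments 3 := by
  obtain ⟨v, hv⟩ := nonempty_of_mem_faces hs
  obtain ⟨x, rfl⟩ := exists_eq_seg hs hc hv
  simpa only [seg_mem_segments] using valence_cases x

theorem notMem_segments_of_mem {s : Finset V} {k l : ℕ} (hs : s ∈ X.segments k) (h : k ≠ l) :
    s ∉ X.segments l := fun hl => h (hs.2.2.symm.trans hl.2.2)

theorem singleton_notMem_segments (v : V) (k : ℕ) : {v} ∉ X.segments k := fun h => by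
  have := h.2.1
  simp at this

/-- The part of a stratum of dimension one in the triangulation: segments contained in `k`
triangles, and vertices with the property `p`. -/
def edgeStratum (X : SimplePolyhedron V) (k : ℕ) (p : V → Prop) : Set (Finset V) :=
  X.segments k ∪ {s | s ∈ X.faces ∧ ∃ v, s = {v} ∧ p v}

theorem singleton_mem_edgeStratum {k : ℕ} {p : V → Prop} {v : V} :
    {v} ∈ X.edgeStratum k p ↔ {v} ∈ X.faces ∧ p v := by
  unfold edgeStratum
  simp only [Set.mem_union, singleton_notMem_segments, false_or, Set.mem_ofPred_eq,
    Finset.singleton_inj]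
  exact ⟨fun ⟨h, w, e, hp⟩ => ⟨h, e ▸ hp⟩, fun ⟨h, hp⟩ => ⟨h, v, rfl, hp⟩⟩

theorem mem_edgeStratum_of_card {k : ℕ} {p : V → Prop} {s : Finset V} (hc : s.card ≠ 1) :
    s ∈ X.edgeStratum k p ↔ s ∈ X.segments k := by
  refine ⟨fun h => h.resolve_right ?_, Or.inl⟩
  rintro ⟨-, v, rfl, -⟩
  simp at hc

theorem singleton_mem_regionSimplices {v : V} :
    {v} ∈ X.regionSimplices ↔ {v} ∈ X.faces ∧ (X.link v).IsCircle := by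
  unfold regionSimplices
  simp only [Set.mem_union, singleton_notMem_segments, Set.mem_ofPred_eq, Finset.card_singleton,
    Finset.singleton_inj, OfNat.one_ne_ofNat, and_false, or_false, false_or]
  exact ⟨fun ⟨h, w, e, hp⟩ => ⟨h, e ▸ hp⟩, fun ⟨h, hp⟩ => ⟨h, v, rfl, hp⟩⟩

theorem segment_mem_regionSimplices {s : Finset V} (hc : s.card = 2) :
    s ∈ X.regionSimplices ↔ s ∈ X.segments 2 := by
  refine ⟨?_, fun h => Or.inl (Or.inr h)⟩
  rintro ((⟨-, h⟩ | h) | ⟨-, v, rfl, -⟩)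
  · omega
  · exact h
  · simp at hc

theorem card_cases {s : Finset V} (hs : s ∈ X.faces) :
    (∃ v, s = {v}) ∨ s.card = 2 ∨ s.card = 3 := by
  have h1 := X.card_le s hs
  have h2 := Finset.card_pos.2 (nonempty_of_mem_faces hs)
  rcases (by omega : s.card = 1 ∨ s.card = 2 ∨ s.card = 3) with h | h
  · exact Or.inl (Finset.card_eq_one.1 h)
  · exact Or.inr h

theorem mem_faces_of_mem_regionSimplices {s : Finset V} (hs : s ∈ X.regionSimplices) :
    s ∈ X.faces := by
  rcases hs with (h | h) | h <;> exact h.1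

theorem mem_faces_of_mem_edgeStratum {k : ℕ} {p : V → Prop} {s : Finset V}
    (hs : s ∈ X.edgeStratum k p) : s ∈ X.faces := by
  rcases hs with h | h <;> exact h.1

theorem finite_edgeStratum (k : ℕ) (p : V → Prop) : (X.edgeStratum k p).Finite :=
  X.finite_faces.subset fun _ hs => mem_faces_of_mem_edgeStratum hs

theorem finite_regions : X.regionSimplices.Finite :=
  X.finite_faces.subset fun _ hs => mem_faces_of_mem_regionSimplices hs

/-- Each open simplex belongs to exactly one stratum. -/
theorem sum_faces_eq (g : Finset V → ℤ) :
    ∑ s ∈ X.finite_faces.toFinset, g s =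
      ∑ s ∈ (finite_regions (X := X)).toFinset, g s +
      ∑ s ∈ (finite_edgeStratum (X := X) 3 fun v => (X.link v).IsTheta).toFinset, g s +
      ∑ s ∈ (finite_edgeStratum (X := X) 1 fun v => (X.link v).IsInterval).toFinset, g s +
      ∑ v : X.IntVertex, g {v.1} + ∑ v : X.BdryVertex, g {v.1} := by
  classical
  have hvert : ∀ (p : V → Prop) [Fintype {v : V // {v} ∈ X.faces ∧ p v}],
      ∑ v : {v : V // {v} ∈ X.faces ∧ p v}, g {v.1} =
        ∑ s ∈ X.finite_faces.toFinset, if ∃ v, s = {v} ∧ p v then g s else 0 := by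
    intro p _
    rw [← Finset.sum_filter]
    refine Finset.sum_bij (fun v _ => {v.1}) ?_ ?_ ?_ ?_
    · intro v _
      simp only [Finset.mem_filter, Set.Finite.mem_toFinset]
      exact ⟨v.2.1, v.1, rfl, v.2.2⟩
    · intro v _ w _ h
      exact Subtype.ext (Finset.singleton_injective h)
    · intro s hs
      simp only [Finset.mem_filter, Set.Finite.mem_toFinset] at hs
      obtain ⟨h1, v, rfl, h2⟩ := hs
      exact ⟨⟨v, h1, h2⟩, Finset.mem_univ _, rfl⟩
    · intro v _
      rfl
  have hset : ∀ (P : Set (Finset V)) (hP : P.Finite) (_ : P ⊆ X.faces),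
      ∑ s ∈ hP.toFinset, g s = ∑ s ∈ X.finite_faces.toFinset, if s ∈ P then g s else 0 := by
    intro P hP hsub
    rw [← Finset.sum_filter]
    refine Finset.sum_congr ?_ fun _ _ => rfl
    ext s
    simp only [Set.Finite.mem_toFinset, Finset.mem_filter]
    exact ⟨fun h => ⟨hsub h, h⟩, fun h => h.2⟩
  rw [hset _ _ fun s hs => mem_faces_of_mem_regionSimplices hs,
    hset _ _ fun s hs => mem_faces_of_mem_edgeStratum hs,
    hset _ _ fun s hs => mem_faces_of_mem_edgeStratum hs, hvert, hvert,
    ← Finset.sum_add_distrib, ← Finset.sum_add_distrib, ← Finset.sum_add_distrib,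
    ← Finset.sum_add_distrib]
  refine Finset.sum_congr rfl fun s hs => ?_
  rw [Set.Finite.mem_toFinset] at hs
  have hns : ∀ p : V → Prop, s.card ≠ 1 → ¬ ∃ v, s = {v} ∧ p v := by
    rintro p hc ⟨v, rfl, -⟩
    simp at hc
  rcases card_cases hs with ⟨v, rfl⟩ | hc | hc
  · have hv : ∀ p : V → Prop, (∃ w, ({v} : Finset V) = {w} ∧ p w) ↔ p v := fun p =>
      ⟨fun ⟨w, e, h⟩ => Finset.singleton_injective e ▸ h, fun h => ⟨v, rfl, h⟩⟩
    simp only [singleton_mem_regionSimplices, singleton_mem_edgeStratum, hv, hs, true_and]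
    rcases link_cases hs with h | h | h | h | h
    · rw [if_pos h, if_neg fun h' => not_two_types (circle_type h) (theta_type h') (by decide),
        if_neg fun h' => not_two_types (circle_type h) (interval_type h') (by decide),
        if_neg fun h' => not_two_types (circle_type h) (tetra_type h') (by decide),
        if_neg fun h' => not_two_types (circle_type h) (tripod_type h') (by decide)]
      ring
    · rw [if_pos h, if_neg fun h' => not_two_types (theta_type h) (circle_type h') (by decide),
        if_neg fun h' => not_two_types (theta_type h) (interval_type h') (by decide),
        if_neg fun h' => not_two_types (theta_type h) (tetra_type h') (by decide),
        if_neg fun h' => not_two_types (theta_type h) (tripod_type h') (by decide)]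
      ring
    · rw [if_pos h, if_neg fun h' => not_two_types (tetra_type h) (circle_type h') (by decide),
        if_neg fun h' => not_two_types (tetra_type h) (interval_type h') (by decide),
        if_neg fun h' => not_two_types (tetra_type h) (theta_type h') (by decide),
        if_neg fun h' => not_two_types (tetra_type h) (tripod_type h') (by decide)]
      ring
    · rw [if_pos h, if_neg fun h' => not_two_types (interval_type h) (circle_type h') (by decide),
        if_neg fun h' => not_two_types (interval_type h) (tetra_type h') (by decide),
        if_neg fun h' => not_two_types (interval_type h) (theta_type h') (by decide),
        if_neg fun h' => not_two_types (interval_type h) (tripod_type h') (by decide)]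
      ring
    · rw [if_pos h, if_neg fun h' => not_two_types (tripod_type h) (circle_type h') (by decide),
        if_neg fun h' => not_two_types (tripod_type h) (tetra_type h') (by decide),
        if_neg fun h' => not_two_types (tripod_type h) (theta_type h') (by decide),
        if_neg fun h' => not_two_types (tripod_type h) (interval_type h') (by decide)]
      ring
  · rw [if_neg (hns (fun v => (X.link v).IsTetra) (by omega)),
      if_neg (hns (fun v => (X.link v).IsTripod) (by omega))]
    simp only [segment_mem_regionSimplices hc, mem_edgeStratum_of_card (show s.card ≠ 1 by omega)]
    rcases segments_cases hs hc with h | h | h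
    · simp [h, notMem_segments_of_mem h (show 1 ≠ 2 by decide),
        notMem_segments_of_mem h (show 1 ≠ 3 by decide)]
    · simp [h, notMem_segments_of_mem h (show 2 ≠ 1 by decide),
        notMem_segments_of_mem h (show 2 ≠ 3 by decide)]
    · simp [h, notMem_segments_of_mem h (show 3 ≠ 1 by decide),
        notMem_segments_of_mem h (show 3 ≠ 2 by decide)]
  · rw [if_neg (hns (fun v => (X.link v).IsTetra) (by omega)),
      if_neg (hns (fun v => (X.link v).IsTripod) (by omega)),
      if_pos (triangle_mem_regionSimplices hs hc)]
    have : ∀ k, s ∉ X.segments k := fun k h => by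
      have := h.2.1
      omega
    simp [mem_edgeStratum_of_card (show s.card ≠ 1 by omega), this]

/-! ## Euler characteristics of the strata -/

theorem component_simplices_subset {P : Set (Finset V)} (C : Component P) : C.simplices ⊆ P :=
  fun _ hs => hs.1

theorem mem_component_of_subset {P : Set (Finset V)} {C : Component P} {s t : Finset V}
    (hs : s ∈ C.simplices) (ht : t ∈ P) (h : s ⊆ t) : t ∈ C.simplices := by
  obtain ⟨h1, rfl⟩ := hs
  exact ⟨ht, (component_eq_of_subset h1 ht h).symm⟩

theorem component_nonempty {P : Set (Finset V)} (C : Component P) : ∃ s, s ∈ C.simplices := by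
  obtain ⟨s, rfl⟩ := Quot.exists_rep C
  exact ⟨s.1, s.2, rfl⟩

open Classical in
/-- A sum over the components of `P`, written as a sum over the simplices in `P`. -/
theorem sum_component {P : Set (Finset V)} [Fintype (Component P)] (hP : P.Finite)
    (h : Component P → ℤ) (g ε : Finset V → ℤ) (hg : ∀ C, ∀ s ∈ C.simplices, g s = h C)
    (hχ : ∀ C : Component P, eulerChar C.simplices =
      ∑ s ∈ hP.toFinset.filter (· ∈ C.simplices), ε s) :
    ∑ C, eulerChar C.simplices * h C = ∑ s ∈ hP.toFinset, ε s * g s := by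
  simp only [hχ, Finset.sum_mul, Finset.sum_filter, ite_mul, zero_mul]
  rw [Finset.sum_comm]
  refine Finset.sum_congr rfl fun s hs => ?_
  rw [Set.Finite.mem_toFinset] at hs
  have hm : s ∈ Component.simplices ((incidence P).connectedComponentMk ⟨s, hs⟩) := ⟨hs, rfl⟩
  rw [Finset.sum_eq_single ((incidence P).connectedComponentMk ⟨s, hs⟩), if_pos hm, hg _ s hm]
  · rintro C - hC
    rw [if_neg]
    rintro ⟨_, rfl⟩
    exact hC rfl
  · simp

theorem eulerChar_segmentsAt (k : ℕ) (v : V) :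
    eulerChar (X.segmentsAt k v : Set (Finset V)) = (X.segmentsAt k v).card := by
  refine eulerChar_of_antichain _ fun s hs t ht hst => ?_
  have h1 := (mem_segmentsAt.1 hs).1.2.1
  have h2 := (mem_segmentsAt.1 ht).1.2.1
  have := Finset.card_lt_card hst
  omega

-- A segment contributes 1 and a vertex, with two segments above it, contributes `1 - 2`. The sign
-- is opposite to that of the dimension, as the Euler characteristic with compact support of an edge
-- is `-χ`.
open Classical in
theorem eulerChar_edge {k : ℕ} {p : V → Prop} (hp : ∀ v, p v → (X.segmentsAt k v).card = 2)
    (C : Component (X.edgeStratum k p)) : eulerChar C.simplices =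
      ∑ s ∈ (finite_edgeStratum (X := X) k p).toFinset.filter (· ∈ C.simplices), (-1) ^ s.card := by
  set A := (finite_edgeStratum (X := X) k p).toFinset.filter (· ∈ C.simplices) with hA
  have hmem : ∀ s, s ∈ A ↔ s ∈ C.simplices := by
    intro s
    simp only [hA, Finset.mem_filter, Set.Finite.mem_toFinset, and_iff_right_iff_imp]
    exact fun h => component_simplices_subset C h
  rw [show C.simplices = (A : Set (Finset V)) by ext s; simp [hmem], eulerChar_eq_sum_above]
  refine Finset.sum_congr rfl fun s hs => ?_
  rw [hmem] at hs
  rcases component_simplices_subset C hs with h | ⟨h, v, rfl, hv⟩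
  · rw [show {t | t ∈ A ∧ s ⊂ t} = ∅ from ?_, eulerChar_empty, h.2.1]
    · rfl
    · ext t
      simp only [Set.mem_ofPred_eq, Set.mem_empty_iff_false, iff_false, hmem]
      rintro ⟨ht, hst⟩
      have h1 := Finset.card_lt_card hst
      rw [h.2.1] at h1
      rcases component_simplices_subset C ht with h2 | ⟨-, w, rfl, -⟩
      · have := h2.2.1
        omega
      · simp at h1
  · rw [show {t | t ∈ A ∧ {v} ⊂ t} = (X.segmentsAt k v : Set (Finset V)) from ?_,
      eulerChar_segmentsAt, hp v hv]
    · rfl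
    · ext t
      simp only [Set.mem_ofPred_eq, hmem, Finset.mem_coe]
      constructor
      · rintro ⟨ht, hst⟩
        rcases component_simplices_subset C ht with h2 | ⟨-, w, rfl, -⟩
        · exact mem_segmentsAt.2 ⟨h2, hst.subset (by simp)⟩
        · have := Finset.card_lt_card hst
          simp at this
      · intro ht
        obtain ⟨h1, h2⟩ := mem_segmentsAt.1 ht
        refine ⟨mem_component_of_subset hs (Or.inl h1) (by simpa using h2),
          Finset.ssubset_iff_subset_ne.2 ⟨by simpa using h2, ?_⟩⟩
        rintro rfl
        exact singleton_notMem_segments v k h1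

theorem mem_regionSimplices_of_subset {s t : Finset V} (hs : s ∈ X.regionSimplices)
    (ht : t ∈ X.faces) (h : s ⊆ t) : t ∈ X.regionSimplices := by
  have hcard := Finset.card_le_card h
  rcases card_cases ht with ⟨v, rfl⟩ | hc | hc
  · rcases Finset.subset_singleton_iff.1 h with rfl | rfl
    · exact absurd (nonempty_of_mem_faces (mem_faces_of_mem_regionSimplices hs)) (by simp)
    · exact hs
  · rcases card_cases (mem_faces_of_mem_regionSimplices hs) with ⟨v, rfl⟩ | hc' | hc'
    · obtain ⟨x, rfl⟩ := exists_eq_seg ht hc (by simpa using h)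
      have := (singleton_mem_regionSimplices.1 hs).2.2 x
      exact Or.inl (Or.inr ((seg_mem_segments x 2).2 this))
    · rw [← Finset.eq_of_subset_of_card_le h (by omega)]
      exact hs
    · omega
  · exact triangle_mem_regionSimplices ht hc

-- Around `v` there are as many segments as triangles; a segment has two triangles above it and
-- contributes `1 - 2`, a triangle contributes 1.
open Classical in
theorem eulerChar_above_circle {v : V} (h : (X.link v).IsCircle) :
    eulerChar {t | t ∈ X.faces ∧ {v} ⊂ t} = 0 := by
  set A := X.finite_faces.toFinset.filter fun t => {v} ⊂ t with hA
  have hmem : ∀ t, t ∈ A ↔ t ∈ X.faces ∧ {v} ⊂ t := fun t => by simp [hA]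
  set A₂ := A.filter fun t => t.card = 2 with hA₂
  set A₃ := A.filter fun t => ¬ t.card = 2 with hA₃
  have hmem₂ : ∀ t, t ∈ A₂ → ∃ x : X.LinkVertex v, t = seg v x := by
    intro t ht
    rw [hA₂, Finset.mem_filter, hmem] at ht
    exact exists_eq_seg ht.1.1 ht.2 (ht.1.2.subset (by simp))
  have hmem₃ : ∀ t, t ∈ A₃ → t ∈ X.faces ∧ t.card = 3 ∧ v ∈ t := by
    intro t ht
    rw [hA₃, Finset.mem_filter, hmem] at ht
    refine ⟨ht.1.1, ?_, ht.1.2.subset (by simp)⟩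
    rcases card_cases ht.1.1 with ⟨w, rfl⟩ | hc | hc
    · have := Finset.card_lt_card ht.1.2
      simp at this
    · exact absurd hc ht.2
    · exact hc
  have mem₃ : ∀ t, t ∈ X.faces → t.card = 3 → v ∈ t → t ∈ A₃ := by
    intro t h1 h2 h3
    rw [hA₃, Finset.mem_filter, hmem]
    refine ⟨⟨h1, Finset.ssubset_iff_subset_ne.2 ⟨by simpa using h3, ?_⟩⟩, by omega⟩
    rintro rfl
    simp at h2
  have mem₂ : ∀ x : X.LinkVertex v, seg v x ∈ A₂ := by
    intro x
    rw [hA₂, Finset.mem_filter, hmem]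
    exact ⟨⟨seg_mem_faces x, singleton_ssubset_seg x⟩, card_seg x⟩
  rw [show {t | t ∈ X.faces ∧ {v} ⊂ t} = (A : Set (Finset V)) by ext t; simp [hmem],
    eulerChar_eq_sum_above, ← Finset.sum_filter_add_sum_filter_not A fun t => t.card = 2]
  have e2 : ∀ t ∈ A₂, 1 - eulerChar {u | u ∈ A ∧ t ⊂ u} = -1 := by
    intro t ht
    obtain ⟨x, rfl⟩ := hmem₂ t ht
    rw [show {u | u ∈ A ∧ seg v x ⊂ u} = (X.cofaces (seg v x) : Set (Finset V)) from ?_,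
      eulerChar_of_antichain, card_cofaces_seg, h.2 x]
    · rfl
    · intro s hs t ht hst
      have h1 := (mem_cofaces.1 hs).2.1
      have h2 := (mem_cofaces.1 ht).2.1
      have := Finset.card_lt_card hst
      omega
    · ext u
      simp only [Set.mem_ofPred_eq, hmem, Finset.mem_coe, mem_cofaces]
      constructor
      · rintro ⟨⟨h1, -⟩, h2⟩
        have h3 := Finset.card_lt_card h2
        rw [card_seg] at h3
        have := X.card_le u h1
        exact ⟨h1, by omega, h2.subset⟩
      · rintro ⟨h1, h2, h3⟩
        have h4 : seg v x ⊂ u := Finset.ssubset_iff_subset_ne.2 ⟨h3, fun e => by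
          have := card_seg x
          rw [e] at this
          omega⟩
        exact ⟨⟨h1, (singleton_ssubset_seg x).trans h4⟩, h4⟩
  have e3 : ∀ t ∈ A₃, 1 - eulerChar {u | u ∈ A ∧ t ⊂ u} = 1 := by
    intro t ht
    rw [show {u | u ∈ A ∧ t ⊂ u} = ∅ from ?_, eulerChar_empty, sub_zero]
    ext u
    simp only [Set.mem_ofPred_eq, hmem, Set.mem_empty_iff_false, iff_false]
    rintro ⟨⟨h1, -⟩, h2⟩
    have h3 := Finset.card_lt_card h2
    have := X.card_le u h1
    have := (hmem₃ t ht).2.1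
    omega
  rw [Finset.sum_congr rfl e2, Finset.sum_congr rfl e3, Finset.sum_const, Finset.sum_const]
  -- Double counting: each segment at `v` lies in two triangles, and each triangle at `v` has two
  -- sides through `v`.
  have hcount : A₂.card * 2 = A₃.card * 2 := by
    refine Finset.card_mul_eq_card_mul (fun s t : Finset V => s ⊆ t) ?_ ?_
    · intro s hs
      obtain ⟨x, rfl⟩ := hmem₂ s hs
      rw [← h.2 x, ← card_cofaces_seg]
      congr 1
      ext t
      simp only [Finset.bipartiteAbove, Finset.mem_filter, mem_cofaces]
      exact ⟨fun ⟨h1, h2⟩ => ⟨(hmem₃ t h1).1, (hmem₃ t h1).2.1, h2⟩,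
        fun ⟨h1, h2, h3⟩ => ⟨mem₃ t h1 h2 (h3 (by simp [seg])), h3⟩⟩
    · intro t ht
      obtain ⟨h1, h2, h3⟩ := hmem₃ t ht
      obtain ⟨x, y, hxy, rfl⟩ := exists_eq_tri h1 h2 h3
      rw [show A₂.bipartiteBelow (fun s t : Finset V => s ⊆ t) (tri v x y) =
        {seg v x, seg v y} from ?_, Finset.card_pair fun e => hxy.1 (seg_injective v e)]
      ext s
      simp only [Finset.bipartiteBelow, Finset.mem_filter, Finset.mem_insert,
        Finset.mem_singleton]
      constructor
      · rintro ⟨hs, hst⟩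
        obtain ⟨z, rfl⟩ := hmem₂ s hs
        have hz : z.1 ∈ tri v x y := hst (by simp [seg])
        simp only [tri, Finset.mem_insert, Finset.mem_singleton] at hz
        rcases hz with e | e | e
        · exact absurd e z.2.1
        · exact Or.inl (by rw [Subtype.ext e])
        · exact Or.inr (by rw [Subtype.ext e])
      · rintro (rfl | rfl)
        · exact ⟨mem₂ x, seg_subset_tri x y⟩
        · exact ⟨mem₂ y, tri_comm x y ▸ seg_subset_tri y x⟩
  simp only [nsmul_eq_mul]
  have : (A₂.card : ℤ) = A₃.card := by omega
  rw [this]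
  ring

-- A region is an open surface: above a vertex, a segment, a triangle there is a circle, two points,
-- nothing, of Euler characteristic 0, 2, 0. So `χ` is the alternating count of the open simplices.
open Classical in
theorem eulerChar_region (C : X.Region) : eulerChar C.simplices =
    ∑ s ∈ (finite_regions (X := X)).toFinset.filter (· ∈ C.simplices), (-1) ^ (s.card + 1) := by
  set A := (finite_regions (X := X)).toFinset.filter (· ∈ C.simplices) with hA
  have hmem : ∀ s, s ∈ A ↔ s ∈ C.simplices := by
    intro s
    simp only [hA, Finset.mem_filter, Set.Finite.mem_toFinset, and_iff_right_iff_imp]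
    exact fun h => component_simplices_subset C h
  rw [show C.simplices = (A : Set (Finset V)) by ext s; simp [hmem], eulerChar_eq_sum_above]
  refine Finset.sum_congr rfl fun s hs => ?_
  rw [hmem] at hs
  have hsR := component_simplices_subset C hs
  have hs' := mem_faces_of_mem_regionSimplices hsR
  have habove : {t | t ∈ A ∧ s ⊂ t} = {t | t ∈ X.faces ∧ s ⊂ t} := by
    ext t
    simp only [Set.mem_ofPred_eq, hmem]
    refine ⟨fun h => ⟨mem_faces_of_mem_regionSimplices (component_simplices_subset C h.1), h.2⟩,
      fun h => ⟨mem_component_of_subset hs ?_ h.2.subset, h.2⟩⟩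
    exact mem_regionSimplices_of_subset hsR h.1 h.2.subset
  rw [habove]
  rcases card_cases hs' with ⟨v, rfl⟩ | hc | hc
  · rw [eulerChar_above_circle (singleton_mem_regionSimplices.1 hsR).2]
    simp
  · rw [show {t | t ∈ X.faces ∧ s ⊂ t} = (X.cofaces s : Set (Finset V)) from ?_,
      eulerChar_of_antichain, ((segment_mem_regionSimplices hc).1 hsR).2.2, hc]
    · rfl
    · intro s hs t ht hst
      have h1 := (mem_cofaces.1 hs).2.1
      have h2 := (mem_cofaces.1 ht).2.1
      have := Finset.card_lt_card hst
      omega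
    · ext u
      simp only [Set.mem_ofPred_eq, Finset.mem_coe, mem_cofaces]
      constructor
      · rintro ⟨h1, h2⟩
        have h3 := Finset.card_lt_card h2
        have := X.card_le u h1
        exact ⟨h1, by omega, h2.subset⟩
      · rintro ⟨h1, h2, h3⟩
        exact ⟨h1, Finset.ssubset_iff_subset_ne.2 ⟨h3, fun e => by rw [e] at hc; omega⟩⟩
  · rw [show {t | t ∈ X.faces ∧ s ⊂ t} = ∅ from ?_, eulerChar_empty, hc]
    · rfl
    · ext u
      simp only [Set.mem_ofPred_eq, Set.mem_empty_iff_false, iff_false]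
      rintro ⟨h1, h2⟩
      have h3 := Finset.card_lt_card h2
      have := X.card_le u h1
      omega

open Classical in
theorem eulerChar_closure (S : Set X.Region) : eulerChar (closure S) =
    ∑ s ∈ X.finite_faces.toFinset, (-1) ^ (s.card + 1) * if s ∈ closure S then 1 else 0 := by
  set A := X.finite_faces.toFinset.filter (· ∈ closure S) with hA
  have hmem : ∀ s, s ∈ A ↔ s ∈ closure S := by
    intro s
    simp only [hA, Finset.mem_filter, Set.Finite.mem_toFinset, and_iff_right_iff_imp]
    exact fun h => h.1
  simp only [mul_ite, mul_one, mul_zero]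
  rw [← Finset.sum_filter, ← hA, ← eulerChar_of_isLower A]
  · congr 1
    ext s
    simp [hmem]
  · rw [hmem]
    intro h
    exact absurd (nonempty_of_mem_faces h.1) (by simp)
  · intro t ht s hs hn
    rw [hmem] at ht ⊢
    obtain ⟨h1, f, hf, u, hu, htu⟩ := ht
    exact ⟨mem_faces_of_subset h1 hs hn, f, hf, u, hu, hs.trans htu⟩

end SimplePolyhedron

namespace SimplePolyhedron

open Simplices Quantum

variable {V : Type*} [DecidableEq V] {X : SimplePolyhedron V}

/-! ## The odd surface -/

theorem closure_isLower {S : Set X.Region} {s t : Finset V} (ht : t ∈ closure S) (h : s ⊆ t)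
    (hs : s.Nonempty) : s ∈ closure S := by
  obtain ⟨h1, f, hf, u, hu, htu⟩ := ht
  exact ⟨mem_faces_of_subset h1 h hs, f, hf, u, hu, h.trans htu⟩

theorem exists_coface_of_mem_regionSimplices {s : Finset V} (hs : s ∈ X.regionSimplices) :
    ∃ t, t ∈ X.cofaces s := by
  rcases card_cases (mem_faces_of_mem_regionSimplices hs) with ⟨v, rfl⟩ | hc | hc
  · have h := (singleton_mem_regionSimplices.1 hs).2
    obtain ⟨x⟩ := h.1.nonempty
    obtain ⟨y, hy⟩ := SimpleGraph.exists_adj_of_valence_ne_zero (G := X.link v) (x := x) (by rw [h.2]; decide)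
    exact ⟨tri v x y, mem_cofaces.2 ⟨hy.2, card_tri hy.1, by simp [tri]⟩⟩
  · have h := ((segment_mem_regionSimplices hc).1 hs).2.2
    exact Finset.card_pos.1 (by omega)
  · exact ⟨s, mem_cofaces.2 ⟨mem_faces_of_mem_regionSimplices hs, hc, subset_rfl⟩⟩

theorem mem_regionSimplices_of_mem_cofaces {s t : Finset V} (ht : t ∈ X.cofaces s) :
    t ∈ X.regionSimplices :=
  triangle_mem_regionSimplices (mem_cofaces.1 ht).1 (mem_cofaces.1 ht).2.1

theorem mem_closure_iff_of_mem_regionSimplices {S : Set X.Region} {s : Finset V}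
    (hs : s ∈ X.regionSimplices) :
    s ∈ closure S ↔ (incidence X.regionSimplices).connectedComponentMk ⟨s, hs⟩ ∈ S := by
  constructor
  · rintro ⟨-, f, hf, t, ⟨ht, rfl⟩, hst⟩
    rwa [component_eq_of_subset hs ht hst]
  · intro h
    exact ⟨mem_faces_of_mem_regionSimplices hs, _, h, s, ⟨hs, rfl⟩, subset_rfl⟩

/-- Every simplex of a region lies in a triangle of the same region, so a closure is determined by
its triangles. -/
theorem mem_closure_iff_exists {S : Set X.Region} {s : Finset V} (hs : s ∈ X.faces) :
    s ∈ closure S ↔ ∃ t ∈ X.cofaces s, t ∈ closure S := by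
  constructor
  · rintro ⟨-, f, hf, t, ht, hst⟩
    have htR := component_simplices_subset f ht
    obtain ⟨u, hu⟩ := exists_coface_of_mem_regionSimplices htR
    have huR := mem_regionSimplices_of_mem_cofaces hu
    rw [mem_cofaces] at hu
    exact ⟨u, mem_cofaces.2 ⟨hu.1, hu.2.1, hst.trans hu.2.2⟩, hu.1, f, hf, u,
      mem_component_of_subset ht huR hu.2.2, subset_rfl⟩
  · rintro ⟨t, ht, h⟩
    exact closure_isLower h (mem_cofaces.1 ht).2.2 (nonempty_of_mem_faces hs)

theorem mem_closure_oddRegions_of_mem_regionSimplices (σ : X.Region → ℕ) {s : Finset V}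
    (hs : s ∈ X.regionSimplices) : s ∈ closure (oddRegions σ) ↔ Odd (valueAt σ s) := by
  rw [mem_closure_iff_of_mem_regionSimplices hs, valueAt_of_mem σ hs]
  rfl

theorem mem_closure_oddRegions (σ : X.Region → ℕ) {s : Finset V} (hs : s ∈ X.faces) :
    s ∈ closure (oddRegions σ) ↔ ∃ c ∈ segmentColors σ s, Odd c := by
  rw [mem_closure_iff_exists hs]
  constructor
  · rintro ⟨t, ht, h⟩
    exact ⟨_, Multiset.mem_map_of_mem _ ht, (mem_closure_oddRegions_of_mem_regionSimplices σ
      (mem_regionSimplices_of_mem_cofaces ht)).1 h⟩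
  · rintro ⟨c, hc, h⟩
    obtain ⟨t, ht, rfl⟩ := Multiset.mem_map.1 hc
    exact ⟨t, ht, (mem_closure_oddRegions_of_mem_regionSimplices σ
      (mem_regionSimplices_of_mem_cofaces ht)).2 h⟩

/-- If a vertex lies on the odd surface, then so does some branch of its link. -/
theorem exists_odd_branch (σ : X.Region → ℕ) {v : V} (hc : (X.link v).Connected)
    {x₀ : X.LinkVertex v} (hx₀ : (X.link v).valence x₀ ≠ 2)
    (h : {v} ∈ closure (oddRegions σ)) :
    ∃ x, (X.link v).valence x ≠ 2 ∧ ∃ c ∈ segmentColors σ (seg v x), Odd c := by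
  by_contra! hn
  obtain ⟨t, ht, hto⟩ := (mem_closure_iff_exists h.1).1 h
  obtain ⟨h1, h2, h3⟩ := mem_cofaces.1 ht
  obtain ⟨x, y, hxy, rfl⟩ := exists_eq_tri h1 h2 (h3 (by simp) : v ∈ t)
  exact not_triColor_of_branch (p := Odd) σ hc hx₀ hn hxy
    ((mem_closure_oddRegions_of_mem_regionSimplices σ (tri_mem_regionSimplices hxy)).1 hto)

/-- An odd color at `v` reaches some trivalent vertex of the link, and both trivalent vertices see
the same colors. -/
theorem theta_mem_closure (σ : X.Region → ℕ) {v : V} (h : (X.link v).IsTheta) {s : Finset V}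
    (hs : s ∈ X.segmentsAt 3 v) :
    {v} ∈ closure (oddRegions σ) ↔ s ∈ closure (oddRegions σ) := by
  have hs' := mem_segmentsAt.1 hs
  refine ⟨fun hv => ?_, fun h => closure_isLower h (by simpa using hs'.2) (by simp)⟩
  obtain ⟨x, y, -, h3, h23, -⟩ := theta_frame h
  obtain ⟨w, hw, c, hc, hco⟩ := exists_odd_branch σ h.1
    (x₀ := x) (by rw [(h3 x).2 ⟨0, rfl⟩]; decide) hv
  have hw3 := (h23 w).resolve_left hw
  rw [mem_closure_oddRegions σ hs'.1.1,
    theta_segmentColors σ h hs (mem_segmentsAt_iff_exists.2 ⟨w, hw3, rfl⟩)]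
  exact ⟨c, hc, hco⟩

theorem interval_mem_closure (σ : X.Region → ℕ) {v : V} (h : (X.link v).IsInterval) {s : Finset V}
    (hs : s ∈ X.segmentsAt 1 v) :
    {v} ∈ closure (oddRegions σ) ↔ s ∈ closure (oddRegions σ) := by
  have hs' := mem_segmentsAt.1 hs
  refine ⟨fun hv => ?_, fun h => closure_isLower h (by simpa using hs'.2) (by simp)⟩
  obtain ⟨x, y, -, h3, h23, -⟩ := interval_frame h
  obtain ⟨w, hw, c, hc, hco⟩ := exists_odd_branch σ h.1
    (x₀ := x) (by rw [(h3 x).2 ⟨0, rfl⟩]; decide) hv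
  have hw3 := (h23 w).resolve_left hw
  rw [mem_closure_oddRegions σ hs'.1.1,
    interval_segmentColors σ h hs (mem_segmentsAt_iff_exists.2 ⟨w, hw3, rfl⟩)]
  exact ⟨c, hc, hco⟩

theorem segmentColors_of_segments_one (σ : X.Region → ℕ) {s : Finset V} (hs : s ∈ X.segments 1) :
    segmentColors σ s = {bdryColor σ s} := by
  obtain ⟨t, ht⟩ := Finset.card_eq_one.1 hs.2.2
  simp [bdryColor, segmentColors, ht]

theorem tripod_exists_odd (σ : X.Region → ℕ) (v : X.BdryVertex)
    (hv : {v.1} ∈ closure (oddRegions σ)) : ∃ c ∈ bdryVertexColors (bdryColor σ) v, Odd c := by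
  obtain ⟨x, y, hy, h3, h1, h123, -⟩ := tripod_frame v.2.2
  obtain ⟨w, hw, c, hc, hco⟩ := exists_odd_branch σ v.2.2.1
    (x₀ := x) (by rw [(h3 x).2 rfl]; decide) hv
  rcases h123 w with hw' | hw' | hw'
  · have hs : seg v.1 w ∈ X.segmentsAt 1 v.1 := mem_segmentsAt_iff_exists.2 ⟨w, hw', rfl⟩
    rw [segmentColors_of_segments_one σ (mem_segmentsAt.1 hs).1, Multiset.mem_singleton] at hc
    exact ⟨c, by rw [bdryVertexColors_eq, hc]; exact Multiset.mem_map_of_mem _ hs, hco⟩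
  · exact absurd hw' hw
  · refine ⟨c, ?_, hco⟩
    rwa [tripod_segmentColors σ v (mem_segmentsAt_iff_exists.2 ⟨w, hw', rfl⟩)]

/-! ## Colors of edges -/

/-- A function on segments is constant along an edge if it does not change at its vertices. -/
theorem eq_of_mem_component {k : ℕ} {p : V → Prop} {α : Type*} (g : Finset V → α)
    (hg : ∀ v, p v → ∀ s ∈ X.segmentsAt k v, ∀ t ∈ X.segmentsAt k v, g s = g t)
    {C : Component (X.edgeStratum k p)} {s t : Finset V} (hs : s ∈ C.simplices)
    (ht : t ∈ C.simplices) (hsk : s ∈ X.segments k) (htk : t ∈ X.segments k) : g s = g t := by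
  -- The invariant along a walk: a segment has the value `g s`, and at a vertex all segments of this
  -- type have it.
  have spread : ∀ a b : X.edgeStratum k p, (incidence (X.edgeStratum k p)).Walk a b →
      ((a.1 ∈ X.segments k → g a.1 = g s) ∧ ∀ v, a.1 = {v} → ∀ u ∈ X.segmentsAt k v, g u = g s) →
      ((b.1 ∈ X.segments k → g b.1 = g s) ∧
        ∀ v, b.1 = {v} → ∀ u ∈ X.segmentsAt k v, g u = g s) := by
    intro a b q
    induction q with
    | nil => exact id
    | @cons a b c hab _ ih =>
      rintro ⟨h1, h2⟩
      refine ih ⟨fun hb => ?_, fun v hv u hu => ?_⟩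
      · rcases a.2 with ha | ⟨-, w, hw, -⟩
        · rcases hab with hab | hab <;>
          · have := Finset.card_lt_card hab
            rw [ha.2.1, hb.2.1] at this
            omega
        · refine h2 w hw _ (mem_segmentsAt.2 ⟨hb, ?_⟩)
          rcases hab with hab | hab
          · exact hab.subset (by simp [hw])
          · have := Finset.card_lt_card hab
            rw [hw, hb.2.1] at this
            simp at this
      · have hbv : p v := (singleton_mem_edgeStratum.1 (hv ▸ b.2)).2
        rcases a.2 with ha | ⟨-, w, hw, -⟩
        · rw [← h1 ha]
          refine hg v hbv u hu a.1 (mem_segmentsAt.2 ⟨ha, ?_⟩)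
          rcases hab with hab | hab
          · have := Finset.card_lt_card hab
            rw [hv, ha.2.1] at this
            simp at this
          · exact hab.subset (by simp [hv])
        · rcases hab with hab | hab <;>
          · have := Finset.card_lt_card hab
            rw [hw, hv] at this
            simp at this
  obtain ⟨hs1, hsC⟩ := hs
  obtain ⟨ht1, htC⟩ := ht
  obtain ⟨q⟩ := SimpleGraph.ConnectedComponent.exact (hsC.trans htC.symm)
  refine ((spread _ _ q ⟨fun _ => rfl, fun v hv => ?_⟩).1 htk).symm
  rw [show s = {v} from hv] at hsk
  exact absurd hsk (singleton_notMem_segments v k)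

theorem exists_segment {k : ℕ} {p : V → Prop} (hp : ∀ v, p v → (X.segmentsAt k v).card = 2)
    (C : Component (X.edgeStratum k p)) : ∃ s ∈ C.simplices, s ∈ X.segments k := by
  obtain ⟨s, hs⟩ := component_nonempty C
  rcases component_simplices_subset C hs with h | ⟨-, v, rfl, hv⟩
  · exact ⟨s, hs, h⟩
  · obtain ⟨t, ht⟩ := Finset.card_pos.1 (show 0 < (X.segmentsAt k v).card by rw [hp v hv]; decide)
    rw [mem_segmentsAt] at ht
    exact ⟨t, mem_component_of_subset hs (Or.inl ht.1) (by simpa using ht.2), ht.1⟩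

/-- Colors do not change along an edge, so the segment chosen in `edgeColors` is immaterial. -/
theorem edgeColors_eq {k : ℕ} {p : V → Prop} (σ : X.Region → ℕ)
    (hσ : ∀ v, p v → ∀ s ∈ X.segmentsAt k v, ∀ t ∈ X.segmentsAt k v,
      segmentColors σ s = segmentColors σ t)
    {C : Component (X.edgeStratum k p)} {s : Finset V} (hs : s ∈ C.simplices)
    (hsk : s ∈ X.segments k) : edgeColors σ C = segmentColors σ s := by
  have h : ∃ s ∈ C.simplices, s.card = 2 := ⟨s, hs, hsk.2.1⟩
  unfold edgeColors
  rw [dif_pos h]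
  refine eq_of_mem_component _ hσ h.choose_spec.1 hs ?_ hsk
  exact (mem_edgeStratum_of_card (by rw [h.choose_spec.2]; decide)).1
    (component_simplices_subset C h.choose_spec.1)

theorem intEdgeColors_eq (σ : X.Region → ℕ) {e : X.IntEdge} {s : Finset V}
    (hs : s ∈ Component.simplices e) (hsk : s ∈ X.segments 3) :
    edgeColors σ e = segmentColors σ s :=
  edgeColors_eq (k := 3) (p := fun v => (X.link v).IsTheta) σ
    (fun _ h _ hs _ ht => theta_segmentColors σ h hs ht) hs hsk

theorem bdryEdgeColors_eq (σ : X.Region → ℕ) {e : X.BdryEdge} {s : Finset V}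
    (hs : s ∈ Component.simplices e) (hsk : s ∈ X.segments 1) :
    edgeColors σ e = {bdryColor σ s} :=
  (edgeColors_eq (k := 1) (p := fun v => (X.link v).IsInterval) σ
    (fun _ h _ hs _ ht => interval_segmentColors σ h hs ht) hs hsk).trans
    (segmentColors_of_segments_one σ hsk)

theorem exists_segment_intEdge (e : X.IntEdge) :
    ∃ s ∈ Component.simplices e, s ∈ X.segments 3 :=
  exists_segment (k := 3) (p := fun v => (X.link v).IsTheta) (fun _ h => (theta_valence h).2) e

/-- An edge is contained in the odd surface or disjoint from it, so the surface can be counted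
stratum by stratum. -/
theorem intEdge_mem_closure (σ : X.Region → ℕ) {e : X.IntEdge} {s : Finset V}
    (hs : s ∈ Component.simplices e) :
    s ∈ closure (oddRegions σ) ↔ ∃ c ∈ edgeColors σ e, Odd c := by
  rcases component_simplices_subset e hs with h | ⟨h, v, rfl, hv⟩
  · rw [intEdgeColors_eq σ hs h, mem_closure_oddRegions σ h.1]
  · obtain ⟨t, ht⟩ := Finset.card_pos.1
      (show 0 < (X.segmentsAt 3 v).card by rw [(theta_valence hv).2]; decide)
    have ht' := mem_segmentsAt.1 ht
    have hte : t ∈ Component.simplices e :=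
      mem_component_of_subset hs (Or.inl ht'.1) (by simpa using ht'.2)
    rw [theta_mem_closure σ hv ht, intEdgeColors_eq σ hte ht'.1, mem_closure_oddRegions σ ht'.1.1]

theorem bdryEdge_mem_closure (σ : X.Region → ℕ) {e : X.BdryEdge} {s : Finset V}
    (hs : s ∈ Component.simplices e) :
    s ∈ closure (oddRegions σ) ↔ Odd (edgeColors σ e).sum := by
  have key : ∀ t ∈ Component.simplices e, t ∈ X.segments 1 →
      (t ∈ closure (oddRegions σ) ↔ Odd (edgeColors σ e).sum) := by
    intro t ht htk
    rw [mem_closure_oddRegions σ htk.1, bdryEdgeColors_eq σ ht htk,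
      segmentColors_of_segments_one σ htk]
    simp
  rcases component_simplices_subset e hs with h | ⟨h, v, rfl, hv⟩
  · exact key s hs h
  · obtain ⟨t, ht⟩ := Finset.card_pos.1
      (show 0 < (X.segmentsAt 1 v).card by rw [(interval_valence hv).1]; decide)
    have ht' := mem_segmentsAt.1 ht
    rw [interval_mem_closure σ hv ht]
    exact key t (mem_component_of_subset hs (Or.inl ht'.1) (by simpa using ht'.2)) ht'.1

/-! ## Orders of the factors of the evaluation -/

open Classical in
/-- The indicator of the odd surface. -/
noncomputable def oddInd (σ : X.Region → ℕ) (s : Finset V) : ℤ :=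
  if s ∈ closure (oddRegions σ) then 1 else 0

open Classical in
/-- The indicator of red triples. -/
noncomputable def redInd (m : Multiset ℕ) : ℤ := if Red m then 1 else 0

/-- The trivalent vertices of the link correspond to the ends at `v` of interior edges, so the red
vertices of the tetrahedron are the red segments at `v`. -/
theorem exists_ordGE_vertexTet {σ : X.Region → ℕ} (hσ : IsAdmissible σ) (v : X.IntVertex) :
    ∃ n : ℤ, OrdGE (vertexTet σ v) n ∧
      2 * oddInd σ {v.1} - ∑ s ∈ X.segmentsAt 3 v.1, redInd (segmentColors σ s) ≤ 2 * n := by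
  classical
  have hx := v.2.2.2.choose_spec
  unfold vertexTet
  set x := v.2.2.2.choose with hxd
  obtain ⟨hsymm, hcol⟩ := tetra_sectorColor σ hx
  have hc : ∀ i, segmentColors σ (seg v.1 (x i)) = {sectorColor σ v.1 (x i) (x (i.succAbove 0)),
      sectorColor σ v.1 (x i) (x (i.succAbove 1)), sectorColor σ v.1 (x i) (x (i.succAbove 2))} := by
    intro i
    rw [hcol]
    rfl
  have hadm : ∀ i, Admissible (segmentColors σ (seg v.1 (x i))) := fun i =>
    hσ _ ((seg_mem_segments _ _).2 (hx.2.1 i))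
  -- The colors are put in the order of the triples `(a, b, c)`, `(a, e, f)`, `(d, b, f)`, `(d, e,
  -- c)` of `tet`.
  have c0 : segmentColors σ (seg v.1 (x 0)) = {sectorColor σ v.1 (x 0) (x 1),
      sectorColor σ v.1 (x 0) (x 2), sectorColor σ v.1 (x 0) (x 3)} := hc 0
  have c1 : segmentColors σ (seg v.1 (x 1)) = {sectorColor σ v.1 (x 0) (x 1),
      sectorColor σ v.1 (x 1) (x 3), sectorColor σ v.1 (x 1) (x 2)} := by
    rw [hsymm 0 1 (by decide)]
    refine (hc 1).trans ?_
    congr 1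
    exact Multiset.pair_comm _ _
  have c2 : segmentColors σ (seg v.1 (x 2)) = {sectorColor σ v.1 (x 2) (x 3),
      sectorColor σ v.1 (x 0) (x 2), sectorColor σ v.1 (x 1) (x 2)} := by
    rw [hsymm 0 2 (by decide), hsymm 1 2 (by decide)]
    refine (hc 2).trans ?_
    rw [Multiset.pair_comm]
    exact Multiset.cons_swap _ _ _
  have c3 : segmentColors σ (seg v.1 (x 3)) = {sectorColor σ v.1 (x 2) (x 3),
      sectorColor σ v.1 (x 1) (x 3), sectorColor σ v.1 (x 0) (x 3)} := by
    rw [hsymm 2 3 (by decide), hsymm 1 3 (by decide), hsymm 0 3 (by decide)]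
    refine (hc 3).trans ?_
    rw [Multiset.pair_comm]
    refine (Multiset.cons_swap _ _ _).trans ?_
    congr 1
    exact Multiset.pair_comm _ _
  have h0 := hadm 0
  have h1 := hadm 1
  have h2 := hadm 2
  have h3 := hadm 3
  rw [c0] at h0
  rw [c1] at h1
  rw [c2] at h2
  rw [c3] at h3
  obtain ⟨n, hn, hle⟩ := exists_ordGE_tet h0 h1 h2 h3
  refine ⟨n, hn, le_trans ?_ hle⟩
  rw [segmentsAt_eq_map x hx.1 (tetra_valence_iff hx), Finset.sum_map, Fin.sum_univ_four]
  simp only [Function.Embedding.coeFn_mk, c0, c1, c2, c3]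
  refine sub_le_sub ?_ le_rfl
  unfold oddInd
  split_ifs with ho hs hs
  · norm_num
  · exfalso
    apply hs
    obtain ⟨w, hw, c, hcw, hco⟩ := exists_odd_branch σ v.2.2.1 (x₀ := x 0)
      (by rw [hx.2.1]; decide) ho
    have hwr : w ∈ Set.range x := by
      by_contra hn
      exact hw (hx.2.2.1 w hn)
    obtain ⟨i, rfl⟩ := hwr
    fin_cases i
    · simp only [Fin.zero_eta, c0, Multiset.insert_eq_cons, Multiset.mem_cons,
        Multiset.mem_singleton] at hcw
      rcases hcw with rfl | rfl | rfl <;> simp [hco]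
    · simp only [Fin.mk_one, c1, Multiset.insert_eq_cons, Multiset.mem_cons,
        Multiset.mem_singleton] at hcw
      rcases hcw with rfl | rfl | rfl <;> simp [hco]
    · simp only [Fin.reduceFinMk, c2, Multiset.insert_eq_cons, Multiset.mem_cons,
        Multiset.mem_singleton] at hcw
      rcases hcw with rfl | rfl | rfl <;> simp [hco]
    · simp only [Fin.reduceFinMk, c3, Multiset.insert_eq_cons, Multiset.mem_cons,
        Multiset.mem_singleton] at hcw
      rcases hcw with rfl | rfl | rfl <;> simp [hco]
  · norm_num
  · norm_num

end SimplePolyhedron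

/-! ### Red edges and the order of the evaluation. -/

namespace SimplePolyhedron

open Simplices Quantum

variable {V : Type*} [DecidableEq V] {X : SimplePolyhedron V}

open Classical in
/-- The indicator of the red interior edges. -/
noncomputable def redEdgeInd (σ : X.Region → ℕ) (s : Finset V) : ℤ :=
  if h : s ∈ X.intEdgeSimplices then
    redInd (edgeColors σ ((incidence X.intEdgeSimplices).connectedComponentMk ⟨s, h⟩)) else 0

theorem redEdgeInd_of_mem (σ : X.Region → ℕ) {e : X.IntEdge} {s : Finset V}
    (hs : s ∈ Component.simplices e) : redEdgeInd σ s = redInd (edgeColors σ e) := by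
  obtain ⟨h, rfl⟩ := hs
  exact dif_pos h

open Classical in
/-- Counting the pairs of a red segment and a vertex of it in two ways. -/
theorem two_mul_sum_redEdgeInd (σ : X.Region → ℕ) :
    2 * ∑ s ∈ (finite_edgeStratum (X := X) 3 fun v => (X.link v).IsTheta).toFinset,
        (-1) ^ s.card * redEdgeInd σ s =
      ∑ v : X.IntVertex, ∑ s ∈ X.segmentsAt 3 v.1, redInd (segmentColors σ s) +
        ∑ v : X.BdryVertex, ∑ s ∈ X.segmentsAt 3 v.1, redInd (segmentColors σ s) := by
  set F := X.finite_faces.toFinset with hF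
  set r : Finset V → ℤ := fun s => redInd (segmentColors σ s)
  set E := F.filter (· ∈ X.segments 3) with hE
  -- Supported on vertices, where it counts the red segments.
  set g : Finset V → ℤ := fun s => if s.card = 1 then ∑ u ∈ E.filter (s ⊆ ·), r u else 0 with hg
  have hEv : ∀ v, E.filter ({v} ⊆ ·) = X.segmentsAt 3 v := by
    intro v
    ext s
    simp only [hE, hF, Finset.mem_filter, Set.Finite.mem_toFinset, mem_segmentsAt,
      Finset.singleton_subset_iff]
    exact ⟨fun h => ⟨h.1.2, h.2⟩, fun h => ⟨⟨h.1.1, h.1⟩, h.2⟩⟩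
  have hgv : ∀ v, g {v} = ∑ s ∈ X.segmentsAt 3 v, r s := by
    intro v
    simp only [hg, Finset.card_singleton, if_true, hEv]
  have hg0 : ∀ s, s.card ≠ 1 → g s = 0 := fun s hs => if_neg hs
  have htotal : ∑ s ∈ F, g s = 2 * ∑ u ∈ E, r u := by
    simp only [hg]
    rw [← Finset.sum_filter]
    simp only [Finset.sum_filter (s := E)]
    rw [Finset.sum_comm, Finset.mul_sum]
    refine Finset.sum_congr rfl fun u hu => ?_
    rw [hE, Finset.mem_filter, hF, Set.Finite.mem_toFinset] at hu
    obtain ⟨a, b, hab, rfl⟩ := Finset.card_eq_two.1 hu.2.2.1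
    rw [← Finset.sum_filter, show (F.filter fun s => s.card = 1).filter (· ⊆ {a, b}) =
      {{a}, {b}} from ?_, Finset.sum_pair (fun e => hab (Finset.singleton_injective e)), two_mul]
    ext s
    simp only [Finset.mem_filter, hF, Set.Finite.mem_toFinset, Finset.mem_insert,
      Finset.mem_singleton]
    constructor
    · rintro ⟨⟨-, hc⟩, hs⟩
      obtain ⟨c, rfl⟩ := Finset.card_eq_one.1 hc
      simpa using hs
    · rintro (rfl | rfl)
      · exact ⟨⟨mem_faces_of_subset hu.1 (by simp) (by simp), by simp⟩, by simp⟩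
      · exact ⟨⟨mem_faces_of_subset hu.1 (by simp) (by simp), by simp⟩, by simp⟩
  have hR : ∑ s ∈ (finite_regions (X := X)).toFinset, g s = 0 := by
    refine Finset.sum_eq_zero fun s hs => ?_
    rw [Set.Finite.mem_toFinset] at hs
    by_cases hc : s.card = 1
    · obtain ⟨v, rfl⟩ := Finset.card_eq_one.1 hc
      rw [hgv, (circle_valence (singleton_mem_regionSimplices.1 hs).2).2, Finset.sum_empty]
    · exact hg0 s hc
  have hB : ∑ s ∈ (finite_edgeStratum (X := X) 1 fun v => (X.link v).IsInterval).toFinset, g s =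
      0 := by
    refine Finset.sum_eq_zero fun s hs => ?_
    rw [Set.Finite.mem_toFinset] at hs
    by_cases hc : s.card = 1
    · obtain ⟨v, rfl⟩ := Finset.card_eq_one.1 hc
      rw [hgv, (interval_valence (singleton_mem_edgeStratum.1 hs).2).2, Finset.sum_empty]
    · exact hg0 s hc
  -- A vertex on a red interior edge sees two red segments. What remains of twice the number of red
  -- segments is twice segments minus vertices, that is `2χ` of the red edges.
  have hI : ∑ s ∈ (finite_edgeStratum (X := X) 3 fun v => (X.link v).IsTheta).toFinset, g s +
      2 * ∑ s ∈ (finite_edgeStratum (X := X) 3 fun v => (X.link v).IsTheta).toFinset,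
        (-1) ^ s.card * redEdgeInd σ s = 2 * ∑ u ∈ E, r u := by
    rw [Finset.mul_sum, ← Finset.sum_add_distrib, Finset.mul_sum]
    have hEI : E = (finite_edgeStratum (X := X) 3 fun v => (X.link v).IsTheta).toFinset.filter
        (· ∈ X.segments 3) := by
      ext s
      simp only [hE, hF, Finset.mem_filter, Set.Finite.mem_toFinset]
      exact ⟨fun h => ⟨Or.inl h.2, h.2⟩, fun h => ⟨h.2.1, h.2⟩⟩
    rw [hEI, Finset.sum_filter]
    refine Finset.sum_congr rfl fun s hs => ?_
    rw [Set.Finite.mem_toFinset] at hs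
    have hse : s ∈ Component.simplices
      ((incidence X.intEdgeSimplices).connectedComponentMk ⟨s, hs⟩) := ⟨hs, rfl⟩
    rw [redEdgeInd_of_mem σ hse]
    rcases hs with h | ⟨h, v, rfl, hv⟩
    · rw [hg0 s (by rw [h.2.1]; decide), if_pos h, intEdgeColors_eq σ hse h, h.2.1]
      simp [r]
    · rw [hgv, if_neg (singleton_notMem_segments v 3)]
      have hconst : ∀ t ∈ X.segmentsAt 3 v, r t = redInd (edgeColors σ
          ((incidence X.intEdgeSimplices).connectedComponentMk ⟨{v}, Or.inr ⟨h, v, rfl, hv⟩⟩)) := by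
        intro t ht
        have ht' := mem_segmentsAt.1 ht
        rw [intEdgeColors_eq σ (mem_component_of_subset hse (Or.inl ht'.1)
          (by simpa using ht'.2)) ht'.1]
      rw [Finset.sum_congr rfl hconst, Finset.sum_const, (theta_valence hv).2]
      simp
  have := sum_faces_eq (X := X) g
  rw [← hF, htotal, hR, hB] at this
  simp only [hgv] at this
  linarith

theorem intEdgeColors_admissible {σ : X.Region → ℕ} (hσ : IsAdmissible σ) (e : X.IntEdge) :
    Admissible (edgeColors σ e) := by
  obtain ⟨s, hs, h3⟩ := exists_segment_intEdge e
  rw [intEdgeColors_eq σ hs h3]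
  exact hσ s h3

theorem bdryVertexColors_admissible {σ : X.Region → ℕ} (hσ : IsAdmissible σ) (v : X.BdryVertex) :
    Admissible (bdryVertexColors (bdryColor σ) v) := by
  obtain ⟨s, hs⟩ := Finset.card_pos.1
    (show 0 < (X.segmentsAt 3 v.1).card by rw [(tripod_valence v.2.2).2]; decide)
  rw [tripod_segmentColors σ v hs]
  exact hσ s (mem_segmentsAt.1 hs).1

theorem sum_redInd_tripod (σ : X.Region → ℕ) (v : X.BdryVertex) :
    ∑ s ∈ X.segmentsAt 3 v.1, redInd (segmentColors σ s) =
      redInd (bdryVertexColors (bdryColor σ) v) := by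
  obtain ⟨s, hs⟩ := Finset.card_eq_one.1 (tripod_valence v.2.2).2
  rw [hs, Finset.sum_singleton, tripod_segmentColors σ v (s := s) (by simp [hs])]

theorem numRed_eq_sum (c : Finset V → ℕ) :
    (X.numRed c : ℤ) = ∑ v : X.BdryVertex, redInd (bdryVertexColors c v) := by
  classical
  unfold numRed redInd
  rw [Set.ncard_eq_toFinset_card', Finset.sum_boole]
  congr 2
  ext v
  simp

/-- The evaluation of an admissible coloring has order at least `χ(S_σ) - r / 2`. -/
theorem exists_ordGE_state (gl : X.Region → ℚ) {σ : X.Region → ℕ} (hσ : IsAdmissible σ) :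
    ∃ N : ℤ, OrdGE (state gl σ) N ∧
      2 * eulerChar (closure (oddRegions σ)) - X.numRed (bdryColor σ) ≤ 2 * N := by
  classical
  choose n hn hle using fun v : X.IntVertex => exists_ordGE_vertexTet hσ v
  have hA := HasOrd.prod Finset.univ fun (f : X.Region) _ =>
    ((hasOrd_circ (σ f)).zpow (eulerChar f.simplices)).mul (hasOrd_phase (gl f) (σ f))
  have hB := OrdGE.prod Finset.univ fun (v : X.IntVertex) _ => hn v
  have hC := HasOrd.prod Finset.univ fun (v : X.BdryVertex) _ =>
    hasOrd_theta (bdryVertexColors_admissible hσ v)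
  have hD := HasOrd.prod Finset.univ fun (e : X.IntEdge) _ =>
    (hasOrd_theta (intEdgeColors_admissible hσ e)).zpow (eulerChar e.simplices)
  have hE := HasOrd.prod Finset.univ fun (e : X.BdryEdge) _ =>
    (hasOrd_circ (edgeColors σ e).sum).zpow (eulerChar e.simplices)
  refine ⟨_, ((hA.ordGE.mul hB).mul hC.ordGE).div (hD.mul hE), ?_⟩
  have parity : ∀ k : ℕ, (if Odd k then 1 else 0 : ℤ) = ((k % 2 : ℕ) : ℤ) := by
    intro k
    rcases Nat.mod_two_eq_zero_or_one k with h | h <;> simp [Nat.odd_iff, h]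
  have sA : ∑ f : X.Region, eulerChar f.simplices * ((σ f % 2 : ℕ) : ℤ) =
      ∑ s ∈ (finite_regions (X := X)).toFinset, (-1) ^ (s.card + 1) * oddInd σ s := by
    refine sum_component finite_regions _ _ _ (fun f s hs => ?_) eulerChar_region
    obtain ⟨h, rfl⟩ := hs
    rw [← parity, oddInd]
    refine if_congr ?_ rfl rfl
    rw [mem_closure_oddRegions_of_mem_regionSimplices σ h, valueAt_of_mem σ h]
  have sD : ∑ e : X.IntEdge, eulerChar e.simplices *
      ((if ∃ x ∈ edgeColors σ e, Odd x then 1 else 0) - if Red (edgeColors σ e) then 1 else 0) =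
      ∑ s ∈ (finite_edgeStratum (X := X) 3 fun v => (X.link v).IsTheta).toFinset,
        (-1) ^ s.card * (oddInd σ s - redEdgeInd σ s) := by
    let _ : Fintype (Component (X.edgeStratum 3 fun v => (X.link v).IsTheta)) := X.fintypeIntEdge
    refine sum_component (finite_edgeStratum (X := X) 3 fun v => (X.link v).IsTheta) _ _ _
      (fun e s hs => ?_) (eulerChar_edge fun v h => (theta_valence h).2)
    rw [redEdgeInd_of_mem σ hs, oddInd, redInd]
    congr 1
    exact if_congr (intEdge_mem_closure σ hs) rfl rfl
  have sE : ∑ e : X.BdryEdge, eulerChar e.simplices * (((edgeColors σ e).sum % 2 : ℕ) : ℤ) =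
      ∑ s ∈ (finite_edgeStratum (X := X) 1 fun v => (X.link v).IsInterval).toFinset,
        (-1) ^ s.card * oddInd σ s := by
    let _ : Fintype (Component (X.edgeStratum 1 fun v => (X.link v).IsInterval)) :=
      X.fintypeBdryEdge
    refine sum_component (finite_edgeStratum (X := X) 1 fun v => (X.link v).IsInterval) _ _ _
      (fun e s hs => ?_) (eulerChar_edge fun v h => (interval_valence h).1)
    rw [← parity, oddInd]
    exact if_congr (bdryEdge_mem_closure σ hs) rfl rfl
  have sC : ∑ v : X.BdryVertex, (oddInd σ {v.1} - redInd (bdryVertexColors (bdryColor σ) v)) ≤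
      ∑ v : X.BdryVertex, ((if ∃ x ∈ bdryVertexColors (bdryColor σ) v, Odd x then 1 else 0) -
        if Red (bdryVertexColors (bdryColor σ) v) then 1 else 0 : ℤ) := by
    refine Finset.sum_le_sum fun v _ => ?_
    unfold redInd
    refine sub_le_sub ?_ le_rfl
    unfold oddInd
    split_ifs with h1 h2 h2
    · exact le_rfl
    · exact absurd (tripod_exists_odd σ v h1) h2
    · exact zero_le_one
    · exact le_rfl
  have sB := Finset.sum_le_sum fun (v : X.IntVertex) (_ : v ∈ Finset.univ) => hle v
  have hχ : eulerChar (closure (oddRegions σ)) =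
      ∑ s ∈ X.finite_faces.toFinset, (-1) ^ (s.card + 1) * oddInd σ s := eulerChar_closure _
  have hsum := sum_faces_eq (X := X) fun s => (-1) ^ (s.card + 1) * oddInd σ s
  -- Red edges contribute half the number of their ends. This makes up for the loss of 1/2 at each
  -- end in an interior vertex, and for half of the loss of 1 at each red boundary vertex.
  have hcount := two_mul_sum_redEdgeInd σ
  simp only [sum_redInd_tripod] at hcount
  rw [← numRed_eq_sum] at hcount
  rw [Finset.sum_sub_distrib, ← numRed_eq_sum, Finset.sum_sub_distrib] at sC
  simp only [add_zero]
  rw [sA, sD, sE]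
  simp only [mul_sub, Finset.sum_sub_distrib, ← Finset.mul_sum] at sB ⊢
  simp only [pow_succ, mul_neg, mul_one, neg_mul, one_mul, Finset.sum_neg_distrib,
    Finset.card_singleton, pow_zero, neg_neg] at hsum hχ ⊢
  linarith

end SimplePolyhedron

namespace SimplePolyhedron

open Simplices Quantum

variable {V : Type*} [DecidableEq V] {X : SimplePolyhedron V}

/-! ## Collapsing onto a graph -/

/-- If `X` collapses onto a graph, a property holds for all triangles as soon as, for any segment,
it passes from all but one triangles at the segment to the last one. -/
theorem triangle_induction (hX : X.CollapsesToGraph) {Q : Finset V → Prop}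
    (H : ∀ s ∈ X.faces, s.card = 2 → ∀ t ∈ X.cofaces s,
      (∀ u ∈ X.cofaces s, u ≠ t → Q u) → Q t)
    {t : Finset V} (ht : t ∈ X.faces) (hc : t.card = 3) : Q t := by
  obtain ⟨B, hXB, hB⟩ := hX
  -- Invariant of the collapse: what is left is a subcomplex, and `Q` holds for the triangles
  -- already removed.
  have key : (B ⊆ X.faces ∧ ∀ t ∈ B, ∀ s ⊆ t, s.Nonempty → s ∈ B) ∧
      ∀ t ∈ X.faces, t.card = 3 → t ∉ B → Q t := by
    clear hB
    induction hXB with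
    | refl => exact ⟨⟨subset_rfl, fun t ht s hs hn => mem_faces_of_subset ht hs hn⟩,
        fun t ht _ h => absurd ht h⟩
    | @tail A _ _ hAB ih =>
      obtain ⟨⟨hA, hlow⟩, hQ⟩ := ih
      obtain ⟨s, hs, t, ht, hst, huniq, rfl⟩ := hAB
      refine ⟨⟨Set.sdiff_subset.trans hA, fun u hu w hw hn => ⟨hlow u hu.1 w hw hn, ?_⟩⟩,
        fun u hu hc huB => ?_⟩
      · intro hw'
        have hsu : s ⊆ u ∧ u ≠ s := by
          rcases hw' with rfl | rfl
          · exact ⟨hw, fun e => hu.2 (Or.inl e)⟩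
          · exact ⟨hst.subset.trans hw, fun e => hu.2 (Or.inl e)⟩
        exact hu.2 (Or.inr (huniq u hu.1 (Finset.ssubset_iff_subset_ne.2 ⟨hsu.1, hsu.2.symm⟩)))
      · by_cases huA : u ∈ A
        · have hu' : u = s ∨ u = t := by
            by_contra hn
            exact huB ⟨huA, hn⟩
          have hcard := Finset.card_lt_card hst
          have htc := X.card_le t (hA ht)
          rcases hu' with rfl | rfl
          · omega
          -- A vertex of the triangle is not a free face, being also contained in a side of the
          -- triangle.
          · have hs2 : s.card = 2 := by
              rcases card_cases (hA hs) with ⟨a, rfl⟩ | h | h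
              · obtain ⟨b, hb, hba⟩ := Finset.exists_mem_ne (s := u) (by omega) a
                have hab : ({a, b} : Finset V) ⊆ u := by
                  intro c hc
                  simp only [Finset.mem_insert, Finset.mem_singleton] at hc
                  rcases hc with rfl | rfl
                  exacts [hst.subset (by simp), hb]
                have h2 : ({a, b} : Finset V).card = 2 := Finset.card_pair hba.symm
                have := huniq {a, b} (hlow u huA _ hab (by simp))
                  (Finset.ssubset_iff_subset_ne.2 ⟨by simp, fun e => by
                    rw [← e] at h2
                    simp at h2⟩)
                rw [this] at h2
                omega
              · exact h
              · omega
            -- Only one simplex still present contains `s` properly, so the other triangles at `s`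
            -- are gone and satisfy `Q`.
            refine H s (hA hs) hs2 u (mem_cofaces.2 ⟨hu, hc, hst.subset⟩) fun w hw hwu => ?_
            obtain ⟨hw1, hw2, hw3⟩ := mem_cofaces.1 hw
            refine hQ w hw1 hw2 fun hwA => hwu (huniq w hwA ?_)
            exact Finset.ssubset_iff_subset_ne.2 ⟨hw3, fun e => by rw [e] at hs2; omega⟩
        · exact hQ u hu hc huA
  refine key.2 t ht hc fun h => ?_
  have := hB t h
  omega

theorem valueAt_eq_of_segments_two (σ : X.Region → ℕ) {s t u : Finset V} (hs : s ∈ X.segments 2)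
    (ht : t ∈ X.cofaces s) (hu : u ∈ X.cofaces s) : valueAt σ t = valueAt σ u := by
  have hsR : s ∈ X.regionSimplices := Or.inl (Or.inr hs)
  rw [← valueAt_eq_of_subset σ hsR (mem_regionSimplices_of_mem_cofaces ht) (mem_cofaces.1 ht).2.2,
    valueAt_eq_of_subset σ hsR (mem_regionSimplices_of_mem_cofaces hu) (mem_cofaces.1 hu).2.2]

/-- The color of a triangle at a segment is bounded by the colors of the other triangles at this
segment, or by the boundary color. -/
theorem valueAt_le_sum {ψ : X.BdryEdge → ℕ} {σ : X.Region → ℕ} (hσ : σ ∈ extensions ψ)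
    {s t : Finset V} (hs : s ∈ X.faces) (hc : s.card = 2) (ht : t ∈ X.cofaces s) :
    valueAt σ t ≤ valueAt ψ s + ∑ u ∈ (X.cofaces s).erase t, valueAt σ u := by
  have hsum : ∑ u ∈ X.cofaces s, valueAt σ u =
      valueAt σ t + ∑ u ∈ (X.cofaces s).erase t, valueAt σ u :=
    (Finset.add_sum_erase _ _ ht).symm
  rcases segments_cases hs hc with h | h | h
  · have h1 : ∑ u ∈ X.cofaces s, valueAt σ u = valueAt ψ s := hσ.2 s h
    omega
  · obtain ⟨u, hu⟩ := Finset.card_pos.1 (show 0 < ((X.cofaces s).erase t).card by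
      rw [Finset.card_erase_of_mem ht, h.2.2]; decide)
    have h1 := Finset.single_le_sum (f := fun u => valueAt σ u) (fun _ _ => Nat.zero_le _) hu
    rw [valueAt_eq_of_segments_two σ h ht (Finset.mem_of_mem_erase hu)]
    exact h1.trans (Nat.le_add_left _ _)
  · have h1 : 2 * valueAt σ t ≤ ∑ u ∈ X.cofaces s, valueAt σ u :=
      (hσ.1 s h).2.2 _ (Multiset.mem_map_of_mem _ ht)
    omega

/-- The collapse gives each triangle a bound independent of `σ`, the sum of the bounds of its
neighbors at a segment and of the boundary color; every region contains a triangle. -/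
theorem finite_extensions (hX : X.CollapsesToGraph) (ψ : X.BdryEdge → ℕ) :
    (extensions ψ).Finite := by
  have hbound : ∀ t ∈ X.faces, t.card = 3 → ∃ M, ∀ σ ∈ extensions ψ, valueAt σ t ≤ M := by
    intro t ht hc
    refine triangle_induction hX (Q := fun t => ∃ M, ∀ σ ∈ extensions ψ, valueAt σ t ≤ M)
      (fun s hs hc t ht h => ?_) ht hc
    have h' : ∀ u, ∃ M, u ∈ (X.cofaces s).erase t → ∀ σ ∈ extensions ψ, valueAt σ u ≤ M := by
      intro u
      by_cases hu : u ∈ (X.cofaces s).erase t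
      · rw [Finset.mem_erase] at hu
        obtain ⟨M, hM⟩ := h u hu.2 hu.1
        exact ⟨M, fun _ => hM⟩
      · exact ⟨0, fun h => absurd h hu⟩
    choose M hM using h'
    refine ⟨valueAt ψ s + ∑ u ∈ (X.cofaces s).erase t, M u, fun σ hσ => ?_⟩
    exact (valueAt_le_sum hσ hs hc ht).trans
      (Nat.add_le_add_left (Finset.sum_le_sum fun u hu => hM u hu σ hσ) _)
  have hregion : ∀ f : X.Region, ∃ M, ∀ σ ∈ extensions ψ, σ f ≤ M := by
    intro f
    obtain ⟨s, hs, rfl⟩ := component_nonempty f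
    obtain ⟨t, ht⟩ := exists_coface_of_mem_regionSimplices hs
    have htR := mem_regionSimplices_of_mem_cofaces ht
    rw [mem_cofaces] at ht
    obtain ⟨M, hM⟩ := hbound t ht.1 ht.2.1
    refine ⟨M, fun σ hσ => ?_⟩
    rw [component_eq_of_subset hs htR ht.2.2, ← valueAt_of_mem σ htR]
    exact hM σ hσ
  choose M hM using hregion
  exact (Set.Finite.pi' fun f => Set.finite_Iic (M f)).subset fun σ hσ f => hM f σ hσ

/-- With this parity rule the last germ at an interior edge is decided by the other two. -/
theorem iff_odd_card_erase {α : Type*} [DecidableEq α] {s : Finset α} {p : α → Prop}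
    [DecidablePred p] {a : α} (ha : a ∈ s) (h : Even (s.filter p).card) :
    p a ↔ Odd ((s.erase a).filter p).card := by
  rw [← Finset.insert_erase ha, Finset.filter_insert] at h
  split_ifs at h with hp
  · rw [Finset.card_insert_of_notMem (by simp), Nat.even_add_one, Nat.not_even_iff_odd] at h
    exact iff_of_true hp h
  · exact iff_of_false hp (Nat.not_odd_iff_even.2 h)

theorem mem_closure_iff_of_segments_two {S : Set X.Region} {s t u : Finset V}
    (hs : s ∈ X.segments 2) (ht : t ∈ X.cofaces s) (hu : u ∈ X.cofaces s) :
    t ∈ closure S ↔ u ∈ closure S := by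
  have hsR : s ∈ X.regionSimplices := Or.inl (Or.inr hs)
  rw [mem_closure_iff_of_mem_regionSimplices (mem_regionSimplices_of_mem_cofaces ht),
    mem_closure_iff_of_mem_regionSimplices (mem_regionSimplices_of_mem_cofaces hu),
    ← component_eq_of_subset hsR _ (mem_cofaces.1 ht).2.2,
    ← component_eq_of_subset hsR _ (mem_cofaces.1 hu).2.2]

theorem mem_closure_iff_of_segments_one {S : Set X.Region} {s t : Finset V}
    (hs : s ∈ X.segments 1) (ht : t ∈ X.cofaces s) : t ∈ closure S ↔ s ∈ closure S := by
  obtain ⟨u, hu⟩ := Finset.card_eq_one.1 hs.2.2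
  rw [mem_closure_iff_exists hs.1]
  rw [hu, Finset.mem_singleton] at ht
  simp [hu, ht]

/-- If `X` collapses onto a graph, a properly embedded surface is determined by its boundary. -/
theorem closure_eq_closure_oddRegions (hX : X.CollapsesToGraph) {ψ : X.BdryEdge → ℕ}
    {σ : X.Region → ℕ} (hσ : σ ∈ extensions ψ) {S : Set X.Region} (hS : IsProperSurface S)
    (hψ : BoundaryIsOddSublink S ψ) : closure S = closure (oddRegions σ) := by
  classical
  have key : ∀ t ∈ X.faces, t.card = 3 → (t ∈ closure S ↔ t ∈ closure (oddRegions σ)) := by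
    intro t ht hc
    refine triangle_induction hX (Q := fun t => t ∈ closure S ↔ t ∈ closure (oddRegions σ))
      (fun s hs hc t ht h => ?_) ht hc
    rcases segments_cases hs hc with h1 | h1 | h1
    · rw [mem_closure_iff_of_segments_one h1 ht, mem_closure_iff_of_segments_one h1 ht, hψ s h1,
        mem_closure_oddRegions σ h1.1, segmentColors_of_segments_one σ h1, hσ.2 s h1]
      simp
    · obtain ⟨u, hu⟩ := Finset.card_pos.1 (show 0 < ((X.cofaces s).erase t).card by
        rw [Finset.card_erase_of_mem ht, h1.2.2]; decide)
      rw [Finset.mem_erase] at hu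
      rw [mem_closure_iff_of_segments_two h1 ht hu.2, mem_closure_iff_of_segments_two h1 ht hu.2]
      exact h u hu.2 hu.1
    -- Both surfaces contain an even number of the three germs: `S` because it is proper, the odd
    -- surface because the three colors have an even sum.
    · have e1 : Even ((X.cofaces s).filter (· ∈ closure S)).card := by
        have := hS s h1
        rcases this with h2 | h2
        · exact ⟨0, by convert h2⟩
        · exact ⟨1, by convert h2⟩
      have e2 : Even ((X.cofaces s).filter (· ∈ closure (oddRegions σ))).card := by
        have h2 : Even (∑ u ∈ X.cofaces s, valueAt σ u) := (hσ.1 s h1).2.1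
        rw [Finset.even_sum_iff_even_card_odd] at h2
        convert h2 using 2
        refine Finset.filter_congr fun u hu => ?_
        exact mem_closure_oddRegions_of_mem_regionSimplices σ
          (mem_regionSimplices_of_mem_cofaces hu)
      rw [iff_odd_card_erase (p := (· ∈ closure S)) ht e1,
        iff_odd_card_erase (p := (· ∈ closure (oddRegions σ))) ht e2,
        Finset.filter_congr fun u hu => h u (Finset.mem_of_mem_erase hu) (Finset.ne_of_mem_erase hu)]
  ext s
  constructor
  · intro hs
    obtain ⟨t, ht, hts⟩ := (mem_closure_iff_exists hs.1).1 hs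
    exact (mem_closure_iff_exists hs.1).2
      ⟨t, ht, (key t (mem_cofaces.1 ht).1 (mem_cofaces.1 ht).2.1).1 hts⟩
  · intro hs
    obtain ⟨t, ht, hts⟩ := (mem_closure_iff_exists hs.1).1 hs
    exact (mem_closure_iff_exists hs.1).2
      ⟨t, ht, (key t (mem_cofaces.1 ht).1 (mem_cofaces.1 ht).2.1).2 hts⟩

theorem numRed_bdryColor {ψ : X.BdryEdge → ℕ} {σ : X.Region → ℕ} (hσ : σ ∈ extensions ψ) :
    X.numRed (bdryColor σ) = X.numRed (valueAt ψ) := by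
  unfold numRed
  congr 1
  ext v
  have : bdryVertexColors (bdryColor σ) v = bdryVertexColors (valueAt ψ) v := by
    rw [bdryVertexColors_eq, bdryVertexColors_eq]
    exact Multiset.map_congr rfl fun s hs => hσ.2 s (mem_segmentsAt.1 hs).1
  simp [this]

/-- The state sum has order at least `χ(S) - r / 2`. -/
theorem ordGE_stateSum (gl : X.Region → ℚ) (hX : X.CollapsesToGraph) (ψ : X.BdryEdge → ℕ)
    {S : Set X.Region} (hS : IsProperSurface S) (hψ : BoundaryIsOddSublink S ψ) :
    OrdGE (fun q => ∑ᶠ σ ∈ extensions ψ, state gl σ q)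
      ((2 * eulerChar (closure S) - X.numRed (valueAt ψ) + 1) / 2) := by
  have hfin := finite_extensions hX ψ
  simp only [finsum_mem_eq_finite_toFinset_sum _ hfin]
  refine OrdGE.sum _ fun σ hσ => ?_
  rw [Set.Finite.mem_toFinset] at hσ
  obtain ⟨N, hN, hle⟩ := exists_ordGE_state gl hσ.1
  rw [← closure_eq_closure_oddRegions hX hσ hS hψ, numRed_bdryColor hσ] at hle
  -- The stated order is `χ(S) - r / 2` rounded up, which the integer `N` reaches.
  exact hN.mono (by omega)

end SimplePolyhedron

/-! ### The theorem, with the integral bounds rewritten in `ℚ ∪ {⊤}`. -/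

theorem theorem4p4 {V : Type*} [DecidableEq V] (X : SimplePolyhedron V)
    (gl : X.Region → ℚ) (hgl : ∀ f, ∃ n : ℤ, 2 * gl f = n) :
    (∀ σ : X.Region → ℕ, SimplePolyhedron.IsAdmissible σ →
      MeromorphicAt (SimplePolyhedron.state gl σ) Complex.I ∧
      (((Simplices.eulerChar (SimplePolyhedron.closure (SimplePolyhedron.oddRegions σ)) : ℚ) -
          (X.numRed (SimplePolyhedron.bdryColor σ) : ℚ) / 2 : ℚ) : WithTop ℚ) ≤
        Quantum.ordI (SimplePolyhedron.state gl σ)) ∧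
    (X.CollapsesToGraph → ∀ ψ : X.BdryEdge → ℕ,
      (SimplePolyhedron.extensions ψ).Finite ∧
      ∀ S : Set X.Region, SimplePolyhedron.IsProperSurface S →
        SimplePolyhedron.BoundaryIsOddSublink S ψ →
        MeromorphicAt
          (fun q => ∑ᶠ σ ∈ SimplePolyhedron.extensions ψ, SimplePolyhedron.state gl σ q) Complex.I ∧
        (((Simplices.eulerChar (SimplePolyhedron.closure S) : ℚ) -
            (X.numRed (Simplices.valueAt ψ) : ℚ) / 2 : ℚ) : WithTop ℚ) ≤
          Quantum.ordI
            (fun q => ∑ᶠ σ ∈ SimplePolyhedron.extensions ψ, SimplePolyhedron.state gl σ q)) := by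
  refine ⟨fun σ hσ => ?_, fun hX ψ => ⟨SimplePolyhedron.finite_extensions hX ψ,
    fun S hS hψ => ?_⟩⟩
  · obtain ⟨N, hN, hle⟩ := SimplePolyhedron.exists_ordGE_state gl hσ
    refine ⟨hN.1, hN.le_ordI ?_⟩
    have hle' : (2 * Simplices.eulerChar (SimplePolyhedron.closure (SimplePolyhedron.oddRegions σ)) -
      X.numRed (SimplePolyhedron.bdryColor σ) : ℚ) ≤ 2 * N := by exact_mod_cast hle
    linarith
  · have hN := SimplePolyhedron.ordGE_stateSum gl hX ψ hS hψ
    refine ⟨hN.1, hN.le_ordI ?_⟩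
    have hle : 2 * Simplices.eulerChar (SimplePolyhedron.closure S) -
        X.numRed (Simplices.valueAt ψ) ≤
        2 * ((2 * Simplices.eulerChar (SimplePolyhedron.closure S) -
          X.numRed (Simplices.valueAt ψ) + 1) / 2) := by omega
    have hle' := (Int.cast_le (R := ℚ)).2 hle
    push_cast at hle' ⊢
    linarith
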